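/- Consider the equations $$u_{tt}=(H(u)u_x)_x+K(u)u_x, \qquad (*)$$ where $H,K$ are smooth ($C^\infty$) real functions on an open interval $I$ (the range of $u$), $H\neq0$ everywhere on $I$, and $H,K$ are not both constant. Let $T,X$ be nonempty open intervals. $A^{\max}$ denotes the set of all smooth vector fields $Q=\tau\partial_t+\xi\partial_x+\eta\partial_u$ on $T\times X\times I$ (coefficients depending on $t,x,u$) satisfying the infinitesimal invariance criterion $\mathrm{pr}^{(2)}Q(\Delta)|_{\Delta=0}=0$, $\Delta=u_{tt}-(H(u)u_x)_x-K(u)u_x$, and $A^{\ker}=\langle\partial_t,\partial_x\rangle$. Let $G_1^\sim$ be the group of the transformations $$\tilde t=\epsilon_4t+\epsilon_1,\ \ \tilde x=\epsilon_5x+\epsilon_2,\ \ \tilde u=\epsilon_6u+\epsilon_3,\ \ \tilde H=\epsilon_4^{-2}\epsilon_5^2H,\ \ \tilde K=\epsilon_4^{-2}\epsilon_5K,\qquad \epsilon_4\epsilon_5\epsilon_6\ne0,$$ with $\tilde H,\tilde K$ defined on the image of $I$. Consider the following table of functions and bases (besides $\partial_t,\partial_x$, which belong to every basis). Below $\sigma=1$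 or $\sigma=-1$ is the sign of $H$. 1. $H$ arbitrary, $K=0$, where $H$ is not of the form $he^{cu}$ or $h|u+b|^{p}$ on $I$ ($h,c,b,p$ constants): $\ t\partial_t+x\partial_x$. 2. $H=\sigma e^{\mu u}$, $K=\sigma e^{\nu u}$, $(\mu,\nu)\neq(0,0)$: $\ (\mu-2\nu)t\partial_t+2(\mu-\nu)x\partial_x+2\partial_u$. 3. $H=\sigma e^{u}$, $K=\sigma$: $\ t\partial_t+2x\partial_x+2\partial_u$. 4. $H=\sigma e^{u}$, $K=0$: $\ t\partial_t-2\partial_u,\ x\partial_x+2\partial_u$. 5. $H=\sigma|u|^{\mu}$, $K=\sigma|u|^{\nu}$, $(\mu,\nu)\ne(0,0),(-2,-2),(-4,-4)$: $\ (\mu-2\nu)t\partial_t+2(\mu-\nu)x\partial_x+2u\partial_u$. 6. $H=\sigma|u|^{\mu}$, $K=\sigma$, $\mu\neq0$: $\ \mu t\partial_t+2\mu x\partial_x+2u\partial_u$. 7. (a) $H=\sigma|u|^{\mu}$, $K=0$, $\mu\neq0,-4,-4/3$: $\ \mu t\partial_t-2u\partial_u,\ \mu x\partial_x+2u\partial_u$.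 (b) $H=K=\sigma u^{-2}$: $\ t\partial_t+u\partial_u,\ e^{-x}(\partial_x+u\partial_u)$. 8. $H=K=\sigma u^{-4}$: $\ 2t\partial_t+u\partial_u,\ t^2\partial_t+tu\partial_u$. 9. $H=\sigma u^{-4}$, $K=0$: $\ 2t\partial_t+u\partial_u,\ 2x\partial_x-u\partial_u,\ t^2\partial_t+tu\partial_u$. 10. $H=\sigma|u|^{-4/3}$, $K=0$: $\ 2t\partial_t+3u\partial_u,\ 2x\partial_x-3u\partial_u,\ x^2\partial_x-3xu\partial_u$. In cases 5–10 the interval $I$ does not contain $0$, except that case 5 with $\mu=0$ and $\nu=n$ a positive integer also includes $H=\sigma$, $K=\sigma u^n$ on intervals $I\ni0$. Call the parameters in case 2 normalized if $(\mu,\nu)=(0,1)$, or $\mu=1$ and $\nu\ne0$; in case 5 if $\nu\neq0$; in the other cases always. **Theorem.** (i) Always $A^{\ker}\subseteq A^{\max}$, and $A^{\max}\ne A^{\ker}$ if and only if $(*)$ is $G_1^\sim$-equivalent to an equation of the table with normalized parameters. (ii) For every equation of the table, $\partial_t$, $\partial_x$ and the listed operators form a basis of $A^{\max}$. (iii) Two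 $G_1^\sim$-equivalent equations of the table with normalized parameters belong to the same case, with the same parameters and the same $\sigma$. (iv) Case 7b is reduced to case 7a with $\mu=-2$ by $\tilde t=t$, $\tilde x=e^x$, $\tilde u=e^{-x}u$: for open $T\subseteq\mathbb R$, $Y\subseteq(0,\infty)$, a function $\tilde u(t,\tilde x)$ is a $C^2$ nowhere vanishing solution of $\tilde u_{tt}=(\sigma\tilde u^{-2}\tilde u_{\tilde x})_{\tilde x}$ on $T\times Y$ if and only if $u(t,x)=e^x\tilde u(t,e^x)$ is such a solution of $u_{tt}=(\sigma u^{-2}u_x)_x+\sigma u^{-2}u_x$ on $T\times\{x: e^x\in Y\}$. -/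

import Mathlib

open scoped ContDiff

/-- Nonempty open intervals of the real line (bounded or not). -/
def IsOpenInterval (S : Set ℝ) : Prop := IsOpen S ∧ S.OrdConnected ∧ S.Nonempty

/-- An equation `u_tt = (H(u) u_x)_x + K(u) u_x`: smooth functions `H`, `K` of `u` on an open
interval `I`, with `H ≠ 0` and `(H_u, K_u) ≠ (0, 0)`. Values of `H`, `K` outside `I` play no role. -/
structure TelegraphEq where
  I : Set ℝ
  H : ℝ → ℝ
  K : ℝ → ℝ
  interval : IsOpenInterval I
  smooth_H : ContDiffOn ℝ ∞ H I
  smooth_K : ContDiffOn ℝ ∞ K I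
  H_ne_zero : ∀ u ∈ I, H u ≠ 0
  nonlinear : ¬ ((∀ u ∈ I, deriv H u = 0) ∧ (∀ u ∈ I, deriv K u = 0))

/-! ### Second-order jets, total derivatives, prolongation -/

/-- Points of the second-order jet space of functions `u(t, x)`. -/
structure Jet where
  t : ℝ
  x : ℝ
  u : ℝ
  ut : ℝ
  ux : ℝ
  utt : ℝ
  utx : ℝ
  uxx : ℝ

namespace Jet

/-- Total derivative `D_t`, applied to functions of `t, x, u, u_t, u_x`. -/
noncomputable def Dt (F : Jet → ℝ) (j : Jet) : ℝ :=
  deriv (fun s => F { j with t := s }) j.t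
    + j.ut * deriv (fun s => F { j with u := s }) j.u
    + j.utt * deriv (fun s => F { j with ut := s }) j.ut
    + j.utx * deriv (fun s => F { j with ux := s }) j.ux

/-- Total derivative `D_x`, applied to functions of `t, x, u, u_t, u_x`. -/
noncomputable def Dx (F : Jet → ℝ) (j : Jet) : ℝ :=
  deriv (fun s => F { j with x := s }) j.x
    + j.ux * deriv (fun s => F { j with u := s }) j.u
    + j.utx * deriv (fun s => F { j with ut := s }) j.ut
    + j.uxx * deriv (fun s => F { j with ux := s }) j.ux

end Jet

/-- A vector field `τ ∂_t + ξ ∂_x + η ∂_u` on the space of `(t, x, u)`, as the map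
`(t, x, u) ↦ (τ, ξ, η)`. -/
abbrev VField := ℝ × ℝ × ℝ → ℝ × ℝ × ℝ

namespace VField

/-- The coefficient `τ`, as a function on the jet space. -/
def τ (Q : VField) (j : Jet) : ℝ := (Q (j.t, j.x, j.u)).1

/-- The coefficient `ξ`, as a function on the jet space. -/
def ξ (Q : VField) (j : Jet) : ℝ := (Q (j.t, j.x, j.u)).2.1

/-- The coefficient `η`, as a function on the jet space. -/
def η (Q : VField) (j : Jet) : ℝ := (Q (j.t, j.x, j.u)).2.2

/-- The coefficient of `∂_{u_t}` in the prolongation. -/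
noncomputable def ηt (Q : VField) (j : Jet) : ℝ :=
  Jet.Dt Q.η j - j.ut * Jet.Dt Q.τ j - j.ux * Jet.Dt Q.ξ j

/-- The coefficient of `∂_{u_x}` in the prolongation. -/
noncomputable def ηx (Q : VField) (j : Jet) : ℝ :=
  Jet.Dx Q.η j - j.ut * Jet.Dx Q.τ j - j.ux * Jet.Dx Q.ξ j

/-- The coefficient of `∂_{u_tt}` in the prolongation. -/
noncomputable def ηtt (Q : VField) (j : Jet) : ℝ :=
  Jet.Dt Q.ηt j - j.utt * Jet.Dt Q.τ j - j.utx * Jet.Dt Q.ξ j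

/-- The coefficient of `∂_{u_tx}` in the prolongation. -/
noncomputable def ηtx (Q : VField) (j : Jet) : ℝ :=
  Jet.Dx Q.ηt j - j.utt * Jet.Dx Q.τ j - j.utx * Jet.Dx Q.ξ j

/-- The coefficient of `∂_{u_xx}` in the prolongation. -/
noncomputable def ηxx (Q : VField) (j : Jet) : ℝ :=
  Jet.Dx Q.ηx j - j.utx * Jet.Dx Q.τ j - j.uxx * Jet.Dx Q.ξ j

/-- The second prolongation of `Q` applied to a function `F` on the jet space. -/
noncomputable def pr2 (Q : VField) (F : Jet → ℝ) (j : Jet) : ℝ :=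
  Q.τ j * deriv (fun s => F { j with t := s }) j.t
    + Q.ξ j * deriv (fun s => F { j with x := s }) j.x
    + Q.η j * deriv (fun s => F { j with u := s }) j.u
    + Q.ηt j * deriv (fun s => F { j with ut := s }) j.ut
    + Q.ηx j * deriv (fun s => F { j with ux := s }) j.ux
    + Q.ηtt j * deriv (fun s => F { j with utt := s }) j.utt
    + Q.ηtx j * deriv (fun s => F { j with utx := s }) j.utx
    + Q.ηxx j * deriv (fun s => F { j with uxx := s }) j.uxx

/-- The vector field with coefficients `τ, ξ, η`. -/
def mk (τ ξ η : ℝ → ℝ → ℝ → ℝ) : VField :=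
  fun p => (τ p.1 p.2.1 p.2.2, ξ p.1 p.2.1 p.2.2, η p.1 p.2.1 p.2.2)

/-- `∂_t`. -/
def dt : VField := mk (fun _ _ _ => 1) (fun _ _ _ => 0) (fun _ _ _ => 0)

/-- `∂_x`. -/
def dx : VField := mk (fun _ _ _ => 0) (fun _ _ _ => 1) (fun _ _ _ => 0)

end VField

/-! ### Lie symmetries -/

namespace TelegraphEq

/-- The function `Δ = u_tt - (H(u) u_x)_x - K(u) u_x` on the jet space. -/
noncomputable def Δ (E : TelegraphEq) (j : Jet) : ℝ :=
  j.utt - Jet.Dx (fun i => E.H i.u * i.ux) j - E.K j.u * j.ux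

/-- The part `T × X × I` of the space of `(t, x, u)`. -/
def domain (E : TelegraphEq) (T X : Set ℝ) : Set (ℝ × ℝ × ℝ) := T ×ˢ X ×ˢ E.I

/-- `Q` is a smooth vector field on `T × X × I` that satisfies the infinitesimal invariance
criterion `pr⁽²⁾ Q (Δ) = 0` wherever `Δ = 0`. -/
def IsLieSymmetry (E : TelegraphEq) (T X : Set ℝ) (Q : VField) : Prop :=
  ContDiffOn ℝ ∞ Q (E.domain T X) ∧
    ∀ j : Jet, (j.t, j.x, j.u) ∈ E.domain T X → E.Δ j = 0 → Q.pr2 E.Δ j = 0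

/-- The maximal Lie invariance algebra `A^max` on `T × X × I`. -/
def maxAlgebra (E : TelegraphEq) (T X : Set ℝ) : Set (E.domain T X → ℝ × ℝ × ℝ) :=
  { v | ∃ Q : VField, E.IsLieSymmetry T X Q ∧ v = (E.domain T X).domRestrict Q }

/-- The list of vector fields `B`, restricted to `T × X × I`, as a family. -/
def family (E : TelegraphEq) (T X : Set ℝ) (B : List VField) :
    Fin B.length → E.domain T X → ℝ × ℝ × ℝ :=
  fun i => (E.domain T X).domRestrict (B.get i)

/-- The linear span of the vector fields in `B` on `T × X × I`. -/
def spanOf (E : TelegraphEq) (T X : Set ℝ) (B : List VField) :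
    Submodule ℝ (E.domain T X → ℝ × ℝ × ℝ) :=
  Submodule.span ℝ (Set.range (E.family T X B))

/-- The kernel algebra `A^ker = ⟨∂_t, ∂_x⟩` on `T × X × I`. -/
def kerAlgebra (E : TelegraphEq) (T X : Set ℝ) : Submodule ℝ (E.domain T X → ℝ × ℝ × ℝ) :=
  E.spanOf T X [VField.dt, VField.dx]

end TelegraphEq

/-! ### The equivalence group -/

/-- A transformation from `G₁^∼`: `t ↦ ε₄ t + ε₁`, `x ↦ ε₅ x + ε₂`, `u ↦ ε₆ u + ε₃`. -/
structure EquivTransf where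
  ε₁ : ℝ
  ε₂ : ℝ
  ε₃ : ℝ
  ε₄ : ℝ
  ε₅ : ℝ
  ε₆ : ℝ
  nondegenerate : ε₄ * ε₅ * ε₆ ≠ 0

/-- The transformation `g` maps the equation `E` to the equation `E'`, that is
`H' = ε₄⁻² ε₅² H` and `K' = ε₄⁻² ε₅ K` at the transformed values of `u`. -/
def EquivTransf.Maps (g : EquivTransf) (E E' : TelegraphEq) : Prop :=
  E'.I = (fun u => u * g.ε₆ + g.ε₃) '' E.I ∧
    ∀ u ∈ E.I, E'.H (u * g.ε₆ + g.ε₃) = E.H u * g.ε₄ ^ (-2 : ℤ) * g.ε₅ ^ 2 ∧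
      E'.K (u * g.ε₆ + g.ε₃) = E.K u * g.ε₄ ^ (-2 : ℤ) * g.ε₅

/-- Equivalence of equations with respect to `G₁^∼`. -/
def TelegraphEq.Equivalent (E E' : TelegraphEq) : Prop := ∃ g : EquivTransf, g.Maps E E'

/-! ### The classification table -/

/-- The rows of the table that extend the kernel algebra, with their parameters; the names give
the form of `H` and then of `K`. -/
inductive Row where
  | any_zero : Row
  | exp_exp (μ ν : ℝ) : Row
  | exp_one : Row
  | exp_zero : Row
  | pow_pow (μ ν : ℝ) : Row
  | pow_one (μ : ℝ) : Row
  | pow_zero (μ : ℝ) : Row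
  | inv2_inv2 : Row
  | inv4_inv4 : Row
  | inv4_zero : Row
  | inv43_zero : Row

namespace Row

/-- The parameter values for which the row gives the maximal invariance algebra. -/
def Admissible : Row → Prop
  | exp_exp μ ν => (μ, ν) ≠ (0, 0)
  | pow_pow μ ν => (μ, ν) ≠ (0, 0) ∧ (μ, ν) ≠ (-2, -2) ∧ (μ, ν) ≠ (-4, -4)
  | pow_one μ => μ ≠ 0
  | pow_zero μ => μ ≠ 0 ∧ μ ≠ -4 ∧ μ ≠ -4 / 3
  | _ => True

/-- The parameter values that remain modulo `G₁^∼`, without the overlap of the rows with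
`K = e^{νu}`, `K = |u|^ν` and the rows with `K = 1` at `ν = 0`. -/
def Normalized (r : Row) : Prop :=
  r.Admissible ∧
    match r with
    | exp_exp μ ν => (μ = 1 ∧ ν ≠ 0) ∨ (μ = 0 ∧ ν = 1)
    | pow_pow _ ν => ν ≠ 0
    | _ => True

/-- `E` is an equation of the row `r`, with `σ = 1` or `σ = -1` the sign of `H`: the functions in
the table are multiplied by `σ`. Powers `|u|^p` are considered on intervals not containing `0`;
in the only case where a power can be smooth through `0` (constant `H`, and `K = u^n` with a
positive integer `n`) the interval may contain `0`. In the row with arbitrary `H`, the functions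
which are affinely equivalent to exponentials and powers are left to the other rows. -/
def Profile (σ : ℝ) (E : TelegraphEq) (r : Row) : Prop :=
  (σ = 1 ∨ σ = -1) ∧
  match r with
  | any_zero =>
      (∀ u ∈ E.I, 0 < σ * E.H u ∧ E.K u = 0) ∧
        (∀ h c : ℝ, ¬ ∀ u ∈ E.I, E.H u = h * Real.exp (c * u)) ∧
        (∀ h b p : ℝ, ¬ ∀ u ∈ E.I, E.H u = h * |u + b| ^ p)
  | exp_exp μ ν => ∀ u ∈ E.I, E.H u = σ * Real.exp (μ * u) ∧ E.K u = σ * Real.exp (ν * u)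
  | exp_one => ∀ u ∈ E.I, E.H u = σ * Real.exp u ∧ E.K u = σ
  | exp_zero => ∀ u ∈ E.I, E.H u = σ * Real.exp u ∧ E.K u = 0
  | pow_pow μ ν =>
      (0 ∉ E.I ∧ ∀ u ∈ E.I, E.H u = σ * |u| ^ μ ∧ E.K u = σ * |u| ^ ν) ∨
        (0 ∈ E.I ∧ μ = 0 ∧ ∃ n : ℕ, 0 < n ∧ ν = n ∧ ∀ u ∈ E.I, E.H u = σ ∧ E.K u = σ * u ^ n)
  | pow_one μ => 0 ∉ E.I ∧ ∀ u ∈ E.I, E.H u = σ * |u| ^ μ ∧ E.K u = σ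
  | pow_zero μ => 0 ∉ E.I ∧ ∀ u ∈ E.I, E.H u = σ * |u| ^ μ ∧ E.K u = 0
  | inv2_inv2 =>
      0 ∉ E.I ∧ ∀ u ∈ E.I, E.H u = σ * u ^ (-2 : ℤ) ∧ E.K u = σ * u ^ (-2 : ℤ)
  | inv4_inv4 =>
      0 ∉ E.I ∧ ∀ u ∈ E.I, E.H u = σ * u ^ (-4 : ℤ) ∧ E.K u = σ * u ^ (-4 : ℤ)
  | inv4_zero => 0 ∉ E.I ∧ ∀ u ∈ E.I, E.H u = σ * u ^ (-4 : ℤ) ∧ E.K u = 0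
  | inv43_zero => 0 ∉ E.I ∧ ∀ u ∈ E.I, E.H u = σ * |u| ^ (-4 / 3 : ℝ) ∧ E.K u = 0

/-- The operators listed in the row besides `∂_t`, `∂_x`. -/
noncomputable def extension : Row → List VField
  | any_zero => [.mk (fun t _ _ => t) (fun _ x _ => x) (fun _ _ _ => 0)]
  | exp_exp μ ν =>
      [.mk (fun t _ _ => (μ - 2 * ν) * t) (fun _ x _ => 2 * (μ - ν) * x) (fun _ _ _ => 2)]
  | exp_one => [.mk (fun t _ _ => t) (fun _ x _ => 2 * x) (fun _ _ _ => 2)]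
  | exp_zero =>
      [.mk (fun t _ _ => t) (fun _ _ _ => 0) (fun _ _ _ => -2),
       .mk (fun _ _ _ => 0) (fun _ x _ => x) (fun _ _ _ => 2)]
  | pow_pow μ ν =>
      [.mk (fun t _ _ => (μ - 2 * ν) * t) (fun _ x _ => 2 * (μ - ν) * x) (fun _ _ u => 2 * u)]
  | pow_one μ => [.mk (fun t _ _ => μ * t) (fun _ x _ => 2 * μ * x) (fun _ _ u => 2 * u)]
  | pow_zero μ =>
      [.mk (fun t _ _ => μ * t) (fun _ _ _ => 0) (fun _ _ u => -2 * u),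
       .mk (fun _ _ _ => 0) (fun _ x _ => μ * x) (fun _ _ u => 2 * u)]
  | inv2_inv2 =>
      [.mk (fun t _ _ => t) (fun _ _ _ => 0) (fun _ _ u => u),
       .mk (fun _ _ _ => 0) (fun _ x _ => Real.exp (-x)) (fun _ x u => Real.exp (-x) * u)]
  | inv4_inv4 =>
      [.mk (fun t _ _ => 2 * t) (fun _ _ _ => 0) (fun _ _ u => u),
       .mk (fun t _ _ => t ^ 2) (fun _ _ _ => 0) (fun t _ u => t * u)]
  | inv4_zero =>
      [.mk (fun t _ _ => 2 * t) (fun _ _ _ => 0) (fun _ _ u => u),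
       .mk (fun _ _ _ => 0) (fun _ x _ => 2 * x) (fun _ _ u => -u),
       .mk (fun t _ _ => t ^ 2) (fun _ _ _ => 0) (fun t _ u => t * u)]
  | inv43_zero =>
      [.mk (fun t _ _ => 2 * t) (fun _ _ _ => 0) (fun _ _ u => 3 * u),
       .mk (fun _ _ _ => 0) (fun _ x _ => 2 * x) (fun _ _ u => -3 * u),
       .mk (fun _ _ _ => 0) (fun _ x _ => x ^ 2) (fun _ x u => -3 * x * u)]

/-- The basis of `A^max` listed in the row. -/
noncomputable def basis (r : Row) : List VField := VField.dt :: VField.dx :: r.extension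

end Row

/-! ### Solutions -/

/-- `u` is a (twice continuously differentiable, nowhere vanishing) solution on `T × X` of
`u_tt = (H(u) u_x)_x + K(u) u_x`. -/
def IsNonvanishingSolution (H K : ℝ → ℝ) (T X : Set ℝ) (u : ℝ → ℝ → ℝ) : Prop :=
  ContDiffOn ℝ 2 (fun p : ℝ × ℝ => u p.1 p.2) (T ×ˢ X) ∧
    ∀ t ∈ T, ∀ x ∈ X, u t x ≠ 0 ∧
      deriv (fun s => deriv (fun s' => u s' x) s) t =
        deriv (fun y => H (u t y) * deriv (fun y' => u t y') y) x
          + K (u t x) * deriv (fun y => u t y) x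

/-!
The criterion `pr⁽²⁾Q(Δ) = 0` on `Δ = 0` is a polynomial identity in the free jet variables
`u_t, u_x, u_tx, u_xx`. Comparing coefficients (`IsLieSymmetry.determining`) shows that
`τ = τ(t)`, `ξ = ξ(x)`, that `η` is affine in `u`, and that `H'η = 2H(ξ' - τ')` holds together with
two further equations that involve `K`; conversely these equations suffice (`Determining.isLieSymmetry`).
Hence the symmetries form a linear space, and every operator of the table is checked directly.

If `H` is not constant and `ξ' ≠ τ'` somewhere, the equation `H'η = 2H(ξ' - τ')` says that
`m H' = H` for an affine function `m` of `u`, so `H` is an exponential or a power; otherwise the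
symmetry is a combination of `∂_t`, `∂_x` and `t∂_t + x∂_x` (`IsLieSymmetry.dichotomy`). In the
first case `η = 2m(ξ' - τ')`, and what remains is a system of ordinary differential equations for
`τ` and `ξ` (`IsLieSymmetry.reduced`). If `K ≠ 0`, its solutions are affine functions unless `H` and
`K` are both proportional to a power `-4` or to the same power `-2` of an affine function of `u`
(`reduced_alternatives`); if `K = 0`, they are polynomials of degree at
most two. Constant `H` is treated separately
(`IsLieSymmetry.of_deriv_H_eq_zero`). This gives the bases of the table.

An additional symmetry for `K ≠ 0` therefore forces `m H' = μ H` and `m K' = ν K` with a common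
affine `m ≠ 0` (`exists_affine_relations`). Integration yields exponentials or powers; when `m`
vanishes inside the interval, `H` is constant and smoothness forces `K` to be a monomial
(`IsOpenInterval.euler_solution_zero_mem`). An affine change of `u` and scalings of `t` and `x`
then lead to a row of the table (`hasRow_of_relations`, `hasRow_of_K_eq_zero`). Conversely the
relations are inherited along equivalences and produce a symmetry with `η = 2m ≠ 0`.

For the inequivalence of the rows: if a nonzero function is an eigenfunction of two operators
`m₁ d/du` and `m₂ d/du`, then `m₁` and `m₂` are proportional as the eigenvalues are
(`affine_proportional`). An equivalence transports the relations of one row to those of the other,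
so the type of the row (exponential or power) and the exponents agree; the sign of `H` is preserved
because `H` is multiplied by the square `ε₄⁻² ε₅²` (`Row.eq_of_equivalent`).

The substitution `u(t, x) = eˣ w(t, eˣ)` turns the right-hand side for `H = K = σ u⁻²` into `eˣ`
times the one for `H = σ w⁻²`, `K = 0` (`flux_exp_substitution`).
-/

/-! ### Partial derivatives in `t`, `x`, `u` -/

/-- The partial derivative `∂f/∂t` of a function of `(t, x, u)`. -/
noncomputable def pdt (f : ℝ × ℝ × ℝ → ℝ) (p : ℝ × ℝ × ℝ) : ℝ :=
  deriv (fun s => f (s, p.2.1, p.2.2)) p.1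

/-- The partial derivative `∂f/∂x` of a function of `(t, x, u)`. -/
noncomputable def pdx (f : ℝ × ℝ × ℝ → ℝ) (p : ℝ × ℝ × ℝ) : ℝ :=
  deriv (fun s => f (p.1, s, p.2.2)) p.2.1

/-- The partial derivative `∂f/∂u` of a function of `(t, x, u)`. -/
noncomputable def pdu (f : ℝ × ℝ × ℝ → ℝ) (p : ℝ × ℝ × ℝ) : ℝ :=
  deriv (fun s => f (p.1, p.2.1, s)) p.2.2

section PartialDerivatives

variable {f g : ℝ × ℝ × ℝ → ℝ} {p : ℝ × ℝ × ℝ} {U : Set (ℝ × ℝ × ℝ)}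

lemma hasDerivAt_section_t (hf : DifferentiableAt ℝ f p) :
    HasDerivAt (fun s => f (s, p.2.1, p.2.2)) (fderiv ℝ f p (1, 0, 0)) p.1 :=
  hf.hasFDerivAt.comp_hasDerivAt (f := fun s : ℝ => (s, p.2.1, p.2.2)) p.1
    ((hasDerivAt_id p.1).prodMk ((hasDerivAt_const _ _).prodMk (hasDerivAt_const _ _)))

lemma hasDerivAt_section_x (hf : DifferentiableAt ℝ f p) :
    HasDerivAt (fun s => f (p.1, s, p.2.2)) (fderiv ℝ f p (0, 1, 0)) p.2.1 :=
  hf.hasFDerivAt.comp_hasDerivAt (f := fun s : ℝ => (p.1, s, p.2.2)) p.2.1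
    ((hasDerivAt_const _ _).prodMk ((hasDerivAt_id p.2.1).prodMk (hasDerivAt_const _ _)))

lemma hasDerivAt_section_u (hf : DifferentiableAt ℝ f p) :
    HasDerivAt (fun s => f (p.1, p.2.1, s)) (fderiv ℝ f p (0, 0, 1)) p.2.2 :=
  hf.hasFDerivAt.comp_hasDerivAt (f := fun s : ℝ => (p.1, p.2.1, s)) p.2.2
    ((hasDerivAt_const _ _).prodMk ((hasDerivAt_const _ _).prodMk (hasDerivAt_id p.2.2)))

lemma pdt_eq_fderiv (hf : DifferentiableAt ℝ f p) : pdt f p = fderiv ℝ f p (1, 0, 0) :=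
  (hasDerivAt_section_t hf).deriv

lemma pdx_eq_fderiv (hf : DifferentiableAt ℝ f p) : pdx f p = fderiv ℝ f p (0, 1, 0) :=
  (hasDerivAt_section_x hf).deriv

lemma pdu_eq_fderiv (hf : DifferentiableAt ℝ f p) : pdu f p = fderiv ℝ f p (0, 0, 1) :=
  (hasDerivAt_section_u hf).deriv

lemma hasDerivAt_pdt (hf : DifferentiableAt ℝ f p) :
    HasDerivAt (fun s => f (s, p.2.1, p.2.2)) (pdt f p) p.1 :=
  (hasDerivAt_section_t hf).differentiableAt.hasDerivAt

lemma hasDerivAt_pdx (hf : DifferentiableAt ℝ f p) :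
    HasDerivAt (fun s => f (p.1, s, p.2.2)) (pdx f p) p.2.1 :=
  (hasDerivAt_section_x hf).differentiableAt.hasDerivAt

lemma hasDerivAt_pdu (hf : DifferentiableAt ℝ f p) :
    HasDerivAt (fun s => f (p.1, p.2.1, s)) (pdu f p) p.2.2 :=
  (hasDerivAt_section_u hf).differentiableAt.hasDerivAt

lemma pdt_congr (hU : IsOpen U) (h : Set.EqOn f g U) (hp : p ∈ U) : pdt f p = pdt g p := by
  apply Filter.EventuallyEq.deriv_eq
  have hc : Continuous fun s : ℝ => ((s, p.2.1, p.2.2) : ℝ × ℝ × ℝ) := by fun_prop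
  filter_upwards [(hU.preimage hc).mem_nhds (x := p.1) hp] with s hs using h hs

lemma pdx_congr (hU : IsOpen U) (h : Set.EqOn f g U) (hp : p ∈ U) : pdx f p = pdx g p := by
  apply Filter.EventuallyEq.deriv_eq
  have hc : Continuous fun s : ℝ => ((p.1, s, p.2.2) : ℝ × ℝ × ℝ) := by fun_prop
  filter_upwards [(hU.preimage hc).mem_nhds (x := p.2.1) hp] with s hs using h hs

lemma pdu_congr (hU : IsOpen U) (h : Set.EqOn f g U) (hp : p ∈ U) : pdu f p = pdu g p := by
  apply Filter.EventuallyEq.deriv_eq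
  have hc : Continuous fun s : ℝ => ((p.1, p.2.1, s) : ℝ × ℝ × ℝ) := by fun_prop
  filter_upwards [(hU.preimage hc).mem_nhds (x := p.2.2) hp] with s hs using h hs

lemma ContDiffOn.differentiableAt_of_isOpen {E F : Type*} [NormedAddCommGroup E]
    [NormedSpace ℝ E] [NormedAddCommGroup F] [NormedSpace ℝ F] {f : E → F} {U : Set E} {p : E}
    (hf : ContDiffOn ℝ ∞ f U) (hU : IsOpen U) (hp : p ∈ U) : DifferentiableAt ℝ f p :=
  (hf.contDiffAt (hU.mem_nhds hp)).differentiableAt (by simp)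

lemma contDiffOn_fderiv_apply (hU : IsOpen U) (hf : ContDiffOn ℝ ∞ f U) (e : ℝ × ℝ × ℝ) :
    ContDiffOn ℝ ∞ (fun q => fderiv ℝ f q e) U :=
  (hf.fderiv_of_isOpen hU (by simp)).clm_apply contDiffOn_const

lemma eqOn_pdt (hU : IsOpen U) (hf : ContDiffOn ℝ ∞ f U) :
    Set.EqOn (pdt f) (fun q => fderiv ℝ f q (1, 0, 0)) U :=
  fun _ hq => pdt_eq_fderiv (hf.differentiableAt_of_isOpen hU hq)

lemma eqOn_pdx (hU : IsOpen U) (hf : ContDiffOn ℝ ∞ f U) :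
    Set.EqOn (pdx f) (fun q => fderiv ℝ f q (0, 1, 0)) U :=
  fun _ hq => pdx_eq_fderiv (hf.differentiableAt_of_isOpen hU hq)

lemma eqOn_pdu (hU : IsOpen U) (hf : ContDiffOn ℝ ∞ f U) :
    Set.EqOn (pdu f) (fun q => fderiv ℝ f q (0, 0, 1)) U :=
  fun _ hq => pdu_eq_fderiv (hf.differentiableAt_of_isOpen hU hq)

lemma contDiffOn_pdt (hU : IsOpen U) (hf : ContDiffOn ℝ ∞ f U) : ContDiffOn ℝ ∞ (pdt f) U :=
  (contDiffOn_fderiv_apply hU hf _).congr (eqOn_pdt hU hf)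

lemma contDiffOn_pdx (hU : IsOpen U) (hf : ContDiffOn ℝ ∞ f U) : ContDiffOn ℝ ∞ (pdx f) U :=
  (contDiffOn_fderiv_apply hU hf _).congr (eqOn_pdx hU hf)

lemma contDiffOn_pdu (hU : IsOpen U) (hf : ContDiffOn ℝ ∞ f U) : ContDiffOn ℝ ∞ (pdu f) U :=
  (contDiffOn_fderiv_apply hU hf _).congr (eqOn_pdu hU hf)

lemma fderiv_fderiv_apply_comm (hU : IsOpen U) (hf : ContDiffOn ℝ ∞ f U) (hp : p ∈ U)
    (v w : ℝ × ℝ × ℝ) :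
    fderiv ℝ (fun q => fderiv ℝ f q v) p w = fderiv ℝ (fun q => fderiv ℝ f q w) p v := by
  have hd : DifferentiableAt ℝ (fderiv ℝ f) p :=
    (hf.fderiv_of_isOpen hU (m := ∞) (by simp)).differentiableAt_of_isOpen hU hp
  have hs := ((hf.contDiffAt (hU.mem_nhds hp)).isSymmSndFDerivAt
    (by rw [minSmoothness_of_isRCLikeNormedField]; exact WithTop.coe_le_coe.2 le_top)).eq v w
  have key : ∀ a b : ℝ × ℝ × ℝ,
      fderiv ℝ (fun q => fderiv ℝ f q a) p b = fderiv ℝ (fderiv ℝ f) p b a := by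
    intro a b
    rw [fderiv_clm_apply hd (differentiableAt_const a)]
    simp
  rw [key, key, hs]

lemma pdt_pdu_comm (hU : IsOpen U) (hf : ContDiffOn ℝ ∞ f U) (hp : p ∈ U) :
    pdt (pdu f) p = pdu (pdt f) p := by
  rw [pdt_congr hU (eqOn_pdu hU hf) hp, pdu_congr hU (eqOn_pdt hU hf) hp,
    pdt_eq_fderiv ((contDiffOn_fderiv_apply hU hf _).differentiableAt_of_isOpen hU hp),
    pdu_eq_fderiv ((contDiffOn_fderiv_apply hU hf _).differentiableAt_of_isOpen hU hp),
    fderiv_fderiv_apply_comm hU hf hp]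

lemma pdx_pdu_comm (hU : IsOpen U) (hf : ContDiffOn ℝ ∞ f U) (hp : p ∈ U) :
    pdx (pdu f) p = pdu (pdx f) p := by
  rw [pdx_congr hU (eqOn_pdu hU hf) hp, pdu_congr hU (eqOn_pdx hU hf) hp,
    pdx_eq_fderiv ((contDiffOn_fderiv_apply hU hf _).differentiableAt_of_isOpen hU hp),
    pdu_eq_fderiv ((contDiffOn_fderiv_apply hU hf _).differentiableAt_of_isOpen hU hp),
    fderiv_fderiv_apply_comm hU hf hp]

lemma pdt_lin (hf : DifferentiableAt ℝ f p) (hg : DifferentiableAt ℝ g p) (c : ℝ) :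
    pdt (fun q => f q + c * g q) p = pdt f p + c * pdt g p :=
  ((hasDerivAt_pdt hf).add ((hasDerivAt_pdt hg).const_mul c)).deriv

lemma pdx_lin (hf : DifferentiableAt ℝ f p) (hg : DifferentiableAt ℝ g p) (c : ℝ) :
    pdx (fun q => f q + c * g q) p = pdx f p + c * pdx g p :=
  ((hasDerivAt_pdx hf).add ((hasDerivAt_pdx hg).const_mul c)).deriv

lemma pdu_lin (hf : DifferentiableAt ℝ f p) (hg : DifferentiableAt ℝ g p) (c : ℝ) :
    pdu (fun q => f q + c * g q) p = pdu f p + c * pdu g p :=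
  ((hasDerivAt_pdu hf).add ((hasDerivAt_pdu hg).const_mul c)).deriv

end PartialDerivatives

/-! ### The second prolongation in coordinates -/

/-- The point `(t, x, u)` under a jet. -/
def Jet.base (j : Jet) : ℝ × ℝ × ℝ := (j.t, j.x, j.u)

namespace VField

/-- The coefficient `τ` as a function of `(t, x, u)`. -/
def coeffT (Q : VField) (p : ℝ × ℝ × ℝ) : ℝ := (Q p).1

/-- The coefficient `ξ` as a function of `(t, x, u)`. -/
def coeffX (Q : VField) (p : ℝ × ℝ × ℝ) : ℝ := (Q p).2.1

/-- The coefficient `η` as a function of `(t, x, u)`. -/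
def coeffU (Q : VField) (p : ℝ × ℝ × ℝ) : ℝ := (Q p).2.2

end VField

section Prolongation

variable {U : Set (ℝ × ℝ × ℝ)} {Q : VField}

lemma deriv_of_quadratic {f : ℝ → ℝ} (a b c : ℝ) (hf : ∀ r, f r = a + b * r + c * r ^ 2)
    (s : ℝ) : deriv f s = b + c * (2 * s) := by
  rw [funext hf]
  have h := (((hasDerivAt_id s).const_mul b).const_add a).add
    ((hasDerivAt_pow 2 s).const_mul c)
  refine (h.congr_deriv ?_).deriv
  norm_num

lemma Jet.Dt_base (f : ℝ × ℝ × ℝ → ℝ) (j : Jet) :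
    Jet.Dt (fun i => f i.base) j = pdt f j.base + j.ut * pdu f j.base := by
  simp [Jet.Dt, Jet.base, pdt, pdu]

lemma Jet.Dx_base (f : ℝ × ℝ × ℝ → ℝ) (j : Jet) :
    Jet.Dx (fun i => f i.base) j = pdx f j.base + j.ux * pdu f j.base := by
  simp [Jet.Dx, Jet.base, pdx, pdu]

lemma VField.ηt_eq (Q : VField) (j : Jet) :
    Q.ηt j = pdt Q.coeffU j.base + j.ut * pdu Q.coeffU j.base
      - j.ut * (pdt Q.coeffT j.base + j.ut * pdu Q.coeffT j.base)
      - j.ux * (pdt Q.coeffX j.base + j.ut * pdu Q.coeffX j.base) := by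
  rw [← Jet.Dt_base, ← Jet.Dt_base, ← Jet.Dt_base]; rfl

lemma VField.ηx_eq (Q : VField) (j : Jet) :
    Q.ηx j = pdx Q.coeffU j.base + j.ux * pdu Q.coeffU j.base
      - j.ut * (pdx Q.coeffT j.base + j.ux * pdu Q.coeffT j.base)
      - j.ux * (pdx Q.coeffX j.base + j.ux * pdu Q.coeffX j.base) := by
  rw [← Jet.Dx_base, ← Jet.Dx_base, ← Jet.Dx_base]; rfl

lemma contDiffOn_coeffT (hQ : ContDiffOn ℝ ∞ Q U) : ContDiffOn ℝ ∞ Q.coeffT U :=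
  contDiff_fst.comp_contDiffOn hQ

lemma contDiffOn_coeffX (hQ : ContDiffOn ℝ ∞ Q U) : ContDiffOn ℝ ∞ Q.coeffX U :=
  contDiff_fst.comp_contDiffOn (contDiff_snd.comp_contDiffOn hQ)

lemma contDiffOn_coeffU (hQ : ContDiffOn ℝ ∞ Q U) : ContDiffOn ℝ ∞ Q.coeffU U :=
  contDiff_snd.comp_contDiffOn (contDiff_snd.comp_contDiffOn hQ)

/-- The prolongation coefficient of `∂_{u_tt}` in terms of partial derivatives of `τ, ξ, η`. -/
lemma VField.ηtt_eq (hU : IsOpen U) (hQ : ContDiffOn ℝ ∞ Q U) {j : Jet} (hj : j.base ∈ U) :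
    Q.ηtt j = pdt (pdt Q.coeffU) j.base
      + j.ut * (2 * pdt (pdu Q.coeffU) j.base - pdt (pdt Q.coeffT) j.base)
      - j.ux * pdt (pdt Q.coeffX) j.base
      + j.ut ^ 2 * (pdu (pdu Q.coeffU) j.base - 2 * pdt (pdu Q.coeffT) j.base)
      - 2 * j.ut * j.ux * pdt (pdu Q.coeffX) j.base
      - j.ut ^ 3 * pdu (pdu Q.coeffT) j.base - j.ut ^ 2 * j.ux * pdu (pdu Q.coeffX) j.base
      + j.utt * (pdu Q.coeffU j.base - 2 * pdt Q.coeffT j.base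
        - 3 * j.ut * pdu Q.coeffT j.base - j.ux * pdu Q.coeffX j.base)
      - 2 * j.utx * (pdt Q.coeffX j.base + j.ut * pdu Q.coeffX j.base) := by
  have hT := contDiffOn_coeffT hQ
  have hX := contDiffOn_coeffX hQ
  have hη := contDiffOn_coeffU hQ
  have dt_t {f} (hf : ContDiffOn ℝ ∞ f U) :=
    hasDerivAt_pdt ((contDiffOn_pdt hU hf).differentiableAt_of_isOpen hU hj)
  have dt_u {f} (hf : ContDiffOn ℝ ∞ f U) :=
    hasDerivAt_pdt ((contDiffOn_pdu hU hf).differentiableAt_of_isOpen hU hj)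
  have du_t {f} (hf : ContDiffOn ℝ ∞ f U) :=
    hasDerivAt_pdu ((contDiffOn_pdt hU hf).differentiableAt_of_isOpen hU hj)
  have du_u {f} (hf : ContDiffOn ℝ ∞ f U) :=
    hasDerivAt_pdu ((contDiffOn_pdu hU hf).differentiableAt_of_isOpen hU hj)
  have hcomm {f} (hf : ContDiffOn ℝ ∞ f U) := pdt_pdu_comm hU hf hj
  have h1 : HasDerivAt (fun s => Q.ηt { j with t := s }) (pdt (pdt Q.coeffU) j.base
      + j.ut * pdt (pdu Q.coeffU) j.base
      - j.ut * (pdt (pdt Q.coeffT) j.base + j.ut * pdt (pdu Q.coeffT) j.base)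
      - j.ux * (pdt (pdt Q.coeffX) j.base + j.ut * pdt (pdu Q.coeffX) j.base)) j.t := by
    simp only [VField.ηt_eq]
    exact (((dt_t hη).add ((dt_u hη).const_mul _)).sub
      (((dt_t hT).add ((dt_u hT).const_mul _)).const_mul _)).sub
      (((dt_t hX).add ((dt_u hX).const_mul _)).const_mul _)
  have h2 : HasDerivAt (fun s => Q.ηt { j with u := s }) (pdu (pdt Q.coeffU) j.base
      + j.ut * pdu (pdu Q.coeffU) j.base
      - j.ut * (pdu (pdt Q.coeffT) j.base + j.ut * pdu (pdu Q.coeffT) j.base)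
      - j.ux * (pdu (pdt Q.coeffX) j.base + j.ut * pdu (pdu Q.coeffX) j.base)) j.u := by
    simp only [VField.ηt_eq]
    exact (((du_t hη).add ((du_u hη).const_mul _)).sub
      (((du_t hT).add ((du_u hT).const_mul _)).const_mul _)).sub
      (((du_t hX).add ((du_u hX).const_mul _)).const_mul _)
  have h3 := deriv_of_quadratic (f := fun s => Q.ηt { j with ut := s })
    (pdt Q.coeffU j.base - j.ux * pdt Q.coeffX j.base)
      (pdu Q.coeffU j.base - pdt Q.coeffT j.base - j.ux * pdu Q.coeffX j.base)
      (-pdu Q.coeffT j.base)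
    (fun s => by simp only [VField.ηt_eq, Jet.base]; ring) j.ut
  have h4 := deriv_of_quadratic (f := fun s => Q.ηt { j with ux := s })
    (pdt Q.coeffU j.base + j.ut * pdu Q.coeffU j.base
      - j.ut * (pdt Q.coeffT j.base + j.ut * pdu Q.coeffT j.base))
      (-(pdt Q.coeffX j.base + j.ut * pdu Q.coeffX j.base)) 0
    (fun s => by simp only [VField.ηt_eq, Jet.base]; ring) j.ux
  have e1 : Jet.Dt Q.τ j = _ := Jet.Dt_base Q.coeffT j
  have e2 : Jet.Dt Q.ξ j = _ := Jet.Dt_base Q.coeffX j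
  rw [VField.ηtt, e1, e2, Jet.Dt, h1.deriv, h2.deriv, h3, h4, ← hcomm hη, ← hcomm hT,
    ← hcomm hX]
  ring

/-- The prolongation coefficient of `∂_{u_xx}` in terms of partial derivatives of `τ, ξ, η`. -/
lemma VField.ηxx_eq (hU : IsOpen U) (hQ : ContDiffOn ℝ ∞ Q U) {j : Jet} (hj : j.base ∈ U) :
    Q.ηxx j = pdx (pdx Q.coeffU) j.base
      + j.ux * (2 * pdx (pdu Q.coeffU) j.base - pdx (pdx Q.coeffX) j.base)
      - j.ut * pdx (pdx Q.coeffT) j.base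
      + j.ux ^ 2 * (pdu (pdu Q.coeffU) j.base - 2 * pdx (pdu Q.coeffX) j.base)
      - 2 * j.ut * j.ux * pdx (pdu Q.coeffT) j.base
      - j.ux ^ 3 * pdu (pdu Q.coeffX) j.base - j.ux ^ 2 * j.ut * pdu (pdu Q.coeffT) j.base
      + j.uxx * (pdu Q.coeffU j.base - 2 * pdx Q.coeffX j.base
        - 3 * j.ux * pdu Q.coeffX j.base - j.ut * pdu Q.coeffT j.base)
      - 2 * j.utx * (pdx Q.coeffT j.base + j.ux * pdu Q.coeffT j.base) := by
  have hT := contDiffOn_coeffT hQ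
  have hX := contDiffOn_coeffX hQ
  have hη := contDiffOn_coeffU hQ
  have dx_x {f} (hf : ContDiffOn ℝ ∞ f U) :=
    hasDerivAt_pdx ((contDiffOn_pdx hU hf).differentiableAt_of_isOpen hU hj)
  have dx_u {f} (hf : ContDiffOn ℝ ∞ f U) :=
    hasDerivAt_pdx ((contDiffOn_pdu hU hf).differentiableAt_of_isOpen hU hj)
  have du_x {f} (hf : ContDiffOn ℝ ∞ f U) :=
    hasDerivAt_pdu ((contDiffOn_pdx hU hf).differentiableAt_of_isOpen hU hj)
  have du_u {f} (hf : ContDiffOn ℝ ∞ f U) :=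
    hasDerivAt_pdu ((contDiffOn_pdu hU hf).differentiableAt_of_isOpen hU hj)
  have hcomm {f} (hf : ContDiffOn ℝ ∞ f U) := pdx_pdu_comm hU hf hj
  have h1 : HasDerivAt (fun s => Q.ηx { j with x := s }) (pdx (pdx Q.coeffU) j.base
      + j.ux * pdx (pdu Q.coeffU) j.base
      - j.ut * (pdx (pdx Q.coeffT) j.base + j.ux * pdx (pdu Q.coeffT) j.base)
      - j.ux * (pdx (pdx Q.coeffX) j.base + j.ux * pdx (pdu Q.coeffX) j.base)) j.x := by
    simp only [VField.ηx_eq]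
    exact (((dx_x hη).add ((dx_u hη).const_mul _)).sub
      (((dx_x hT).add ((dx_u hT).const_mul _)).const_mul _)).sub
      (((dx_x hX).add ((dx_u hX).const_mul _)).const_mul _)
  have h2 : HasDerivAt (fun s => Q.ηx { j with u := s }) (pdu (pdx Q.coeffU) j.base
      + j.ux * pdu (pdu Q.coeffU) j.base
      - j.ut * (pdu (pdx Q.coeffT) j.base + j.ux * pdu (pdu Q.coeffT) j.base)
      - j.ux * (pdu (pdx Q.coeffX) j.base + j.ux * pdu (pdu Q.coeffX) j.base)) j.u := by
    simp only [VField.ηx_eq]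
    exact (((du_x hη).add ((du_u hη).const_mul _)).sub
      (((du_x hT).add ((du_u hT).const_mul _)).const_mul _)).sub
      (((du_x hX).add ((du_u hX).const_mul _)).const_mul _)
  have h3 := deriv_of_quadratic (f := fun s => Q.ηx { j with ux := s })
    (pdx Q.coeffU j.base - j.ut * pdx Q.coeffT j.base)
      (pdu Q.coeffU j.base - pdx Q.coeffX j.base - j.ut * pdu Q.coeffT j.base)
      (-pdu Q.coeffX j.base)
    (fun s => by simp only [VField.ηx_eq, Jet.base]; ring) j.ux
  have h4 := deriv_of_quadratic (f := fun s => Q.ηx { j with ut := s })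
    (pdx Q.coeffU j.base + j.ux * pdu Q.coeffU j.base
      - j.ux * (pdx Q.coeffX j.base + j.ux * pdu Q.coeffX j.base))
      (-(pdx Q.coeffT j.base + j.ux * pdu Q.coeffT j.base)) 0
    (fun s => by simp only [VField.ηx_eq, Jet.base]; ring) j.ut
  have e1 : Jet.Dx Q.τ j = _ := Jet.Dx_base Q.coeffT j
  have e2 : Jet.Dx Q.ξ j = _ := Jet.Dx_base Q.coeffX j
  rw [VField.ηxx, e1, e2, Jet.Dx, h1.deriv, h2.deriv, h3, h4, ← hcomm hη, ← hcomm hT,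
    ← hcomm hX]
  ring

lemma TelegraphEq.Δ_eq (E : TelegraphEq) (j : Jet) :
    E.Δ j = j.utt - (deriv E.H j.u * j.ux ^ 2 + E.H j.u * j.uxx) - E.K j.u * j.ux := by
  simp [TelegraphEq.Δ, Jet.Dx]
  ring

/-- The infinitesimal invariance criterion, before its restriction to `Δ = 0`. -/
lemma VField.pr2_Δ (Q : VField) (E : TelegraphEq) {j : Jet} (hj : j.u ∈ E.I) :
    Q.pr2 E.Δ j =
      Q.coeffU j.base * (-(deriv (deriv E.H) j.u * j.ux ^ 2 + deriv E.H j.u * j.uxx)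
        - deriv E.K j.u * j.ux)
      + Q.ηx j * (-(2 * deriv E.H j.u * j.ux) - E.K j.u) + Q.ηtt j - E.H j.u * Q.ηxx j := by
  have hI := E.interval.1
  have hH := (E.smooth_H.differentiableAt_of_isOpen hI hj).hasDerivAt
  have hK := (E.smooth_K.differentiableAt_of_isOpen hI hj).hasDerivAt
  have hH' := ((E.smooth_H.deriv_of_isOpen hI (m := ∞) (by simp)).differentiableAt_of_isOpen
    hI hj).hasDerivAt
  have h1 : HasDerivAt (fun s => E.Δ { j with u := s })
      (-(deriv (deriv E.H) j.u * j.ux ^ 2 + deriv E.H j.u * j.uxx) - deriv E.K j.u * j.ux)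
      j.u := by
    simp only [TelegraphEq.Δ_eq]
    exact (((hH'.mul_const _).add (hH.mul_const _)).const_sub _).sub (hK.mul_const _)
  have h2 : HasDerivAt (fun s => E.Δ { j with ux := s })
      (-(deriv E.H j.u * (↑2 * j.ux ^ (2 - 1) * 1)) - E.K j.u * 1) j.ux := by
    simp only [TelegraphEq.Δ_eq]
    exact (((((hasDerivAt_id j.ux).pow 2).const_mul _).add_const _).const_sub _).sub
      ((hasDerivAt_id j.ux).const_mul _)
  have h3 : HasDerivAt (fun s => E.Δ { j with utt := s }) 1 j.utt := by
    simp only [TelegraphEq.Δ_eq]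
    exact ((hasDerivAt_id j.utt).sub_const _).sub_const _
  have h4 : HasDerivAt (fun s => E.Δ { j with uxx := s }) (-(E.H j.u * 1)) j.uxx := by
    simp only [TelegraphEq.Δ_eq]
    exact ((((hasDerivAt_id j.uxx).const_mul _).const_add _).const_sub _).sub_const _
  have h0 : deriv (fun s => E.Δ { j with t := s }) j.t = 0 ∧
      deriv (fun s => E.Δ { j with x := s }) j.x = 0 ∧
      deriv (fun s => E.Δ { j with ut := s }) j.ut = 0 ∧
      deriv (fun s => E.Δ { j with utx := s }) j.utx = 0 := by
    simp only [TelegraphEq.Δ_eq, deriv_const, and_self]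
  rw [VField.pr2, h1.deriv, h2.deriv, h3.deriv, h4.deriv, h0.1, h0.2.1, h0.2.2.1, h0.2.2.2]
  have e : Q.η j = Q.coeffU j.base := rfl
  rw [e]
  ring

end Prolongation

/-! ### The determining equations -/

section Intervals

lemma IsOpenInterval.eq_of_hasDerivAt_zero {S : Set ℝ} (hS : IsOpenInterval S) {f : ℝ → ℝ}
    (hf : ∀ s ∈ S, HasDerivAt f 0 s) {a b : ℝ} (ha : a ∈ S) (hb : b ∈ S) : f a = f b :=
  hS.1.is_const_of_deriv_eq_zero hS.2.1.isPreconnected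
    (fun s hs => (hf s hs).differentiableAt.differentiableWithinAt)
    (fun s hs => (hf s hs).deriv) ha hb

variable {E : TelegraphEq} {T X : Set ℝ} {f : ℝ × ℝ × ℝ → ℝ}

lemma isOpen_domain (hT : IsOpenInterval T) (hX : IsOpenInterval X) : IsOpen (E.domain T X) :=
  hT.1.prod (hX.1.prod E.interval.1)

lemma eq_of_pdu_eq_zero (hd : ∀ p ∈ E.domain T X, DifferentiableAt ℝ f p)
    (hf : ∀ p ∈ E.domain T X, pdu f p = 0) {t x u v : ℝ} (ht : t ∈ T) (hx : x ∈ X)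
    (hu : u ∈ E.I) (hv : v ∈ E.I) : f (t, x, u) = f (t, x, v) :=
  E.interval.eq_of_hasDerivAt_zero (f := fun s => f (t, x, s)) (fun s hs => by
    have hp : (t, x, s) ∈ E.domain T X := ⟨ht, hx, hs⟩
    simpa [hf _ hp] using hasDerivAt_pdu (hd _ hp)) hu hv

lemma eq_of_pdx_eq_zero (hX : IsOpenInterval X) (hd : ∀ p ∈ E.domain T X, DifferentiableAt ℝ f p)
    (hf : ∀ p ∈ E.domain T X, pdx f p = 0) {t x y u : ℝ} (ht : t ∈ T) (hx : x ∈ X) (hy : y ∈ X)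
    (hu : u ∈ E.I) : f (t, x, u) = f (t, y, u) :=
  hX.eq_of_hasDerivAt_zero (f := fun s => f (t, s, u)) (fun s hs => by
    have hp : (t, s, u) ∈ E.domain T X := ⟨ht, hs, hu⟩
    simpa [hf _ hp] using hasDerivAt_pdx (hd _ hp)) hx hy

lemma eq_of_pdt_eq_zero (hT : IsOpenInterval T) (hd : ∀ p ∈ E.domain T X, DifferentiableAt ℝ f p)
    (hf : ∀ p ∈ E.domain T X, pdt f p = 0) {t s x u : ℝ} (ht : t ∈ T) (hs : s ∈ T) (hx : x ∈ X)
    (hu : u ∈ E.I) : f (t, x, u) = f (s, x, u) :=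
  hT.eq_of_hasDerivAt_zero (f := fun s => f (s, x, u)) (fun s hs => by
    have hp : (s, x, u) ∈ E.domain T X := ⟨hs, hx, hu⟩
    simpa [hf _ hp] using hasDerivAt_pdt (hd _ hp)) ht hs

lemma pdt_eq_of_section (hT : IsOpen T) {t x u v : ℝ} (ht : t ∈ T)
    (h : ∀ s ∈ T, f (s, x, u) = f (s, x, v)) : pdt f (t, x, u) = pdt f (t, x, v) :=
  Filter.EventuallyEq.deriv_eq (by filter_upwards [hT.mem_nhds ht] with s hs using h s hs)

lemma pdx_eq_of_section (hX : IsOpen X) {t x u v : ℝ} (hx : x ∈ X)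
    (h : ∀ s ∈ X, f (t, s, u) = f (t, s, v)) : pdx f (t, x, u) = pdx f (t, x, v) :=
  Filter.EventuallyEq.deriv_eq (by filter_upwards [hX.mem_nhds hx] with s hs using h s hs)

lemma pdt_eq_zero_of_eqOn {U : Set (ℝ × ℝ × ℝ)} (hU : IsOpen U) (h : ∀ p ∈ U, f p = 0)
    {p : ℝ × ℝ × ℝ} (hp : p ∈ U) : pdt f p = 0 := by
  rw [pdt_congr (g := fun _ => 0) hU h hp]; simp [pdt]

lemma pdx_eq_zero_of_eqOn {U : Set (ℝ × ℝ × ℝ)} (hU : IsOpen U) (h : ∀ p ∈ U, f p = 0)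
    {p : ℝ × ℝ × ℝ} (hp : p ∈ U) : pdx f p = 0 := by
  rw [pdx_congr (g := fun _ => 0) hU h hp]; simp [pdx]

lemma pdu_eq_zero_of_eqOn {U : Set (ℝ × ℝ × ℝ)} (hU : IsOpen U) (h : ∀ p ∈ U, f p = 0)
    {p : ℝ × ℝ × ℝ} (hp : p ∈ U) : pdu f p = 0 := by
  rw [pdu_congr (g := fun _ => 0) hU h hp]; simp [pdu]

end Intervals

/-- The determining equations of the symmetries of `u_tt = (H(u) u_x)_x + K(u) u_x`: they state that
`τ = τ(t)`, `ξ = ξ(x)`, `η` is affine in `u`, and how the three coefficients are coupled. -/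
structure Determining (E : TelegraphEq) (T X : Set ℝ) (Q : VField) : Prop where
  τ_u : ∀ p ∈ E.domain T X, pdu Q.coeffT p = 0
  τ_x : ∀ p ∈ E.domain T X, pdx Q.coeffT p = 0
  ξ_u : ∀ p ∈ E.domain T X, pdu Q.coeffX p = 0
  ξ_t : ∀ p ∈ E.domain T X, pdt Q.coeffX p = 0
  η_uu : ∀ p ∈ E.domain T X, pdu (pdu Q.coeffU) p = 0
  η_tu : ∀ p ∈ E.domain T X, 2 * pdt (pdu Q.coeffU) p = pdt (pdt Q.coeffT) p
  eq_H : ∀ p ∈ E.domain T X,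
    deriv E.H p.2.2 * Q.coeffU p = 2 * E.H p.2.2 * (pdx Q.coeffX p - pdt Q.coeffT p)
  eq_K : ∀ p ∈ E.domain T X,
    deriv E.K p.2.2 * Q.coeffU p + 2 * deriv E.H p.2.2 * pdx Q.coeffU p
      = E.K p.2.2 * (pdx Q.coeffX p - 2 * pdt Q.coeffT p)
        - E.H p.2.2 * (2 * pdx (pdu Q.coeffU) p - pdx (pdx Q.coeffX) p)
  eq_wave : ∀ p ∈ E.domain T X,
    pdt (pdt Q.coeffU) p = E.H p.2.2 * pdx (pdx Q.coeffU) p + E.K p.2.2 * pdx Q.coeffU p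

section Determining

variable {E : TelegraphEq} {T X : Set ℝ} {Q : VField}

lemma TelegraphEq.hasDerivAt_H (E : TelegraphEq) {u : ℝ} (hu : u ∈ E.I) :
    HasDerivAt E.H (deriv E.H u) u :=
  (E.smooth_H.differentiableAt_of_isOpen E.interval.1 hu).hasDerivAt

lemma TelegraphEq.hasDerivAt_K (E : TelegraphEq) {u : ℝ} (hu : u ∈ E.I) :
    HasDerivAt E.K (deriv E.K u) u :=
  (E.smooth_K.differentiableAt_of_isOpen E.interval.1 hu).hasDerivAt

lemma TelegraphEq.hasDerivAt_deriv_H (E : TelegraphEq) {u : ℝ} (hu : u ∈ E.I) :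
    HasDerivAt (deriv E.H) (deriv (deriv E.H) u) u :=
  ((E.smooth_H.deriv_of_isOpen E.interval.1 (m := ∞) (by simp)).differentiableAt_of_isOpen
    E.interval.1 hu).hasDerivAt

/-- The `u`-derivative of the equation `H'η = 2H(ξ_x - τ_t)`. -/
lemma Determining.eq_H_u (hT : IsOpenInterval T) (hX : IsOpenInterval X)
    (hQ : ContDiffOn ℝ ∞ Q (E.domain T X)) (h : Determining E T X Q) {p : ℝ × ℝ × ℝ}
    (hp : p ∈ E.domain T X) :
    deriv (deriv E.H) p.2.2 * Q.coeffU p + deriv E.H p.2.2 * pdu Q.coeffU p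
      = 2 * deriv E.H p.2.2 * (pdx Q.coeffX p - pdt Q.coeffT p) := by
  have hU : IsOpen (E.domain T X) := isOpen_domain hT hX
  have hu : p.2.2 ∈ E.I := hp.2.2
  have hcT := contDiffOn_coeffT hQ
  have hcX := contDiffOn_coeffX hQ
  have hcU := contDiffOn_coeffU hQ
  have l := (E.hasDerivAt_deriv_H hu).mul
    (hasDerivAt_pdu (hcU.differentiableAt_of_isOpen hU hp))
  have r := ((E.hasDerivAt_H hu).const_mul 2).mul
    ((hasDerivAt_pdu ((contDiffOn_pdx hU hcX).differentiableAt_of_isOpen hU hp)).sub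
    (hasDerivAt_pdu ((contDiffOn_pdt hU hcT).differentiableAt_of_isOpen hU hp)))
  have e := (l.congr_of_eventuallyEq (f₁ := _) (Filter.EventuallyEq.symm ?_)).unique r
  · rw [← pdx_pdu_comm hU hcX hp, ← pdt_pdu_comm hU hcT hp, pdx_eq_zero_of_eqOn hU h.ξ_u hp,
      pdt_eq_zero_of_eqOn hU h.τ_u hp] at e
    simpa using e
  · filter_upwards [E.interval.1.mem_nhds hu] with s hs
    exact h.eq_H (p.1, p.2.1, s) ⟨hp.1, hp.2.1, hs⟩

/-- The determining equations are sufficient: they make the coefficients of `u_x²`, `u_xx`, `u_x` and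
the free term vanish, up to a multiple of `Δ`. -/
theorem Determining.isLieSymmetry (hT : IsOpenInterval T) (hX : IsOpenInterval X)
    (hQ : ContDiffOn ℝ ∞ Q (E.domain T X)) (h : Determining E T X Q) :
    E.IsLieSymmetry T X Q := by
  refine ⟨hQ, fun j hj hΔ => ?_⟩
  have hU : IsOpen (E.domain T X) := isOpen_domain hT hX
  rw [TelegraphEq.Δ_eq] at hΔ
  rw [VField.pr2_Δ Q E hj.2.2, VField.ηtt_eq hU hQ hj, VField.ηxx_eq hU hQ hj, VField.ηx_eq]
  change j.base ∈ _ at hj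
  have hu : j.base.2.2 = j.u := rfl
  have e1 := h.eq_H_u hT hX hQ hj
  have e2 := h.eq_H _ hj
  have e3 := h.eq_K _ hj
  rw [h.eq_wave _ hj, h.τ_u _ hj, h.τ_x _ hj, h.ξ_u _ hj, h.ξ_t _ hj, h.η_tu _ hj, h.η_uu _ hj,
    pdt_eq_zero_of_eqOn hU h.ξ_t hj, pdt_eq_zero_of_eqOn hU h.τ_u hj,
    pdt_eq_zero_of_eqOn hU h.ξ_u hj, pdu_eq_zero_of_eqOn hU h.τ_u hj,
    pdu_eq_zero_of_eqOn hU h.ξ_u hj, pdx_eq_zero_of_eqOn hU h.τ_x hj,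
    pdx_eq_zero_of_eqOn hU h.τ_u hj, pdx_eq_zero_of_eqOn hU h.ξ_u hj]
  rw [hu] at *
  linear_combination (-j.ux ^ 2) * e1 - j.uxx * e2 - j.ux * e3
    + (pdu Q.coeffU j.base - 2 * pdt Q.coeffT j.base) * hΔ

/-- The invariance criterion on the solution manifold `Δ = 0`: a polynomial identity in the
remaining jet variables `a = u_t`, `b = u_x`, `c = u_tx`, `d = u_xx`. -/
lemma TelegraphEq.IsLieSymmetry.criterion (hT : IsOpenInterval T) (hX : IsOpenInterval X)
    (h : E.IsLieSymmetry T X Q) {p : ℝ × ℝ × ℝ} (hp : p ∈ E.domain T X) (a b c d : ℝ) :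
    Q.coeffU p * (-(deriv (deriv E.H) p.2.2 * b ^ 2 + deriv E.H p.2.2 * d)
        - deriv E.K p.2.2 * b)
      + (pdx Q.coeffU p + b * pdu Q.coeffU p - a * (pdx Q.coeffT p + b * pdu Q.coeffT p)
        - b * (pdx Q.coeffX p + b * pdu Q.coeffX p)) * (-(2 * deriv E.H p.2.2 * b) - E.K p.2.2)
      + (pdt (pdt Q.coeffU) p + a * (2 * pdt (pdu Q.coeffU) p - pdt (pdt Q.coeffT) p)
        - b * pdt (pdt Q.coeffX) p + a ^ 2 * (pdu (pdu Q.coeffU) p - 2 * pdt (pdu Q.coeffT) p)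
        - 2 * a * b * pdt (pdu Q.coeffX) p - a ^ 3 * pdu (pdu Q.coeffT) p
        - a ^ 2 * b * pdu (pdu Q.coeffX) p
        + (deriv E.H p.2.2 * b ^ 2 + E.H p.2.2 * d + E.K p.2.2 * b)
          * (pdu Q.coeffU p - 2 * pdt Q.coeffT p - 3 * a * pdu Q.coeffT p - b * pdu Q.coeffX p)
        - 2 * c * (pdt Q.coeffX p + a * pdu Q.coeffX p))
      - E.H p.2.2 * (pdx (pdx Q.coeffU) p
        + b * (2 * pdx (pdu Q.coeffU) p - pdx (pdx Q.coeffX) p) - a * pdx (pdx Q.coeffT) p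
        + b ^ 2 * (pdu (pdu Q.coeffU) p - 2 * pdx (pdu Q.coeffX) p)
        - 2 * a * b * pdx (pdu Q.coeffT) p - b ^ 3 * pdu (pdu Q.coeffX) p
        - b ^ 2 * a * pdu (pdu Q.coeffT) p
        + d * (pdu Q.coeffU p - 2 * pdx Q.coeffX p - 3 * b * pdu Q.coeffX p
          - a * pdu Q.coeffT p)
        - 2 * c * (pdx Q.coeffT p + b * pdu Q.coeffT p)) = 0 := by
  have hU : IsOpen (E.domain T X) := isOpen_domain hT hX
  let j : Jet := ⟨p.1, p.2.1, p.2.2, a, b,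
    deriv E.H p.2.2 * b ^ 2 + E.H p.2.2 * d + E.K p.2.2 * b, c, d⟩
  have hj : j.base ∈ E.domain T X := hp
  have hΔ : E.Δ j = 0 := by rw [TelegraphEq.Δ_eq]; ring
  have := h.2 j hp hΔ
  rw [VField.pr2_Δ Q E hp.2.2, VField.ηtt_eq hU h.1 hj, VField.ηxx_eq hU h.1 hj,
    VField.ηx_eq] at this
  exact this

/-- Splitting the invariance criterion with respect to the jet variables. -/
theorem TelegraphEq.IsLieSymmetry.determining (hT : IsOpenInterval T) (hX : IsOpenInterval X)
    (h : E.IsLieSymmetry T X Q) : Determining E T X Q := by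
  have hQ := h.1
  have hU : IsOpen (E.domain T X) := isOpen_domain hT hX
  have hcT := contDiffOn_coeffT hQ
  have hcX := contDiffOn_coeffX hQ
  have hcU := contDiffOn_coeffU hQ
  have dcT := fun p hp => hcT.differentiableAt_of_isOpen hU (p := p) hp
  have crit := fun p hp => h.criterion hT hX (p := p) hp
  have hξu : ∀ p ∈ E.domain T X, pdu Q.coeffX p = 0 := fun p hp => by
    linear_combination (-1 / 2) * (crit p hp 1 0 1 0 - crit p hp 1 0 0 0 - crit p hp 0 0 1 0
      + crit p hp 0 0 0 0)
  have hτu : ∀ p ∈ E.domain T X, pdu Q.coeffT p = 0 := fun p hp => by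
    refine (mul_eq_zero.1 (?_ : E.H p.2.2 * _ = 0)).resolve_left (E.H_ne_zero _ hp.2.2)
    linear_combination (1 / 2) * (crit p hp 0 1 1 0 - crit p hp 0 1 0 0 - crit p hp 0 0 1 0
      + crit p hp 0 0 0 0)
  have hξt : ∀ p ∈ E.domain T X, pdt Q.coeffX p = E.H p.2.2 * pdx Q.coeffT p := fun p hp => by
    linear_combination (-1 / 2) * (crit p hp 0 0 1 0 - crit p hp 0 0 0 0)
  have eqH : ∀ p ∈ E.domain T X,
      deriv E.H p.2.2 * Q.coeffU p = 2 * E.H p.2.2 * (pdx Q.coeffX p - pdt Q.coeffT p) :=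
    fun p hp => by
      linear_combination crit p hp 0 0 0 0 - crit p hp 0 0 0 1
  have hut : ∀ p ∈ E.domain T X, ∀ a b : ℝ,
      Q.coeffU p * (-(deriv (deriv E.H) p.2.2 * b ^ 2) - deriv E.K p.2.2 * b)
      + (pdx Q.coeffU p + b * pdu Q.coeffU p - a * pdx Q.coeffT p - b * pdx Q.coeffX p)
        * (-(2 * deriv E.H p.2.2 * b) - E.K p.2.2)
      + (pdt (pdt Q.coeffU) p + a * (2 * pdt (pdu Q.coeffU) p - pdt (pdt Q.coeffT) p)
        - b * pdt (pdt Q.coeffX) p + a ^ 2 * pdu (pdu Q.coeffU) p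
        + (deriv E.H p.2.2 * b ^ 2 + E.K p.2.2 * b) * (pdu Q.coeffU p - 2 * pdt Q.coeffT p))
      - E.H p.2.2 * (pdx (pdx Q.coeffU) p
        + b * (2 * pdx (pdu Q.coeffU) p - pdx (pdx Q.coeffX) p) - a * pdx (pdx Q.coeffT) p
        + b ^ 2 * pdu (pdu Q.coeffU) p) = 0 := fun p hp a b => by
    have := crit p hp a b 0 0
    rw [hτu p hp, hξu p hp, pdt_eq_zero_of_eqOn hU hτu hp, pdt_eq_zero_of_eqOn hU hξu hp,
      pdu_eq_zero_of_eqOn hU hτu hp, pdu_eq_zero_of_eqOn hU hξu hp,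
      pdx_eq_zero_of_eqOn hU hτu hp, pdx_eq_zero_of_eqOn hU hξu hp] at this
    linear_combination this
  have ηuu : ∀ p ∈ E.domain T X, pdu (pdu Q.coeffU) p = 0 := fun p hp => by
    linear_combination (1 / 2) * (hut p hp 1 0 + hut p hp (-1) 0 - 2 * hut p hp 0 0)
  have hHτ : ∀ p ∈ E.domain T X, deriv E.H p.2.2 * pdx Q.coeffT p = 0 := fun p hp => by
    linear_combination (1 / 2) * (hut p hp 1 1 - hut p hp 1 0 - hut p hp 0 1 + hut p hp 0 0)
  have hlin : ∀ p ∈ E.domain T X, E.K p.2.2 * pdx Q.coeffT p + 2 * pdt (pdu Q.coeffU) p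
      - pdt (pdt Q.coeffT) p + E.H p.2.2 * pdx (pdx Q.coeffT) p = 0 := fun p hp => by
    linear_combination (1 / 2) * (hut p hp 1 0 - hut p hp (-1) 0)
  -- `τ` and its derivatives in `t, x` do not depend on `u`
  have τ_const : ∀ t ∈ T, ∀ x ∈ X, ∀ u ∈ E.I, ∀ v ∈ E.I,
      Q.coeffT (t, x, u) = Q.coeffT (t, x, v) := fun t ht x hx u hu v hv =>
    eq_of_pdu_eq_zero dcT hτu ht hx hu hv
  have τx_const : ∀ t ∈ T, ∀ x ∈ X, ∀ u ∈ E.I, ∀ v ∈ E.I,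
      pdx Q.coeffT (t, x, u) = pdx Q.coeffT (t, x, v) := fun t ht x hx u hu v hv =>
    pdx_eq_of_section hX.1 hx fun s hs => τ_const t ht s hs u hu v hv
  have τxx_const : ∀ t ∈ T, ∀ x ∈ X, ∀ u ∈ E.I, ∀ v ∈ E.I,
      pdx (pdx Q.coeffT) (t, x, u) = pdx (pdx Q.coeffT) (t, x, v) := fun t ht x hx u hu v hv =>
    pdx_eq_of_section hX.1 hx fun s hs => τx_const t ht s hs u hu v hv
  have τt_const : ∀ t ∈ T, ∀ x ∈ X, ∀ u ∈ E.I, ∀ v ∈ E.I,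
      pdt Q.coeffT (t, x, u) = pdt Q.coeffT (t, x, v) := fun t ht x hx u hu v hv =>
    pdt_eq_of_section hT.1 ht fun s hs => τ_const s hs x hx u hu v hv
  have τtt_const : ∀ t ∈ T, ∀ x ∈ X, ∀ u ∈ E.I, ∀ v ∈ E.I,
      pdt (pdt Q.coeffT) (t, x, u) = pdt (pdt Q.coeffT) (t, x, v) := fun t ht x hx u hu v hv =>
    pdt_eq_of_section hT.1 ht fun s hs => τt_const s hs x hx u hu v hv
  have ηtu_const : ∀ t ∈ T, ∀ x ∈ X, ∀ u ∈ E.I, ∀ v ∈ E.I,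
      pdt (pdu Q.coeffU) (t, x, u) = pdt (pdu Q.coeffU) (t, x, v) := fun t ht x hx u hu v hv =>
    pdt_eq_of_section hT.1 ht fun s hs => eq_of_pdu_eq_zero
      (fun p hp => (contDiffOn_pdu hU hcU).differentiableAt_of_isOpen hU hp) ηuu hs hx hu hv
  have hτx : ∀ p ∈ E.domain T X, pdx Q.coeffT p = 0 := by
    rintro ⟨t, x, u⟩ ⟨ht, hx, hu⟩
    by_cases hH : ∀ v ∈ E.I, deriv E.H v = 0
    · -- `H` is constant, and `K` takes two different values
      have hHc : ∀ v ∈ E.I, E.H v = E.H u := fun v hv =>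
        E.interval.eq_of_hasDerivAt_zero (fun s hs => hH s hs ▸ E.hasDerivAt_H hs) hv hu
      obtain ⟨v, hv, hvu⟩ : ∃ v ∈ E.I, E.K v ≠ E.K u := by
        by_contra! hc
        refine E.nonlinear ⟨hH, fun v hv => ?_⟩
        refine (Filter.EventuallyEq.deriv_eq (f := fun _ => E.K u) ?_).trans (deriv_const _ _)
        filter_upwards [E.interval.1.mem_nhds hv] with s hs using hc s hs
      have l1 := hlin (t, x, u) ⟨ht, hx, hu⟩
      have l2 := hlin (t, x, v) ⟨ht, hx, hv⟩
      simp only [hHc v hv, τx_const t ht x hx v hv u hu, τxx_const t ht x hx v hv u hu,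
        τtt_const t ht x hx v hv u hu, ηtu_const t ht x hx v hv u hu] at l1 l2
      refine (mul_eq_zero.1 (?_ : (E.K v - E.K u) * _ = 0)).resolve_left (sub_ne_zero.2 hvu)
      linear_combination l2 - l1
    · push Not at hH
      obtain ⟨v, hv, hHv⟩ := hH
      rw [τx_const t ht x hx u hu v hv]
      exact (mul_eq_zero.1 (hHτ (t, x, v) ⟨ht, hx, hv⟩)).resolve_left hHv
  have hξt' : ∀ p ∈ E.domain T X, pdt Q.coeffX p = 0 := fun p hp => by
    rw [hξt p hp, hτx p hp, mul_zero]
  refine ⟨hτu, hτx, hξu, hξt', ηuu, fun p hp => ?_, eqH, fun p hp => ?_, fun p hp => ?_⟩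
  · have := hlin p hp
    rw [hτx p hp, pdx_eq_zero_of_eqOn hU hτx hp] at this
    linear_combination this
  · have l1 := hut p hp 0 1
    have l2 := hut p hp 0 (-1)
    rw [hτx p hp, pdt_eq_zero_of_eqOn hU hξt' hp] at l1 l2
    linear_combination (-1 / 2) * (l1 - l2)
  · have := hut p hp 0 0
    linear_combination this

end Determining

/-! ### Linear structure and explicit symmetries -/

section LinearStructure

variable {E : TelegraphEq} {T X : Set ℝ} {Q R : VField}

/-- Symmetries form a linear space, because the determining equations are linear. -/
lemma TelegraphEq.IsLieSymmetry.add_smul (hT : IsOpenInterval T) (hX : IsOpenInterval X)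
    (hQ : E.IsLieSymmetry T X Q) (hR : E.IsLieSymmetry T X R) (c : ℝ) :
    E.IsLieSymmetry T X (fun p => Q p + c • R p) := by
  have hU : IsOpen (E.domain T X) := isOpen_domain hT hX
  have dQ := hQ.determining hT hX
  have dR := hR.determining hT hX
  have eT : VField.coeffT (fun p => Q p + c • R p) = fun p => Q.coeffT p + c * R.coeffT p := rfl
  have eX : VField.coeffX (fun p => Q p + c • R p) = fun p => Q.coeffX p + c * R.coeffX p := rfl
  have eU : VField.coeffU (fun p => Q p + c • R p) = fun p => Q.coeffU p + c * R.coeffU p := rfl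
  have QT := contDiffOn_coeffT hQ.1
  have QX := contDiffOn_coeffX hQ.1
  have QU := contDiffOn_coeffU hQ.1
  have RT := contDiffOn_coeffT hR.1
  have RX := contDiffOn_coeffX hR.1
  have RU := contDiffOn_coeffU hR.1
  have D {f : ℝ × ℝ × ℝ → ℝ} (hf : ContDiffOn ℝ ∞ f (E.domain T X)) (p) (hp : p ∈ E.domain T X) :=
    hf.differentiableAt_of_isOpen hU hp
  have lt {f g : ℝ × ℝ × ℝ → ℝ} (hf : ContDiffOn ℝ ∞ f (E.domain T X))
      (hg : ContDiffOn ℝ ∞ g (E.domain T X)) :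
      Set.EqOn (pdt fun q => f q + c * g q) (fun q => pdt f q + c * pdt g q) (E.domain T X) :=
    fun p hp => pdt_lin (D hf p hp) (D hg p hp) c
  have lx {f g : ℝ × ℝ × ℝ → ℝ} (hf : ContDiffOn ℝ ∞ f (E.domain T X))
      (hg : ContDiffOn ℝ ∞ g (E.domain T X)) :
      Set.EqOn (pdx fun q => f q + c * g q) (fun q => pdx f q + c * pdx g q) (E.domain T X) :=
    fun p hp => pdx_lin (D hf p hp) (D hg p hp) c
  have lu {f g : ℝ × ℝ × ℝ → ℝ} (hf : ContDiffOn ℝ ∞ f (E.domain T X))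
      (hg : ContDiffOn ℝ ∞ g (E.domain T X)) :
      Set.EqOn (pdu fun q => f q + c * g q) (fun q => pdu f q + c * pdu g q) (E.domain T X) :=
    fun p hp => pdu_lin (D hf p hp) (D hg p hp) c
  refine Determining.isLieSymmetry hT hX (hQ.1.add (hR.1.const_smul c))
    ⟨fun p hp => ?_, fun p hp => ?_, fun p hp => ?_, fun p hp => ?_, fun p hp => ?_,
      fun p hp => ?_, fun p hp => ?_, fun p hp => ?_, fun p hp => ?_⟩
  · rw [eT, lu QT RT hp]; linear_combination dQ.τ_u p hp + c * dR.τ_u p hp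
  · rw [eT, lx QT RT hp]; linear_combination dQ.τ_x p hp + c * dR.τ_x p hp
  · rw [eX, lu QX RX hp]; linear_combination dQ.ξ_u p hp + c * dR.ξ_u p hp
  · rw [eX, lt QX RX hp]; linear_combination dQ.ξ_t p hp + c * dR.ξ_t p hp
  · rw [eU, pdu_congr hU (lu QU RU) hp, lu (contDiffOn_pdu hU QU) (contDiffOn_pdu hU RU) hp]
    linear_combination dQ.η_uu p hp + c * dR.η_uu p hp
  · rw [eU, eT, pdt_congr hU (lu QU RU) hp, pdt_congr hU (lt QT RT) hp,
      lt (contDiffOn_pdu hU QU) (contDiffOn_pdu hU RU) hp,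
      lt (contDiffOn_pdt hU QT) (contDiffOn_pdt hU RT) hp]
    linear_combination dQ.η_tu p hp + c * dR.η_tu p hp
  · rw [eU, eT, eX, lx QX RX hp, lt QT RT hp]
    linear_combination dQ.eq_H p hp + c * dR.eq_H p hp
  · rw [eU, eT, eX, pdx_congr hU (lu QU RU) hp, pdx_congr hU (lx QX RX) hp, lx QU RU hp,
      lx QX RX hp, lt QT RT hp, lx (contDiffOn_pdu hU QU) (contDiffOn_pdu hU RU) hp,
      lx (contDiffOn_pdx hU QX) (contDiffOn_pdx hU RX) hp]
    linear_combination dQ.eq_K p hp + c * dR.eq_K p hp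
  · rw [eU, pdt_congr hU (lt QU RU) hp, pdx_congr hU (lx QU RU) hp, lx QU RU hp,
      lt (contDiffOn_pdt hU QU) (contDiffOn_pdt hU RU) hp,
      lx (contDiffOn_pdx hU QU) (contDiffOn_pdx hU RU) hp]
    linear_combination dQ.eq_wave p hp + c * dR.eq_wave p hp

lemma isLieSymmetry_zero (hT : IsOpenInterval T) (hX : IsOpenInterval X) :
    E.IsLieSymmetry T X (fun _ => 0) := by
  refine Determining.isLieSymmetry hT hX contDiffOn_const ?_
  constructor <;> intro p _ <;> simp [VField.coeffT, VField.coeffX, VField.coeffU, pdt, pdx, pdu]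

lemma spanOf_subset_maxAlgebra (hT : IsOpenInterval T) (hX : IsOpenInterval X) {B : List VField}
    (hB : ∀ Q ∈ B, E.IsLieSymmetry T X Q) :
    (E.spanOf T X B : Set (E.domain T X → ℝ × ℝ × ℝ)) ⊆ E.maxAlgebra T X := by
  intro v hv
  change v ∈ Submodule.span ℝ _ at hv
  induction hv using Submodule.span_induction with
  | mem v hv =>
    obtain ⟨i, rfl⟩ := hv
    exact ⟨B.get i, hB _ (B.get_mem i), rfl⟩
  | zero => exact ⟨_, isLieSymmetry_zero hT hX, rfl⟩
  | add v w _ _ hv hw =>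
    obtain ⟨Q, hQ, rfl⟩ := hv
    obtain ⟨R, hR, rfl⟩ := hw
    exact ⟨_, hQ.add_smul hT hX hR 1, by funext p; simp [Set.domRestrict]⟩
  | smul c v _ hv =>
    obtain ⟨Q, hQ, rfl⟩ := hv
    exact ⟨_, (isLieSymmetry_zero hT hX).add_smul hT hX hQ c, by funext p; simp [Set.domRestrict]⟩

lemma domRestrict_mem_spanOf {B : List VField} (hQ : Q ∈ B) :
    (E.domain T X).domRestrict Q ∈ E.spanOf T X B := by
  obtain ⟨i, rfl⟩ := List.get_of_mem hQ
  exact Submodule.subset_span ⟨i, rfl⟩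

lemma mem_maxAlgebra (hQ : E.IsLieSymmetry T X Q) :
    (E.domain T X).domRestrict Q ∈ E.maxAlgebra T X := ⟨Q, hQ, rfl⟩

end LinearStructure

section ExplicitSymmetries

variable {E : TelegraphEq} {T X : Set ℝ}

lemma isLieSymmetry_dt (hT : IsOpenInterval T) (hX : IsOpenInterval X) :
    E.IsLieSymmetry T X VField.dt := by
  refine Determining.isLieSymmetry hT hX contDiffOn_const ?_
  constructor <;> intro p _ <;>
    simp [VField.coeffT, VField.coeffX, VField.coeffU, pdt, pdx, pdu, VField.dt, VField.mk]

lemma isLieSymmetry_dx (hT : IsOpenInterval T) (hX : IsOpenInterval X) :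
    E.IsLieSymmetry T X VField.dx := by
  refine Determining.isLieSymmetry hT hX contDiffOn_const ?_
  constructor <;> intro p _ <;>
    simp [VField.coeffT, VField.coeffX, VField.coeffU, pdt, pdx, pdu, VField.dx, VField.mk]

/-- The scaling symmetry of an equation with vanishing `K`. -/
lemma isLieSymmetry_dilation (hT : IsOpenInterval T) (hX : IsOpenInterval X)
    (hK : ∀ u ∈ E.I, E.K u = 0) :
    E.IsLieSymmetry T X (.mk (fun t _ _ => t) (fun _ x _ => x) (fun _ _ _ => 0)) := by
  refine Determining.isLieSymmetry hT hX (ContDiff.contDiffOn (by unfold VField.mk; fun_prop)) ?_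
  constructor <;> intro p hp <;>
    simp [VField.coeffT, VField.coeffX, VField.coeffU, pdt, pdx, pdu, VField.mk, hK _ hp.2.2]

/-- If `m H' = μ H` and `m K' = ν K` with `m = αu + β`, then the equation has a symmetry whose flow
scales `t` and `x` and acts on `u` by the flow of `2m ∂_u`. -/
lemma isLieSymmetry_scaling (hT : IsOpenInterval T) (hX : IsOpenInterval X) {α β μ ν : ℝ}
    (hH : ∀ u ∈ E.I, (α * u + β) * deriv E.H u = μ * E.H u)
    (hK : ∀ u ∈ E.I, (α * u + β) * deriv E.K u = ν * E.K u) :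
    E.IsLieSymmetry T X (.mk (fun t _ _ => (μ - 2 * ν) * t) (fun _ x _ => 2 * (μ - ν) * x)
      (fun _ _ u => 2 * (α * u + β))) := by
  refine Determining.isLieSymmetry hT hX (ContDiff.contDiffOn (by unfold VField.mk; fun_prop)) ?_
  constructor <;> intro p hp <;>
    simp [VField.coeffT, VField.coeffX, VField.coeffU, pdt, pdx, pdu, VField.mk]
  · linear_combination 2 * hH _ hp.2.2
  · linear_combination 2 * hK _ hp.2.2

/-- The projective symmetry in `t` if both `H` and `K` are proportional to `u⁻⁴`. -/
lemma isLieSymmetry_projective_t (hT : IsOpenInterval T) (hX : IsOpenInterval X)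
    (hH : ∀ u ∈ E.I, u * deriv E.H u = -4 * E.H u) (hK : ∀ u ∈ E.I, u * deriv E.K u = -4 * E.K u) :
    E.IsLieSymmetry T X (.mk (fun t _ _ => t ^ 2) (fun _ _ _ => 0) (fun t _ u => t * u)) := by
  refine Determining.isLieSymmetry hT hX (ContDiff.contDiffOn (by unfold VField.mk; fun_prop)) ?_
  constructor <;> intro p hp <;>
    simp [VField.coeffT, VField.coeffX, VField.coeffU, pdt, pdx, pdu, VField.mk]
  · linear_combination p.1 * hH _ hp.2.2
  · linear_combination p.1 * hK _ hp.2.2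

/-- The projective symmetry in `x` if `H` is proportional to `|u|^(-4/3)` and `K = 0`. -/
lemma isLieSymmetry_projective_x (hT : IsOpenInterval T) (hX : IsOpenInterval X)
    (hH : ∀ u ∈ E.I, u * deriv E.H u = -4 / 3 * E.H u) (hK : ∀ u ∈ E.I, E.K u = 0) :
    E.IsLieSymmetry T X
      (.mk (fun _ _ _ => 0) (fun _ x _ => x ^ 2) (fun _ x u => -3 * x * u)) := by
  have hK' : ∀ u ∈ E.I, deriv E.K u = 0 := fun u hu =>
    (Filter.EventuallyEq.deriv_eq (f := fun _ => 0)
      (by filter_upwards [E.interval.1.mem_nhds hu] with s hs using hK s hs)).trans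
      (deriv_const _ _)
  refine Determining.isLieSymmetry hT hX (ContDiff.contDiffOn (by unfold VField.mk; fun_prop)) ?_
  constructor <;> intro p hp <;>
    simp [VField.coeffT, VField.coeffX, VField.coeffU, pdt, pdx, pdu, VField.mk, hK _ hp.2.2,
      hK' _ hp.2.2]
  · linear_combination (-3) * p.2.1 * hH _ hp.2.2
  · linear_combination 6 * hH _ hp.2.2

/-- The exponential symmetry if `H = K` is proportional to `u⁻²`. -/
lemma isLieSymmetry_exponential (hT : IsOpenInterval T) (hX : IsOpenInterval X)
    (hH : ∀ u ∈ E.I, u * deriv E.H u = -2 * E.H u) (hK : ∀ u ∈ E.I, E.K u = E.H u) :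
    E.IsLieSymmetry T X
      (.mk (fun _ _ _ => 0) (fun _ x _ => Real.exp (-x)) (fun _ x u => Real.exp (-x) * u)) := by
  have hK' : ∀ u ∈ E.I, deriv E.K u = deriv E.H u := fun u hu => Filter.EventuallyEq.deriv_eq
    (by filter_upwards [E.interval.1.mem_nhds hu] with s hs using hK s hs)
  have hexp (c : ℝ) : deriv (fun s : ℝ => Real.exp (-s)) c = -Real.exp (-c) := by
    simpa using ((hasDerivAt_neg c).exp).deriv
  refine Determining.isLieSymmetry hT hX (ContDiff.contDiffOn (by unfold VField.mk; fun_prop)) ?_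
  constructor <;> intro p hp <;>
    simp [VField.coeffT, VField.coeffX, VField.coeffU, pdt, pdx, pdu, VField.mk, hK _ hp.2.2,
      hK' _ hp.2.2, hexp]
  · linear_combination Real.exp (-p.2.1) * hH _ hp.2.2
  · linear_combination (-Real.exp (-p.2.1)) * hH _ hp.2.2

end ExplicitSymmetries

/-! ### Separation of variables in the determining equations -/

section Reduction

variable {E : TelegraphEq} {T X : Set ℝ} {Q : VField}

lemma ContDiffOn.hasDerivAt_of_isOpen {f : ℝ → ℝ} {S : Set ℝ} (hf : ContDiffOn ℝ ∞ f S)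
    (hS : IsOpen S) {s : ℝ} (hs : s ∈ S) : HasDerivAt f (deriv f s) s :=
  (hf.differentiableAt_of_isOpen hS hs).hasDerivAt

lemma ContDiffOn.deriv_of_isOpen_infty {f : ℝ → ℝ} {S : Set ℝ} (hf : ContDiffOn ℝ ∞ f S)
    (hS : IsOpen S) : ContDiffOn ℝ ∞ (deriv f) S := hf.deriv_of_isOpen hS (by simp)

/-- The coefficients `τ` and `ξ` of a symmetry depend only on `t` and only on `x`. -/
lemma Determining.separated (hT : IsOpenInterval T) (hX : IsOpenInterval X)
    (hQ : ContDiffOn ℝ ∞ Q (E.domain T X)) (h : Determining E T X Q) :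
    ∃ τ ξ : ℝ → ℝ, ContDiffOn ℝ ∞ τ T ∧ ContDiffOn ℝ ∞ ξ X ∧
      (∀ p ∈ E.domain T X, Q.coeffT p = τ p.1) ∧ (∀ p ∈ E.domain T X, Q.coeffX p = ξ p.2.1) ∧
      (∀ p ∈ E.domain T X, pdt Q.coeffT p = deriv τ p.1) ∧
      (∀ p ∈ E.domain T X, pdx Q.coeffX p = deriv ξ p.2.1) ∧
      (∀ p ∈ E.domain T X, pdt (pdt Q.coeffT) p = deriv (deriv τ) p.1) ∧
      (∀ p ∈ E.domain T X, pdx (pdx Q.coeffX) p = deriv (deriv ξ) p.2.1) := by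
  have hU : IsOpen (E.domain T X) := isOpen_domain hT hX
  obtain ⟨t₀, ht₀⟩ := hT.2.2
  obtain ⟨x₀, hx₀⟩ := hX.2.2
  obtain ⟨u₀, hu₀⟩ := E.interval.2.2
  have hcT := contDiffOn_coeffT hQ
  have hcX := contDiffOn_coeffX hQ
  have dcT := fun p hp => hcT.differentiableAt_of_isOpen hU (p := p) hp
  have dcX := fun p hp => hcX.differentiableAt_of_isOpen hU (p := p) hp
  have hτ : ∀ p ∈ E.domain T X, Q.coeffT p = Q.coeffT (p.1, x₀, u₀) := fun p hp =>
    (eq_of_pdx_eq_zero hX dcT h.τ_x hp.1 hp.2.1 hx₀ hp.2.2).trans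
      (eq_of_pdu_eq_zero dcT h.τ_u hp.1 hx₀ hp.2.2 hu₀)
  have hξ : ∀ p ∈ E.domain T X, Q.coeffX p = Q.coeffX (t₀, p.2.1, u₀) := fun p hp =>
    (eq_of_pdt_eq_zero hT dcX h.ξ_t hp.1 ht₀ hp.2.1 hp.2.2).trans
      (eq_of_pdu_eq_zero dcX h.ξ_u ht₀ hp.2.1 hp.2.2 hu₀)
  have h1 : ∀ p ∈ E.domain T X,
      pdt Q.coeffT p = deriv (fun t => Q.coeffT (t, x₀, u₀)) p.1 := fun p hp =>
    pdt_congr hU hτ hp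
  have h2 : ∀ p ∈ E.domain T X,
      pdx Q.coeffX p = deriv (fun x => Q.coeffX (t₀, x, u₀)) p.2.1 := fun p hp =>
    pdx_congr hU hξ hp
  refine ⟨fun t => Q.coeffT (t, x₀, u₀), fun x => Q.coeffX (t₀, x, u₀), ?_, ?_, hτ, hξ, h1, h2,
    fun p hp => pdt_congr hU h1 hp, fun p hp => pdx_congr hU h2 hp⟩
  · exact hcT.comp (ContDiff.contDiffOn (by fun_prop)) fun t ht => ⟨ht, hx₀, hu₀⟩
  · exact hcX.comp (ContDiff.contDiffOn (by fun_prop)) fun x hx => ⟨ht₀, hx, hu₀⟩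

/-- If `H` is an exponential or a power, written as `m H' = H` with `m = αu + β`, then the equation
`H'η = 2H(ξ' - τ')` gives `η = 2m(ξ' - τ')`, and the remaining determining equations become ordinary
differential equations for `τ(t)` and `ξ(x)`. -/
theorem TelegraphEq.IsLieSymmetry.reduced (hT : IsOpenInterval T) (hX : IsOpenInterval X)
    (hQ : E.IsLieSymmetry T X Q) {α β : ℝ}
    (hm : ∀ u ∈ E.I, (α * u + β) * deriv E.H u = E.H u) :
    ∃ τ ξ : ℝ → ℝ, ContDiffOn ℝ ∞ τ T ∧ ContDiffOn ℝ ∞ ξ X ∧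
      (∀ p ∈ E.domain T X,
        Q p = (τ p.1, ξ p.2.1, 2 * (α * p.2.2 + β) * (deriv ξ p.2.1 - deriv τ p.1))) ∧
      (∀ t ∈ T, (1 + 4 * α) * deriv (deriv τ) t = 0) ∧
      (∀ t ∈ T, ∀ x ∈ X, ∀ u ∈ E.I, deriv (deriv (deriv τ)) t
        + E.H u * deriv (deriv (deriv ξ)) x + E.K u * deriv (deriv ξ) x = 0) ∧
      (∀ t ∈ T, ∀ x ∈ X, ∀ u ∈ E.I,
        2 * (α * u + β) * (deriv ξ x - deriv τ t) * deriv E.K u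
          = E.K u * (deriv ξ x - 2 * deriv τ t)
            - (3 + 4 * α) * E.H u * deriv (deriv ξ) x) := by
  have hU : IsOpen (E.domain T X) := isOpen_domain hT hX
  have h := hQ.determining hT hX
  obtain ⟨τ, ξ, sτ, sξ, eτ, eξ, eτ1, eξ1, eτ2, eξ2⟩ := h.separated hT hX hQ.1
  have sτ1 := sτ.deriv_of_isOpen_infty hT.1
  have sξ1 := sξ.deriv_of_isOpen_infty hX.1
  have sτ2 := sτ1.deriv_of_isOpen_infty hT.1
  have sξ2 := sξ1.deriv_of_isOpen_infty hX.1
  have hm0 : ∀ u ∈ E.I, α * u + β ≠ 0 := fun u hu h0 => by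
    have := hm u hu
    rw [h0, zero_mul] at this
    exact E.H_ne_zero u hu this.symm
  have eη : ∀ p ∈ E.domain T X,
      Q.coeffU p = 2 * (α * p.2.2 + β) * (deriv ξ p.2.1 - deriv τ p.1) := fun p hp => by
    have e := h.eq_H p hp
    rw [eτ1 p hp, eξ1 p hp] at e
    refine mul_left_cancel₀ (E.H_ne_zero _ hp.2.2) ?_
    linear_combination (α * p.2.2 + β) * e - Q.coeffU p * hm _ hp.2.2
  have ηu : ∀ p ∈ E.domain T X,
      pdu Q.coeffU p = 2 * α * (deriv ξ p.2.1 - deriv τ p.1) := fun p hp => by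
    rw [pdu_congr hU eη hp]
    exact (((((hasDerivAt_id p.2.2).const_mul α).add_const β).const_mul 2).mul_const
      (deriv ξ p.2.1 - deriv τ p.1) |>.congr_deriv (by ring)).deriv
  have ηtu : ∀ p ∈ E.domain T X,
      pdt (pdu Q.coeffU) p = -2 * α * deriv (deriv τ) p.1 := fun p hp => by
    rw [pdt_congr hU ηu hp]
    exact (((sτ1.hasDerivAt_of_isOpen hT.1 hp.1).const_sub (deriv ξ p.2.1)).const_mul (2 * α)
      |>.congr_deriv (by ring)).deriv
  have ηxu : ∀ p ∈ E.domain T X,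
      pdx (pdu Q.coeffU) p = 2 * α * deriv (deriv ξ) p.2.1 := fun p hp => by
    rw [pdx_congr hU ηu hp]
    exact (((sξ1.hasDerivAt_of_isOpen hX.1 hp.2.1).sub_const (deriv τ p.1)).const_mul
      (2 * α)).deriv
  have ηx : ∀ p ∈ E.domain T X,
      pdx Q.coeffU p = 2 * (α * p.2.2 + β) * deriv (deriv ξ) p.2.1 := fun p hp => by
    rw [pdx_congr hU eη hp]
    exact (((sξ1.hasDerivAt_of_isOpen hX.1 hp.2.1).sub_const (deriv τ p.1)).const_mul
      (2 * (α * p.2.2 + β))).deriv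
  have ηxx : ∀ p ∈ E.domain T X,
      pdx (pdx Q.coeffU) p = 2 * (α * p.2.2 + β) * deriv (deriv (deriv ξ)) p.2.1 := fun p hp => by
    rw [pdx_congr hU ηx hp]
    exact ((sξ2.hasDerivAt_of_isOpen hX.1 hp.2.1).const_mul (2 * (α * p.2.2 + β))).deriv
  have ηt : ∀ p ∈ E.domain T X,
      pdt Q.coeffU p = -(2 * (α * p.2.2 + β)) * deriv (deriv τ) p.1 := fun p hp => by
    rw [pdt_congr hU eη hp]
    exact (((sτ1.hasDerivAt_of_isOpen hT.1 hp.1).const_sub (deriv ξ p.2.1)).const_mul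
      (2 * (α * p.2.2 + β)) |>.congr_deriv (by ring)).deriv
  have ηtt : ∀ p ∈ E.domain T X,
      pdt (pdt Q.coeffU) p = -(2 * (α * p.2.2 + β)) * deriv (deriv (deriv τ)) p.1 :=
    fun p hp => by
      rw [pdt_congr hU ηt hp]
      exact ((sτ2.hasDerivAt_of_isOpen hT.1 hp.1).const_mul (-(2 * (α * p.2.2 + β)))).deriv
  refine ⟨τ, ξ, sτ, sξ, fun p hp => ?_, fun t ht => ?_, fun t ht x hx u hu => ?_,
    fun t ht x hx u hu => ?_⟩
  · exact Prod.ext (eτ p hp) (Prod.ext (eξ p hp) (eη p hp))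
  · obtain ⟨x, hx⟩ := hX.2.2
    obtain ⟨u, hu⟩ := E.interval.2.2
    have hp : (t, x, u) ∈ E.domain T X := ⟨ht, hx, hu⟩
    have e := h.η_tu _ hp
    rw [ηtu _ hp, eτ2 _ hp] at e
    linear_combination -e
  · have hp : (t, x, u) ∈ E.domain T X := ⟨ht, hx, hu⟩
    have e := h.eq_wave _ hp
    rw [ηtt _ hp, ηxx _ hp, ηx _ hp] at e
    refine mul_left_cancel₀ (mul_ne_zero two_ne_zero (hm0 u hu)) ?_
    linear_combination -e
  · have hp : (t, x, u) ∈ E.domain T X := ⟨ht, hx, hu⟩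
    have e := h.eq_K _ hp
    rw [ηxu _ hp, ηx _ hp, eη _ hp, eτ1 _ hp, eξ1 _ hp, eξ2 _ hp] at e
    linear_combination e - 4 * deriv (deriv ξ) x * hm u hu

/-- A function with vanishing second `u`-derivative is affine in `u`. -/
lemma eq_affine_of_pdu_pdu_eq_zero (hT : IsOpenInterval T) (hX : IsOpenInterval X)
    {f : ℝ × ℝ × ℝ → ℝ} (hf : ContDiffOn ℝ ∞ f (E.domain T X))
    (h : ∀ p ∈ E.domain T X, pdu (pdu f) p = 0) {t x u v : ℝ} (ht : t ∈ T) (hx : x ∈ X)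
    (hu : u ∈ E.I) (hv : v ∈ E.I) :
    f (t, x, u) = pdu f (t, x, v) * (u - v) + f (t, x, v) := by
  have hU : IsOpen (E.domain T X) := isOpen_domain hT hX
  have key := E.interval.eq_of_hasDerivAt_zero
    (f := fun s => f (t, x, s) - pdu f (t, x, v) * (s - v)) (fun s hs => by
      have hp : (t, x, s) ∈ E.domain T X := ⟨ht, hx, hs⟩
      refine ((hasDerivAt_pdu (hf.differentiableAt_of_isOpen hU hp)).sub
        (((hasDerivAt_id s).sub_const v).const_mul (pdu f (t, x, v)))).congr_deriv ?_
      rw [eq_of_pdu_eq_zero (fun p hp => (contDiffOn_pdu hU hf).differentiableAt_of_isOpen hU hp)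
        h ht hx hs hv]
      ring) hu hv
  simp only [sub_self, mul_zero, sub_zero] at key
  linear_combination key

/-- If `H` is constant, a symmetry has the form `(ct + c₀)∂_t + (cx + c₁)∂_x + (au + b)∂_u`. -/
theorem TelegraphEq.IsLieSymmetry.of_deriv_H_eq_zero (hT : IsOpenInterval T)
    (hX : IsOpenInterval X) (hQ : E.IsLieSymmetry T X Q) (hH : ∀ u ∈ E.I, deriv E.H u = 0) :
    ∃ a b c c₀ c₁ : ℝ, (∀ p ∈ E.domain T X,
        Q p = (c * p.1 + c₀, c * p.2.1 + c₁, a * p.2.2 + b)) ∧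
      ∀ u ∈ E.I, (a * u + b) * deriv E.K u = -c * E.K u := by
  have hU : IsOpen (E.domain T X) := isOpen_domain hT hX
  have h := hQ.determining hT hX
  have sU := contDiffOn_coeffU hQ.1
  have sUu := contDiffOn_pdu hU sU
  obtain ⟨τ, ξ, sτ, sξ, eτ, eξ, eτ1, eξ1, -, -⟩ := h.separated hT hX hQ.1
  obtain ⟨t₀, ht₀⟩ := hT.2.2
  obtain ⟨x₀, hx₀⟩ := hX.2.2
  obtain ⟨v, hv, hKv⟩ : ∃ v ∈ E.I, deriv E.K v ≠ 0 := by
    by_contra! hc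
    exact E.nonlinear ⟨hH, hc⟩
  have hHc : ∀ u ∈ E.I, E.H u = E.H v := fun u hu =>
    E.interval.eq_of_hasDerivAt_zero (fun s hs => hH s hs ▸ E.hasDerivAt_H hs) hu hv
  -- `τ' = ξ'`, so both are equal to a constant
  have hτξ : ∀ t ∈ T, ∀ x ∈ X, deriv ξ x = deriv τ t := fun t ht x hx => by
    have hp : (t, x, v) ∈ E.domain T X := ⟨ht, hx, hv⟩
    have e := h.eq_H _ hp
    rw [eτ1 _ hp, eξ1 _ hp, hH v hv, zero_mul] at e
    exact sub_eq_zero.1 ((mul_eq_zero.1 e.symm).resolve_left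
      (mul_ne_zero two_ne_zero (E.H_ne_zero v hv)))
  set c := deriv τ t₀ with hc
  have hξc : ∀ x ∈ X, deriv ξ x = c := fun x hx => hτξ t₀ ht₀ x hx
  have hτc : ∀ t ∈ T, deriv τ t = c := fun t ht => by rw [← hτξ t ht x₀ hx₀, hξc x₀ hx₀]
  have hτ : ∀ t ∈ T, τ t = c * t + (τ t₀ - c * t₀) := fun t ht => by
    have := hT.eq_of_hasDerivAt_zero (f := fun s => τ s - c * s) (fun s hs =>
      ((sτ.hasDerivAt_of_isOpen hT.1 hs).sub ((hasDerivAt_id s).const_mul c)).congr_deriv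
        (by rw [hτc s hs]; ring)) ht ht₀
    linear_combination this
  have hξ : ∀ x ∈ X, ξ x = c * x + (ξ x₀ - c * x₀) := fun x hx => by
    have := hX.eq_of_hasDerivAt_zero (f := fun s => ξ s - c * s) (fun s hs =>
      ((sξ.hasDerivAt_of_isOpen hX.1 hs).sub ((hasDerivAt_id s).const_mul c)).congr_deriv
        (by rw [hξc s hs]; ring)) hx hx₀
    linear_combination this
  have τtt : ∀ p ∈ E.domain T X, pdt (pdt Q.coeffT) p = 0 := fun p hp => by
    rw [pdt_congr hU (g := fun _ => c) (fun q hq => (eτ1 q hq).trans (hτc _ hq.1)) hp]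
    simp [pdt]
  have ξxx : ∀ p ∈ E.domain T X, pdx (pdx Q.coeffX) p = 0 := fun p hp => by
    rw [pdx_congr hU (g := fun _ => c) (fun q hq => (eξ1 q hq).trans (hξc _ hq.2.1)) hp]
    simp [pdx]
  have ηtu : ∀ p ∈ E.domain T X, pdt (pdu Q.coeffU) p = 0 := fun p hp => by
    have := h.η_tu p hp
    rw [τtt p hp] at this
    linarith
  have eqK : ∀ p ∈ E.domain T X, deriv E.K p.2.2 * Q.coeffU p
      = -c * E.K p.2.2 - 2 * E.H v * pdx (pdu Q.coeffU) p := fun p hp => by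
    have e := h.eq_K p hp
    rw [ξxx p hp, eτ1 p hp, eξ1 p hp, hτc _ hp.1, hξc _ hp.2.1, hH _ hp.2.2, hHc _ hp.2.2] at e
    linear_combination e
  -- neither the slope nor the value of `η` at `u = v` depends on `t`
  have slope_t : ∀ t ∈ T, ∀ x ∈ X, pdu Q.coeffU (t, x, v) = pdu Q.coeffU (t₀, x, v) :=
    fun t ht x hx => eq_of_pdt_eq_zero hT
      (fun p hp => sUu.differentiableAt_of_isOpen hU hp) ηtu ht ht₀ hx hv
  have value_t : ∀ t ∈ T, ∀ x ∈ X, Q.coeffU (t, x, v) = Q.coeffU (t₀, x, v) := fun t ht x hx => by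
    have e1 := eqK (t, x, v) ⟨ht, hx, hv⟩
    have e2 := eqK (t₀, x, v) ⟨ht₀, hx, hv⟩
    have e3 : pdx (pdu Q.coeffU) (t, x, v) = pdx (pdu Q.coeffU) (t₀, x, v) :=
      Filter.EventuallyEq.deriv_eq (by
        filter_upwards [hX.1.mem_nhds hx] with s hs using slope_t t ht s hs)
    refine mul_left_cancel₀ hKv ?_
    linear_combination e1 - e2 - 2 * E.H v * e3
  let a : ℝ → ℝ := fun x => pdu Q.coeffU (t₀, x, v)
  let b : ℝ → ℝ := fun x => Q.coeffU (t₀, x, v)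
  have sa : ContDiffOn ℝ ∞ a X :=
    sUu.comp (ContDiff.contDiffOn (by fun_prop)) fun x hx => ⟨ht₀, hx, hv⟩
  have sb : ContDiffOn ℝ ∞ b X :=
    sU.comp (ContDiff.contDiffOn (by fun_prop)) fun x hx => ⟨ht₀, hx, hv⟩
  have sa1 := sa.deriv_of_isOpen_infty hX.1
  have sb1 := sb.deriv_of_isOpen_infty hX.1
  have hη : ∀ p ∈ E.domain T X, Q.coeffU p = a p.2.1 * (p.2.2 - v) + b p.2.1 := by
    rintro ⟨t, x, u⟩ ⟨ht, hx, hu⟩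
    have := eq_affine_of_pdu_pdu_eq_zero hT hX sU h.η_uu ht hx hu hv
    rwa [slope_t t ht x hx, value_t t ht x hx] at this
  have ηx : ∀ p ∈ E.domain T X,
      pdx Q.coeffU p = deriv a p.2.1 * (p.2.2 - v) + deriv b p.2.1 := fun p hp => by
    rw [pdx_congr hU hη hp]
    exact (((sa.hasDerivAt_of_isOpen hX.1 hp.2.1).mul_const (p.2.2 - v)).add
      (sb.hasDerivAt_of_isOpen hX.1 hp.2.1)).deriv
  have ηxx : ∀ p ∈ E.domain T X, pdx (pdx Q.coeffU) p
      = deriv (deriv a) p.2.1 * (p.2.2 - v) + deriv (deriv b) p.2.1 := fun p hp => by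
    rw [pdx_congr hU ηx hp]
    exact (((sa1.hasDerivAt_of_isOpen hX.1 hp.2.1).mul_const (p.2.2 - v)).add
      (sb1.hasDerivAt_of_isOpen hX.1 hp.2.1)).deriv
  have ηtt : ∀ p ∈ E.domain T X, pdt (pdt Q.coeffU) p = 0 := fun p hp =>
    pdt_eq_zero_of_eqOn hU (fun q hq => by rw [pdt_congr hU hη hq]; simp [pdt]) hp
  have ηxu : ∀ p ∈ E.domain T X, pdx (pdu Q.coeffU) p = deriv a p.2.1 := fun p hp => by
    rw [pdx_pdu_comm hU sU hp, pdu_congr hU ηx hp]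
    exact ((((hasDerivAt_id p.2.2).sub_const v).const_mul (deriv a p.2.1)).add_const
      (deriv b p.2.1) |>.congr_deriv (by ring)).deriv
  have odeK : ∀ x ∈ X, ∀ u ∈ E.I, deriv E.K u * (a x * (u - v) + b x)
      = -c * E.K u - 2 * E.H v * deriv a x := fun x hx u hu => by
    have hp : (t₀, x, u) ∈ E.domain T X := ⟨ht₀, hx, hu⟩
    have e := eqK _ hp
    rwa [hη _ hp, ηxu _ hp] at e
  have odeW : ∀ x ∈ X, ∀ u ∈ E.I, E.H v * (deriv (deriv a) x * (u - v) + deriv (deriv b) x)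
      + E.K u * (deriv a x * (u - v) + deriv b x) = 0 := fun x hx u hu => by
    have hp : (t₀, x, u) ∈ E.domain T X := ⟨ht₀, hx, hu⟩
    have e := h.eq_wave _ hp
    rw [ηtt _ hp, ηx _ hp, ηxx _ hp, hHc u hu] at e
    exact e.symm
  -- the `x`-derivative of the first and the `u`-derivative of the second relation
  have odeK' : ∀ x ∈ X, ∀ u ∈ E.I, deriv E.K u * (deriv a x * (u - v) + deriv b x)
      = -(2 * E.H v * deriv (deriv a) x) := fun x hx u hu => by
    refine HasDerivAt.unique ((((sa.hasDerivAt_of_isOpen hX.1 hx).mul_const (u - v)).add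
      (sb.hasDerivAt_of_isOpen hX.1 hx)).const_mul (deriv E.K u)) ?_
    refine (((sa1.hasDerivAt_of_isOpen hX.1 hx).const_mul (2 * E.H v)).const_sub
      (-c * E.K u)).congr_of_eventuallyEq ?_
    filter_upwards [hX.1.mem_nhds hx] with s hs using odeK s hs u hu
  have odeW' : ∀ x ∈ X, ∀ u ∈ E.I, E.K u * deriv a x = E.H v * deriv (deriv a) x :=
    fun x hx u hu => by
      have l := ((((hasDerivAt_id u).sub_const v).const_mul (deriv (deriv a) x)).add_const
        (deriv (deriv b) x)).const_mul (E.H v)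
      have r := (E.hasDerivAt_K hu).mul
        ((((hasDerivAt_id u).sub_const v).const_mul (deriv a x)).add_const (deriv b x))
      have e := HasDerivAt.unique (l.add r) ((hasDerivAt_const u (0 : ℝ)).congr_of_eventuallyEq (by
        filter_upwards [E.interval.1.mem_nhds hu] with s hs using odeW x hx s hs))
      simp only [id_eq, mul_one] at e
      linear_combination e - odeK' x hx u hu
  have ha0 : ∀ x ∈ X, deriv a x = 0 := fun x hx => by
    refine (mul_eq_zero.1 (?_ : deriv E.K v * _ = 0)).resolve_left hKv
    refine HasDerivAt.unique ((E.hasDerivAt_K hv).mul_const (deriv a x))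
      ((hasDerivAt_const v (E.H v * deriv (deriv a) x)).congr_of_eventuallyEq (by
        filter_upwards [E.interval.1.mem_nhds hv] with s hs using odeW' x hx s hs))
  have hb0 : ∀ x ∈ X, deriv b x = 0 := fun x hx => by
    refine (mul_eq_zero.1 (?_ : deriv E.K v * _ = 0)).resolve_left hKv
    linear_combination odeK' x hx v hv + 2 * odeW' x hx v hv - 2 * E.K v * ha0 x hx
  have hac : ∀ x ∈ X, a x = a x₀ := fun x hx => hX.eq_of_hasDerivAt_zero
    (fun s hs => ha0 s hs ▸ sa.hasDerivAt_of_isOpen hX.1 hs) hx hx₀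
  have hbc : ∀ x ∈ X, b x = b x₀ := fun x hx => hX.eq_of_hasDerivAt_zero
    (fun s hs => hb0 s hs ▸ sb.hasDerivAt_of_isOpen hX.1 hs) hx hx₀
  refine ⟨a x₀, b x₀ - a x₀ * v, c, τ t₀ - c * t₀, ξ x₀ - c * x₀, fun p hp => ?_, fun u hu => ?_⟩
  · refine Prod.ext ((eτ p hp).trans (hτ _ hp.1)) (Prod.ext ((eξ p hp).trans (hξ _ hp.2.1)) ?_)
    refine (hη p hp).trans ?_
    rw [hac _ hp.2.1, hbc _ hp.2.1]
    ring
  · linear_combination odeK x₀ hx₀ u hu - 2 * E.H v * ha0 x₀ hx₀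

end Reduction

/-! ### Solutions of the reduced system -/

section Reduction

variable {E : TelegraphEq} {T X : Set ℝ} {Q : VField}

lemma IsOpenInterval.exists_eq_add_const {S : Set ℝ} (hS : IsOpenInterval S) {f g f' : ℝ → ℝ}
    (hf : ∀ s ∈ S, HasDerivAt f (f' s) s) (hg : ∀ s ∈ S, HasDerivAt g (f' s) s) :
    ∃ c, ∀ s ∈ S, f s = g s + c := by
  obtain ⟨s₀, h₀⟩ := hS.2.2
  refine ⟨f s₀ - g s₀, fun s hs => ?_⟩
  have := hS.eq_of_hasDerivAt_zero (f := fun r => f r - g r)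
    (fun r hr => ((hf r hr).sub (hg r hr)).congr_deriv (sub_self _)) hs h₀
  linear_combination this

lemma IsOpenInterval.exists_linear {S : Set ℝ} (hS : IsOpenInterval S) {f : ℝ → ℝ}
    (hf : ContDiffOn ℝ ∞ f S) (h : ∀ s ∈ S, deriv (deriv f) s = 0) :
    ∃ a b : ℝ, ∀ s ∈ S, f s = a + b * s ∧ deriv f s = b := by
  have hf1 := hf.deriv_of_isOpen_infty hS.1
  obtain ⟨b, hb⟩ := hS.exists_eq_add_const (f := deriv f) (g := fun _ => 0) (f' := fun _ => 0)
    (fun s hs => h s hs ▸ hf1.hasDerivAt_of_isOpen hS.1 hs) (fun s _ => hasDerivAt_const _ _)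
  simp only [zero_add] at hb
  obtain ⟨a, ha⟩ := hS.exists_eq_add_const (f := f) (g := fun s => b * s) (f' := fun _ => b)
    (fun s hs => hb s hs ▸ hf.hasDerivAt_of_isOpen hS.1 hs)
    (fun s _ => by simpa using (hasDerivAt_id s).const_mul b)
  exact ⟨a, b, fun s hs => ⟨by rw [ha s hs]; ring, hb s hs⟩⟩

lemma IsOpenInterval.exists_quadratic {S : Set ℝ} (hS : IsOpenInterval S) {f : ℝ → ℝ}
    (hf : ContDiffOn ℝ ∞ f S) (h : ∀ s ∈ S, deriv (deriv (deriv f)) s = 0) :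
    ∃ a b c : ℝ, ∀ s ∈ S, f s = a + b * s + c * s ^ 2 ∧ deriv f s = b + 2 * c * s := by
  obtain ⟨b, c, hbc⟩ := hS.exists_linear (hf.deriv_of_isOpen_infty hS.1) h
  obtain ⟨a, ha⟩ := hS.exists_eq_add_const (f := f) (g := fun s => b * s + c / 2 * s ^ 2)
    (f' := fun s => b + c * s) (fun s hs => (hbc s hs).1 ▸ hf.hasDerivAt_of_isOpen hS.1 hs)
    (fun s _ => (((hasDerivAt_id s).const_mul b).add
      ((hasDerivAt_pow 2 s).const_mul (c / 2))).congr_deriv (by norm_num; ring))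
  exact ⟨a, b, c / 2, fun s hs => ⟨by rw [ha s hs]; ring, by rw [(hbc s hs).1]; ring⟩⟩

lemma deriv_eq_zero_of_eqOn_zero {S : Set ℝ} (hS : IsOpen S) {f : ℝ → ℝ} (h : ∀ s ∈ S, f s = 0)
    {s : ℝ} (hs : s ∈ S) : deriv f s = 0 :=
  (Filter.EventuallyEq.deriv_eq (f := fun _ => 0)
    (by filter_upwards [hS.mem_nhds hs] with r hr using h r hr)).trans (deriv_const _ _)

/-- A symmetry of an equation with nonconstant `H` either forces `H` to be an exponential or a power
(`m H' = H` with `m` affine) or is a combination of `∂_t`, `∂_x` and `t∂_t + x∂_x`. -/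
theorem TelegraphEq.IsLieSymmetry.dichotomy (hT : IsOpenInterval T) (hX : IsOpenInterval X)
    (hQ : E.IsLieSymmetry T X Q) (hH : ∃ v ∈ E.I, deriv E.H v ≠ 0) :
    (∃ α β : ℝ, ∀ u ∈ E.I, (α * u + β) * deriv E.H u = E.H u) ∨
    ∃ c c₀ c₁ : ℝ, (∀ p ∈ E.domain T X, Q p = (c * p.1 + c₀, c * p.2.1 + c₁, 0)) ∧
      ∀ u ∈ E.I, c * E.K u = 0 := by
  obtain ⟨v, hv, hHv⟩ := hH
  have hU : IsOpen (E.domain T X) := isOpen_domain hT hX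
  have h := hQ.determining hT hX
  have sU := contDiffOn_coeffU hQ.1
  obtain ⟨τ, ξ, sτ, sξ, eτ, eξ, eτ1, eξ1, -, -⟩ := h.separated hT hX hQ.1
  by_cases hd : ∀ t ∈ T, ∀ x ∈ X, deriv ξ x = deriv τ t
  · right
    obtain ⟨t₀, ht₀⟩ := hT.2.2
    obtain ⟨x₀, hx₀⟩ := hX.2.2
    set c := deriv τ t₀ with hc
    have hξc : ∀ x ∈ X, deriv ξ x = c := fun x hx => hd t₀ ht₀ x hx
    have hτc : ∀ t ∈ T, deriv τ t = c := fun t ht => by rw [← hd t ht x₀ hx₀, hξc x₀ hx₀]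
    have hlin (r : ℝ) : HasDerivAt (fun s => c * s) c r := by
      simpa using (hasDerivAt_id r).const_mul c
    obtain ⟨c₀, hc₀⟩ := hT.exists_eq_add_const (f := τ) (g := fun s => c * s) (f' := fun _ => c)
      (fun s hs => hτc s hs ▸ sτ.hasDerivAt_of_isOpen hT.1 hs) (fun s _ => hlin s)
    obtain ⟨c₁, hc₁⟩ := hX.exists_eq_add_const (f := ξ) (g := fun s => c * s) (f' := fun _ => c)
      (fun s hs => hξc s hs ▸ sξ.hasDerivAt_of_isOpen hX.1 hs) (fun s _ => hlin s)
    have hHη : ∀ p ∈ E.domain T X, deriv E.H p.2.2 * Q.coeffU p = 0 := fun p hp => by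
      rw [h.eq_H p hp, eτ1 p hp, eξ1 p hp, hd _ hp.1 _ hp.2.1]
      ring
    have hη : ∀ p ∈ E.domain T X, Q.coeffU p = 0 := by
      rintro ⟨t, x, u⟩ ⟨ht, hx, hu⟩
      -- `η` vanishes where `H' ≠ 0`, hence near `v`, hence everywhere, being affine in `u`
      have h0 : Q.coeffU (t, x, v) = 0 :=
        (mul_eq_zero.1 (hHη (t, x, v) ⟨ht, hx, hv⟩)).resolve_left hHv
      have h1 : pdu Q.coeffU (t, x, v) = 0 := by
        refine (Filter.EventuallyEq.deriv_eq (f := fun _ => 0) ?_).trans (deriv_const _ _)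
        filter_upwards [E.interval.1.mem_nhds hv,
          (E.hasDerivAt_deriv_H hv).continuousAt.eventually_ne hHv] with s hs hs'
        exact (mul_eq_zero.1 (hHη (t, x, s) ⟨ht, hx, hs⟩)).resolve_left hs'
      rw [eq_affine_of_pdu_pdu_eq_zero hT hX sU h.η_uu ht hx hu hv, h0, h1]
      ring
    refine ⟨c, c₀, c₁, fun p hp => ?_, fun u hu => ?_⟩
    · exact Prod.ext ((eτ p hp).trans (hc₀ _ hp.1))
        (Prod.ext ((eξ p hp).trans (hc₁ _ hp.2.1)) (hη p hp))
    · have hp : (t₀, x₀, u) ∈ E.domain T X := ⟨ht₀, hx₀, hu⟩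
      have e := h.eq_K _ hp
      rw [hη _ hp, pdx_eq_zero_of_eqOn hU hη hp, eτ1 _ hp, eξ1 _ hp, hξc _ hx₀, hτc _ ht₀,
        pdx_eq_zero_of_eqOn hU (fun q hq => pdu_eq_zero_of_eqOn hU hη hq) hp,
        pdx_congr hU (g := fun _ => c) (fun q hq => (eξ1 q hq).trans (hξc _ hq.2.1)) hp] at e
      simp only [pdx, deriv_const] at e
      linear_combination e
  · left
    push Not at hd
    obtain ⟨t, ht, x, hx, hd⟩ := hd
    have hd0 := sub_ne_zero.2 hd
    refine ⟨pdu Q.coeffU (t, x, v) / (2 * (deriv ξ x - deriv τ t)),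
      (Q.coeffU (t, x, v) - pdu Q.coeffU (t, x, v) * v) / (2 * (deriv ξ x - deriv τ t)),
      fun u hu => ?_⟩
    have hp : (t, x, u) ∈ E.domain T X := ⟨ht, hx, hu⟩
    have e := h.eq_H _ hp
    rw [eτ1 _ hp, eξ1 _ hp, eq_affine_of_pdu_pdu_eq_zero hT hX sU h.η_uu ht hx hu hv] at e
    simp only at e
    field_simp
    linear_combination e

/-- The alternatives for the solutions of the reduced system if `K ≠ 0`: `τ` and `ξ` are linear
unless `H` and `K` are proportional to the same power `-4` or `-2`. -/
lemma reduced_alternatives (hT : IsOpenInterval T) (hX : IsOpenInterval X) {α β : ℝ}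
    (hm : ∀ u ∈ E.I, (α * u + β) * deriv E.H u = E.H u) {w : ℝ} (hw : w ∈ E.I)
    (hKw : E.K w ≠ 0) {τ ξ : ℝ → ℝ} (sτ : ContDiffOn ℝ ∞ τ T) (sξ : ContDiffOn ℝ ∞ ξ X)
    (h1 : ∀ t ∈ T, (1 + 4 * α) * deriv (deriv τ) t = 0)
    (h2 : ∀ t ∈ T, ∀ x ∈ X, ∀ u ∈ E.I, deriv (deriv (deriv τ)) t
        + E.H u * deriv (deriv (deriv ξ)) x + E.K u * deriv (deriv ξ) x = 0)
    (h3 : ∀ t ∈ T, ∀ x ∈ X, ∀ u ∈ E.I,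
        2 * (α * u + β) * (deriv ξ x - deriv τ t) * deriv E.K u
          = E.K u * (deriv ξ x - 2 * deriv τ t)
            - (3 + 4 * α) * E.H u * deriv (deriv ξ) x) :
    ((∀ t ∈ T, deriv (deriv τ) t = 0) ∧ ∀ x ∈ X, deriv (deriv ξ) x = 0) ∨
    (α = -1 / 4 ∧ (∀ t ∈ T, deriv (deriv (deriv τ)) t = 0) ∧ (∀ x ∈ X, deriv ξ x = 0) ∧
      ∀ u ∈ E.I, (α * u + β) * deriv E.K u = E.K u) ∨
    (α = -1 / 2 ∧ (∀ t ∈ T, deriv (deriv τ) t = 0) ∧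
      ∃ k : ℝ, k ≠ 0 ∧ (∀ u ∈ E.I, E.K u = k * E.H u) ∧
        ∀ x ∈ X, deriv (deriv ξ) x = -k * deriv ξ x) := by
  obtain ⟨t₀, ht₀⟩ := hT.2.2
  obtain ⟨x₀, hx₀⟩ := hX.2.2
  have sτ1 := sτ.deriv_of_isOpen_infty hT.1
  have sξ1 := sξ.deriv_of_isOpen_infty hX.1
  have sξ2 := sξ1.deriv_of_isOpen_infty hX.1
  have hH' : ∀ u ∈ E.I, deriv E.H u ≠ 0 := fun u hu h0 => by
    have := hm u hu
    rw [h0, mul_zero] at this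
    exact E.H_ne_zero u hu this.symm
  by_cases hξ : ∀ x ∈ X, deriv (deriv ξ) x = 0
  · by_cases hτ : ∀ t ∈ T, deriv (deriv τ) t = 0
    · exact Or.inl ⟨hτ, hξ⟩
    · right; left
      push Not at hτ
      obtain ⟨t₁, ht₁, hτ⟩ := hτ
      have hα : α = -1 / 4 := by
        have := (mul_eq_zero.1 (h1 t₁ ht₁)).resolve_right hτ
        linarith
      have hmK : ∀ u ∈ E.I, (α * u + β) * deriv E.K u = E.K u := fun u hu => by
        -- the `t`-derivative of the third equation
        have l := (((sτ1.hasDerivAt_of_isOpen hT.1 ht₁).const_sub (deriv ξ x₀)).const_mul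
          (2 * (α * u + β))).mul_const (deriv E.K u)
        have r := ((((sτ1.hasDerivAt_of_isOpen hT.1 ht₁).const_mul 2).const_sub
          (deriv ξ x₀)).const_mul (E.K u)).sub_const ((3 + 4 * α) * E.H u * deriv (deriv ξ) x₀)
        have e := l.unique (r.congr_of_eventuallyEq (by
          filter_upwards [hT.1.mem_nhds ht₁] with s hs using h3 s hs x₀ hx₀ u hu))
        refine mul_right_cancel₀ (mul_ne_zero two_ne_zero hτ) ?_
        linear_combination -e
      refine ⟨hα, fun t ht => ?_, fun x hx => ?_, hmK⟩
      · have := h2 t ht x₀ hx₀ w hw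
        rw [hξ x₀ hx₀, deriv_eq_zero_of_eqOn_zero hX.1 hξ hx₀] at this
        linear_combination this
      · have := h3 t₀ ht₀ x hx w hw
        rw [hξ x hx] at this
        refine mul_left_cancel₀ hKw ?_
        linear_combination this - 2 * (deriv ξ x - deriv τ t₀) * hmK w hw
  · right; right
    push Not at hξ
    obtain ⟨x₁, hx₁, hξ⟩ := hξ
    obtain ⟨k₀, k₁, hK⟩ : ∃ k₀ k₁ : ℝ, ∀ u ∈ E.I, E.K u = k₀ + k₁ * E.H u := by
      refine ⟨-deriv (deriv (deriv τ)) t₀ / deriv (deriv ξ) x₁,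
        -deriv (deriv (deriv ξ)) x₁ / deriv (deriv ξ) x₁, fun u hu => ?_⟩
      field_simp
      linear_combination h2 t₀ ht₀ x₁ hx₁ u hu
    have hk₁ : ∀ u ∈ E.I, k₁ * deriv (deriv ξ) x₁ * E.H u
        = -deriv (deriv (deriv ξ)) x₁ * E.H u := fun u hu => by
      have l := (((E.hasDerivAt_H hu).mul_const (deriv (deriv (deriv ξ)) x₁)).const_add
        (deriv (deriv (deriv τ)) t₀)).add
        ((((E.hasDerivAt_H hu).const_mul k₁).const_add k₀).mul_const (deriv (deriv ξ) x₁))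
      have e := l.unique ((hasDerivAt_const u (0 : ℝ)).congr_of_eventuallyEq (by
        filter_upwards [E.interval.1.mem_nhds hu] with s hs
        have := h2 t₀ ht₀ x₁ hx₁ s hs
        rw [hK s hs] at this
        exact this))
      rw [← hm u hu]
      linear_combination (α * u + β) * e
    have hK' : ∀ u ∈ E.I, deriv E.K u = k₁ * deriv E.H u := fun u hu => by
      refine HasDerivAt.unique (E.hasDerivAt_K hu)
        ((((E.hasDerivAt_H hu).const_mul k₁).const_add k₀).congr_of_eventuallyEq ?_)
      filter_upwards [E.interval.1.mem_nhds hu] with s hs using hK s hs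
    -- the `x`-derivative of the third equation at `x₁`
    have key : ∀ u ∈ E.I, (2 + 4 * α) * k₁ * E.H u = -k₀ := fun u hu => by
      have l := (((sξ1.hasDerivAt_of_isOpen hX.1 hx₁).sub_const (deriv τ t₀)).const_mul
        (2 * (α * u + β))).mul_const (deriv E.K u)
      have r := (((sξ1.hasDerivAt_of_isOpen hX.1 hx₁).sub_const (2 * deriv τ t₀)).const_mul
        (E.K u)).sub ((sξ2.hasDerivAt_of_isOpen hX.1 hx₁).const_mul ((3 + 4 * α) * E.H u))
      have e := l.unique (r.congr_of_eventuallyEq (by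
        filter_upwards [hX.1.mem_nhds hx₁] with s hs using h3 t₀ ht₀ s hs u hu))
      rw [hK u hu, hK' u hu] at e
      refine mul_right_cancel₀ hξ ?_
      linear_combination -e + 2 * deriv (deriv ξ) x₁ * k₁ * hm u hu + (3 + 4 * α) * hk₁ u hu
    have hα₁ : (2 + 4 * α) * k₁ = 0 := by
      refine (mul_eq_zero.1 (?_ : _ * deriv E.H w = 0)).resolve_right (hH' w hw)
      refine HasDerivAt.unique ((E.hasDerivAt_H hw).const_mul _)
        ((hasDerivAt_const w (-k₀)).congr_of_eventuallyEq ?_)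
      filter_upwards [E.interval.1.mem_nhds hw] with s hs using key s hs
    have hk₀ : k₀ = 0 := by
      have := key w hw
      rw [hα₁] at this
      linarith
    subst hk₀
    simp only [zero_add] at hK
    have hk₁0 : k₁ ≠ 0 := fun h0 => hKw (by rw [hK w hw, h0, zero_mul])
    have hα : α = -1 / 2 := by
      have := (mul_eq_zero.1 hα₁).resolve_right hk₁0
      linarith
    refine ⟨hα, fun t ht => ?_, k₁, hk₁0, hK, fun x hx => ?_⟩
    · have := h1 t ht
      rw [hα] at this
      linarith
    · have := h3 t₀ ht₀ x hx w hw
      rw [hK w hw, hK' w hw] at this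
      refine mul_left_cancel₀ (E.H_ne_zero w hw) ?_
      have h4 : 3 + 4 * α = 1 := by rw [hα]; norm_num
      rw [h4] at this
      linear_combination this - 2 * (deriv ξ x - deriv τ t₀) * k₁ * hm w hw

end Reduction

/-! ### Kernel algebra and its extensions -/

section Classification

variable {E : TelegraphEq} {T X : Set ℝ} {Q : VField}

lemma kerAlgebra_subset_maxAlgebra (hT : IsOpenInterval T) (hX : IsOpenInterval X) :
    (E.kerAlgebra T X : Set (E.domain T X → ℝ × ℝ × ℝ)) ⊆ E.maxAlgebra T X :=
  spanOf_subset_maxAlgebra hT hX (by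
    simp only [List.mem_cons, List.not_mem_nil, or_false, forall_eq_or_imp, forall_eq]
    exact ⟨isLieSymmetry_dt hT hX, isLieSymmetry_dx hT hX⟩)

lemma mem_kerAlgebra_of_eq {c₀ c₁ : ℝ} (h : ∀ p ∈ E.domain T X, Q p = (c₀, c₁, 0)) :
    (E.domain T X).domRestrict Q ∈ E.kerAlgebra T X := by
  have : (E.domain T X).domRestrict Q = c₀ • (E.domain T X).domRestrict VField.dt
      + c₁ • (E.domain T X).domRestrict VField.dx := by
    funext p
    simp [Set.domRestrict, h p p.2, VField.dt, VField.dx, VField.mk]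
  rw [this]
  exact Submodule.add_mem _ (Submodule.smul_mem _ _ (domRestrict_mem_spanOf (by simp)))
    (Submodule.smul_mem _ _ (domRestrict_mem_spanOf (by simp)))

lemma exists_eq_of_mem_kerAlgebra (h : (E.domain T X).domRestrict Q ∈ E.kerAlgebra T X) :
    ∃ c₀ c₁ : ℝ, ∀ p ∈ E.domain T X, Q p = (c₀, c₁, 0) := by
  have key : ∀ v ∈ E.kerAlgebra T X, ∃ c₀ c₁ : ℝ, ∀ p, v p = (c₀, c₁, 0) := by
    intro v hv
    change v ∈ Submodule.span ℝ _ at hv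
    induction hv using Submodule.span_induction with
    | mem v hv =>
      obtain ⟨i, rfl⟩ := hv
      match i with
      | ⟨0, _⟩ => exact ⟨1, 0, fun p => rfl⟩
      | ⟨1, _⟩ => exact ⟨0, 1, fun p => rfl⟩
    | zero => exact ⟨0, 0, fun p => rfl⟩
    | add v w _ _ hv hw =>
      obtain ⟨a, b, hv⟩ := hv
      obtain ⟨c, d, hw⟩ := hw
      exact ⟨a + c, b + d, fun p => by simp [hv, hw]⟩
    | smul r v _ hv =>
      obtain ⟨a, b, hv⟩ := hv
      exact ⟨r * a, r * b, fun p => by simp [hv]⟩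
  obtain ⟨c₀, c₁, hc⟩ := key _ h
  exact ⟨c₀, c₁, fun p hp => hc ⟨p, hp⟩⟩

/-- A continuous function which vanishes off the zeros of a nonzero affine function vanishes. -/
lemma IsOpenInterval.eq_zero_of_affine_mul {S : Set ℝ} (hS : IsOpenInterval S) {α β : ℝ}
    (hαβ : α ≠ 0 ∨ β ≠ 0) {g : ℝ → ℝ} (hg : ContinuousOn g S)
    (h : ∀ u ∈ S, (α * u + β) * g u = 0) {u : ℝ} (hu : u ∈ S) : g u = 0 := by
  by_cases hm : α * u + β = 0
  · -- the only zero of the affine function is `u`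
    have hα : α ≠ 0 := by
      rintro rfl
      simp only [zero_mul, zero_add] at hm
      exact hαβ.elim (fun h => h rfl) (fun h => h hm)
    have hc : Filter.Tendsto g (nhdsWithin u {u}ᶜ) (nhds (g u)) :=
      ((hg.continuousAt (hS.1.mem_nhds hu)).tendsto).mono_left nhdsWithin_le_nhds
    refine tendsto_nhds_unique hc ((tendsto_const_nhds (x := (0 : ℝ))).congr' ?_)
    filter_upwards [self_mem_nhdsWithin, nhdsWithin_le_nhds (hS.1.mem_nhds hu)] with s hs hs'
    refine ((mul_eq_zero.1 (h s hs')).resolve_left fun h0 => hs ?_).symm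
    exact mul_left_cancel₀ hα (by linear_combination h0 - hm)
  · exact (mul_eq_zero.1 (h u hu)).resolve_left hm

/-- An equation with additional symmetries either has `K = 0`, or `H` and `K` are eigenfunctions of
the same operator `m d/du` with `m` affine. -/
theorem exists_affine_relations (hT : IsOpenInterval T) (hX : IsOpenInterval X)
    (hne : E.maxAlgebra T X ≠ (E.kerAlgebra T X : Set (E.domain T X → ℝ × ℝ × ℝ))) :
    (∀ u ∈ E.I, E.K u = 0) ∨ ∃ α β μ ν : ℝ, (α ≠ 0 ∨ β ≠ 0) ∧
      (∀ u ∈ E.I, (α * u + β) * deriv E.H u = μ * E.H u) ∧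
      ∀ u ∈ E.I, (α * u + β) * deriv E.K u = ν * E.K u := by
  obtain ⟨_, ⟨Q, hQ, rfl⟩, hker⟩ : ∃ v ∈ E.maxAlgebra T X, v ∉ E.kerAlgebra T X := by
    by_contra! hc
    exact hne (Set.Subset.antisymm hc (kerAlgebra_subset_maxAlgebra hT hX))
  rw [or_iff_not_imp_left]
  intro hK
  push Not at hK
  obtain ⟨w, hw, hKw⟩ := hK
  by_cases hH : ∀ u ∈ E.I, deriv E.H u = 0
  · obtain ⟨a, b, c, c₀, c₁, hQe, hab⟩ := hQ.of_deriv_H_eq_zero hT hX hH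
    refine ⟨a, b, 0, -c, ?_, fun u hu => by rw [hH u hu]; ring, hab⟩
    by_contra! h0
    obtain ⟨rfl, rfl⟩ := h0
    have hc : c = 0 := by
      have := hab w hw
      simp only [zero_mul, add_zero] at this
      exact neg_eq_zero.1 ((mul_eq_zero.1 this.symm).resolve_right hKw)
    subst hc
    exact hker (mem_kerAlgebra_of_eq (c₀ := c₀) (c₁ := c₁) fun p hp => by rw [hQe p hp]; simp)
  · push Not at hH
    rcases hQ.dichotomy hT hX hH with ⟨α, β, hm⟩ | ⟨c, c₀, c₁, hQe, hc⟩
    · obtain ⟨τ, ξ, sτ, sξ, hQe, h1, h2, h3⟩ := hQ.reduced hT hX hm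
      have hm0 : α ≠ 0 ∨ β ≠ 0 := by
        by_contra! h0
        have := hm w hw
        rw [h0.1, h0.2] at this
        simp only [zero_mul, add_zero] at this
        exact E.H_ne_zero w hw this.symm
      suffices h : ∃ ν : ℝ, ∀ u ∈ E.I, (α * u + β) * deriv E.K u = ν * E.K u by
        obtain ⟨ν, hν⟩ := h
        exact ⟨α, β, 1, ν, hm0, fun u hu => by rw [hm u hu, one_mul], hν⟩
      rcases reduced_alternatives hT hX hm hw hKw sτ sξ h1 h2 h3 with
        ⟨hτ, hξ⟩ | ⟨-, -, -, hmK⟩ | ⟨-, -, k, -, hk, -⟩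
      · obtain ⟨a₀, q, hq⟩ := hT.exists_linear sτ hτ
        obtain ⟨b₀, p, hp⟩ := hX.exists_linear sξ hξ
        obtain ⟨t, ht⟩ := hT.2.2
        obtain ⟨x, hx⟩ := hX.2.2
        have h3' : ∀ u ∈ E.I, 2 * (α * u + β) * (p - q) * deriv E.K u
            = E.K u * (p - 2 * q) := fun u hu => by
          have := h3 t ht x hx u hu
          rw [hξ x hx, (hp x hx).2, (hq t ht).2] at this
          linear_combination this
        by_cases hpq : p = q
        · -- then `p = q = 0`, and the symmetry belongs to the kernel
          subst hpq
          have hp0 : p = 0 := by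
            refine (mul_eq_zero.1 (?_ : E.K w * p = 0)).resolve_left hKw
            linear_combination h3' w hw
          subst hp0
          refine absurd (mem_kerAlgebra_of_eq (c₀ := a₀) (c₁ := b₀) fun r hr => ?_) hker
          rw [hQe r hr, (hp _ hr.2.1).1, (hp _ hr.2.1).2, (hq _ hr.1).1, (hq _ hr.1).2]
          simp
        · have := sub_ne_zero.2 hpq
          refine ⟨(p - 2 * q) / (2 * (p - q)), fun u hu => ?_⟩
          field_simp
          linear_combination h3' u hu
      · exact ⟨1, fun u hu => by rw [hmK u hu, one_mul]⟩
      · refine ⟨1, fun u hu => ?_⟩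
        have : deriv E.K u = k * deriv E.H u := HasDerivAt.unique (E.hasDerivAt_K hu)
          (((E.hasDerivAt_H hu).const_mul k).congr_of_eventuallyEq (by
            filter_upwards [E.interval.1.mem_nhds hu] with s hs using hk s hs))
        rw [this, hk u hu]
        linear_combination k * hm u hu
    · have hc0 : c = 0 := (mul_eq_zero.1 (hc w hw)).resolve_right hKw
      subst hc0
      exact absurd (mem_kerAlgebra_of_eq (c₀ := c₀) (c₁ := c₁) fun p hp => by
        rw [hQe p hp]; simp) hker

/-- The symmetries of `m H' = μ H`, `m K' = ν K ≠ 0` outside the exceptional exponents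
`μ = ν = -2α` and `μ = ν = -4α`. -/
theorem TelegraphEq.IsLieSymmetry.eq_scaling (hT : IsOpenInterval T) (hX : IsOpenInterval X)
    (hQ : E.IsLieSymmetry T X Q) {α β μ ν : ℝ} (hαβ : α ≠ 0 ∨ β ≠ 0)
    (hH : ∀ u ∈ E.I, (α * u + β) * deriv E.H u = μ * E.H u)
    (hK : ∀ u ∈ E.I, (α * u + β) * deriv E.K u = ν * E.K u)
    {w : ℝ} (hw : w ∈ E.I) (hKw : E.K w ≠ 0) (hμν : μ ≠ 0 ∨ ν ≠ 0)
    (hexc : μ = ν → μ ≠ -2 * α ∧ μ ≠ -4 * α) :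
    ∃ c₀ c₁ s : ℝ, ∀ p ∈ E.domain T X, Q p = (c₀ + s * ((μ - 2 * ν) * p.1),
      c₁ + s * (2 * (μ - ν) * p.2.1), s * (2 * (α * p.2.2 + β))) := by
  by_cases hμ : μ = 0
  · subst hμ
    have hν : ν ≠ 0 := hμν.resolve_left fun h => h rfl
    have hH0 : ∀ u ∈ E.I, deriv E.H u = 0 := fun u hu =>
      E.interval.eq_zero_of_affine_mul hαβ
        (E.smooth_H.deriv_of_isOpen_infty E.interval.1).continuousOn
        (fun u hu => by rw [hH u hu, zero_mul]) hu
    obtain ⟨a, b, c, c₀, c₁, hQe, hab⟩ := hQ.of_deriv_H_eq_zero hT hX hH0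
    -- the two relations for `K` agree near `w`
    have hev : ∀ᶠ u in nhds w, ν * (a * u + b) = -c * (α * u + β) := by
      filter_upwards [E.interval.1.mem_nhds hw,
        (E.hasDerivAt_K hw).continuousAt.eventually_ne hKw] with u hu hKu
      refine mul_right_cancel₀ hKu ?_
      linear_combination (α * u + β) * hab u hu - (a * u + b) * hK u hu
    have ha : ν * a = -c * α := by
      have l (a b : ℝ) : HasDerivAt (fun u => a * u + b) a w := by
        simpa using ((hasDerivAt_id w).const_mul a).add_const b
      exact ((l a b).const_mul ν).unique (((l α β).const_mul (-c)).congr_of_eventuallyEq hev)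
    have hb : ν * b = -c * β := by linear_combination hev.self_of_nhds - w * ha
    refine ⟨c₀, c₁, -c / (2 * ν), fun p hp => ?_⟩
    rw [hQe p hp]
    refine Prod.ext ?_ (Prod.ext ?_ ?_)
    · simp only; field_simp; ring
    · simp only; field_simp; ring
    · simp only; field_simp; linear_combination p.2.2 * ha + hb
  · have hm : ∀ u ∈ E.I, (α / μ * u + β / μ) * deriv E.H u = E.H u := fun u hu => by
      field_simp
      linear_combination hH u hu
    obtain ⟨τ, ξ, sτ, sξ, hQe, h1, h2, h3⟩ := hQ.reduced hT hX hm
    obtain ⟨hτ, hξ⟩ : (∀ t ∈ T, deriv (deriv τ) t = 0) ∧ ∀ x ∈ X, deriv (deriv ξ) x = 0 := by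
      rcases reduced_alternatives hT hX hm hw hKw sτ sξ h1 h2 h3 with
        h | ⟨hα, -, -, hmK⟩ | ⟨hα, -, k, -, hk, -⟩
      · exact h
      · have h4 : μ = ν := by
          have e := hmK w hw
          field_simp at e
          exact mul_right_cancel₀ hKw (by linear_combination hK w hw - e)
        refine absurd ?_ (hexc h4).2
        field_simp at hα
        linarith
      · have h4 : μ = ν := by
          have : deriv E.K w = k * deriv E.H w := HasDerivAt.unique (E.hasDerivAt_K hw)
            (((E.hasDerivAt_H hw).const_mul k).congr_of_eventuallyEq (by
              filter_upwards [E.interval.1.mem_nhds hw] with s hs using hk s hs))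
          refine mul_right_cancel₀ hKw ?_
          rw [← hK w hw, this, hk w hw]
          linear_combination -k * hH w hw
        refine absurd ?_ (hexc h4).1
        field_simp at hα
        linarith
    obtain ⟨a₀, q, hq⟩ := hT.exists_linear sτ hτ
    obtain ⟨b₀, p, hp⟩ := hX.exists_linear sξ hξ
    obtain ⟨t, ht⟩ := hT.2.2
    obtain ⟨x, hx⟩ := hX.2.2
    have hpq : 2 * (p - q) * ν = μ * (p - 2 * q) := by
      have := h3 t ht x hx w hw
      rw [hξ x hx, (hp x hx).2, (hq t ht).2] at this
      field_simp at this
      refine mul_right_cancel₀ hKw ?_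
      linear_combination this - 2 * (p - q) * hK w hw
    refine ⟨a₀, b₀, (p - q) / μ, fun r hr => ?_⟩
    rw [hQe r hr, (hp _ hr.2.1).1, (hp _ hr.2.1).2, (hq _ hr.1).1, (hq _ hr.1).2]
    refine Prod.ext ?_ (Prod.ext ?_ ?_)
    · simp only; field_simp; linear_combination r.1 * hpq
    · simp only; field_simp; linear_combination r.2.1 * hpq
    · simp only; field_simp

/-- The symmetries of `m H' = μ H` with `μ ≠ 0` and `K = 0`. -/
theorem TelegraphEq.IsLieSymmetry.eq_of_K_eq_zero (hT : IsOpenInterval T)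
    (hX : IsOpenInterval X) (hQ : E.IsLieSymmetry T X Q) {α β μ : ℝ} (hμ : μ ≠ 0)
    (hH : ∀ u ∈ E.I, (α * u + β) * deriv E.H u = μ * E.H u) (hK : ∀ u ∈ E.I, E.K u = 0) :
    ∃ a₀ a₁ a₂ b₀ b₁ b₂ : ℝ, (μ + 4 * α) * a₂ = 0 ∧ (3 * μ + 4 * α) * b₂ = 0 ∧
      ∀ p ∈ E.domain T X, Q p = (a₀ + a₁ * p.1 + a₂ * p.1 ^ 2,
        b₀ + b₁ * p.2.1 + b₂ * p.2.1 ^ 2,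
        2 / μ * (α * p.2.2 + β) * (b₁ + 2 * b₂ * p.2.1 - a₁ - 2 * a₂ * p.1)) := by
  have hm : ∀ u ∈ E.I, (α / μ * u + β / μ) * deriv E.H u = E.H u := fun u hu => by
    field_simp
    linear_combination hH u hu
  obtain ⟨τ, ξ, sτ, sξ, hQe, h1, h2, h3⟩ := hQ.reduced hT hX hm
  obtain ⟨t₀, ht₀⟩ := hT.2.2
  obtain ⟨x₀, hx₀⟩ := hX.2.2
  obtain ⟨w, hw⟩ := E.interval.2.2
  have hH' : deriv E.H w ≠ 0 := fun h0 => by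
    have := hm w hw
    rw [h0, mul_zero] at this
    exact E.H_ne_zero w hw this.symm
  have hξ3 : ∀ x ∈ X, deriv (deriv (deriv ξ)) x = 0 := fun x hx => by
    -- the `u`-derivative of `τ''' + H ξ''' = 0`
    refine (mul_eq_zero.1 (?_ : deriv E.H w * _ = 0)).resolve_left hH'
    refine HasDerivAt.unique ((E.hasDerivAt_H hw).mul_const _)
      ((hasDerivAt_const w (-deriv (deriv (deriv τ)) t₀)).congr_of_eventuallyEq ?_)
    filter_upwards [E.interval.1.mem_nhds hw] with s hs
    have := h2 t₀ ht₀ x hx s hs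
    rw [hK s hs] at this
    linear_combination this
  have hτ3 : ∀ t ∈ T, deriv (deriv (deriv τ)) t = 0 := fun t ht => by
    have := h2 t ht x₀ hx₀ w hw
    rw [hK w hw, hξ3 x₀ hx₀] at this
    linear_combination this
  obtain ⟨a₀, a₁, a₂, ha⟩ := hT.exists_quadratic sτ hτ3
  obtain ⟨b₀, b₁, b₂, hb⟩ := hX.exists_quadratic sξ hξ3
  have second {S : Set ℝ} (hS : IsOpen S) {f : ℝ → ℝ} {b c s : ℝ} (hs : s ∈ S)
      (h : ∀ r ∈ S, deriv f r = b + 2 * c * r) : deriv (deriv f) s = 2 * c := by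
    refine HasDerivAt.deriv (HasDerivAt.congr_of_eventuallyEq
      (f := fun r => b + 2 * c * r) ?_ ?_)
    · simpa using ((hasDerivAt_id s).const_mul (2 * c)).const_add b
    · filter_upwards [hS.mem_nhds hs] with r hr using h r hr
  refine ⟨a₀, a₁, a₂, b₀, b₁, b₂, ?_, ?_, fun p hp => ?_⟩
  · have := h1 t₀ ht₀
    rw [second hT.1 ht₀ fun r hr => (ha r hr).2] at this
    have e : μ + 4 * α = μ * (1 + 4 * (α / μ)) := by field_simp
    rw [e]
    linear_combination μ / 2 * this
  · have := h3 t₀ ht₀ x₀ hx₀ w hw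
    rw [hK w hw, deriv_eq_zero_of_eqOn_zero E.interval.1 hK hw,
      second hX.1 hx₀ fun r hr => (hb r hr).2] at this
    refine mul_left_cancel₀ (E.H_ne_zero w hw) ?_
    have e : 3 * μ + 4 * α = μ * (3 + 4 * (α / μ)) := by field_simp
    rw [e]
    linear_combination μ / 2 * this
  · rw [hQe p hp, (ha _ hp.1).1, (ha _ hp.1).2, (hb _ hp.2.1).1, (hb _ hp.2.1).2]
    refine Prod.ext rfl (Prod.ext rfl ?_)
    simp only
    field_simp
    ring

/-- The symmetries of equations with both `H` and `K` proportional to `u⁻⁴`. -/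
theorem TelegraphEq.IsLieSymmetry.eq_of_inv4 (hT : IsOpenInterval T) (hX : IsOpenInterval X)
    (hQ : E.IsLieSymmetry T X Q) (hH : ∀ u ∈ E.I, u * deriv E.H u = -4 * E.H u)
    (hK : ∀ u ∈ E.I, u * deriv E.K u = -4 * E.K u) {w : ℝ} (hw : w ∈ E.I) (hKw : E.K w ≠ 0) :
    ∃ a₀ a₁ a₂ b₀ : ℝ, ∀ p ∈ E.domain T X,
      Q p = (a₀ + a₁ * p.1 + a₂ * p.1 ^ 2, b₀, (a₁ / 2 + a₂ * p.1) * p.2.2) := by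
  have hm : ∀ u ∈ E.I, (-1 / 4 * u + 0) * deriv E.H u = E.H u := fun u hu => by
    linear_combination (-1 / 4) * hH u hu
  obtain ⟨τ, ξ, sτ, sξ, hQe, h1, h2, h3⟩ := hQ.reduced hT hX hm
  obtain ⟨t₀, ht₀⟩ := hT.2.2
  obtain ⟨x₀, hx₀⟩ := hX.2.2
  obtain ⟨hτ, hξ⟩ : (∀ t ∈ T, deriv (deriv (deriv τ)) t = 0) ∧ ∀ x ∈ X, deriv ξ x = 0 := by
    rcases reduced_alternatives hT hX hm hw hKw sτ sξ h1 h2 h3 with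
      ⟨hτ, hξ⟩ | ⟨-, hτ, hξ, -⟩ | ⟨hα, -⟩
    · refine ⟨fun t ht => deriv_eq_zero_of_eqOn_zero hT.1 hτ ht, fun x hx => ?_⟩
      have := h3 t₀ ht₀ x hx w hw
      rw [hξ x hx] at this
      refine mul_left_cancel₀ hKw ?_
      linear_combination this + (1 / 2) * (deriv ξ x - deriv τ t₀) * hK w hw
    · exact ⟨hτ, hξ⟩
    · norm_num at hα
  obtain ⟨a₀, a₁, a₂, ha⟩ := hT.exists_quadratic sτ hτ
  have hb : ∀ x ∈ X, ξ x = ξ x₀ := fun x hx => hX.eq_of_hasDerivAt_zero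
    (fun s hs => hξ s hs ▸ sξ.hasDerivAt_of_isOpen hX.1 hs) hx hx₀
  refine ⟨a₀, a₁, a₂, ξ x₀, fun p hp => ?_⟩
  rw [hQe p hp, (ha _ hp.1).1, (ha _ hp.1).2, hb _ hp.2.1, hξ _ hp.2.1]
  refine Prod.ext rfl (Prod.ext rfl ?_)
  simp only
  ring

/-- The symmetries of equations with `H = K` proportional to `u⁻²`. -/
theorem TelegraphEq.IsLieSymmetry.eq_of_inv2 (hT : IsOpenInterval T) (hX : IsOpenInterval X)
    (hQ : E.IsLieSymmetry T X Q) (hH : ∀ u ∈ E.I, u * deriv E.H u = -2 * E.H u)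
    (hK : ∀ u ∈ E.I, E.K u = E.H u) :
    ∃ a₀ a₁ b₀ b₁ : ℝ, ∀ p ∈ E.domain T X,
      Q p = (a₀ + a₁ * p.1, b₀ + b₁ * Real.exp (-p.2.1),
        (a₁ + b₁ * Real.exp (-p.2.1)) * p.2.2) := by
  have hm : ∀ u ∈ E.I, (-1 / 2 * u + 0) * deriv E.H u = E.H u := fun u hu => by
    linear_combination (-1 / 2) * hH u hu
  obtain ⟨τ, ξ, sτ, sξ, hQe, h1, h2, h3⟩ := hQ.reduced hT hX hm
  obtain ⟨t₀, ht₀⟩ := hT.2.2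
  obtain ⟨w, hw⟩ := E.interval.2.2
  have hHw := E.H_ne_zero w hw
  have hKw : E.K w ≠ 0 := by rwa [hK w hw]
  have hK' : deriv E.K w = deriv E.H w := Filter.EventuallyEq.deriv_eq
    (by filter_upwards [E.interval.1.mem_nhds hw] with s hs using hK s hs)
  have hτ : ∀ t ∈ T, deriv (deriv τ) t = 0 := fun t ht => by linear_combination -h1 t ht
  have hξ : ∀ x ∈ X, deriv (deriv ξ) x = -deriv ξ x := fun x hx => by
    have := h3 t₀ ht₀ x hx w hw
    rw [hK', hK w hw] at this
    refine mul_left_cancel₀ hHw ?_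
    linear_combination this + (deriv ξ x - deriv τ t₀) * hH w hw
  obtain ⟨a₀, a₁, ha⟩ := hT.exists_linear sτ hτ
  have sξ1 := sξ.deriv_of_isOpen_infty hX.1
  have hexp (x : ℝ) : HasDerivAt (fun x : ℝ => Real.exp (-x)) (-Real.exp (-x)) x := by
    simpa using (hasDerivAt_neg x).exp
  obtain ⟨b, hb⟩ := hX.exists_eq_add_const (f := fun x => deriv ξ x * Real.exp x)
    (g := fun _ => 0) (f' := fun _ => 0) (fun s hs =>
      ((sξ1.hasDerivAt_of_isOpen hX.1 hs).mul (Real.hasDerivAt_exp s)).congr_deriv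
        (by rw [hξ s hs]; ring)) (fun s _ => hasDerivAt_const _ _)
  have hb' : ∀ x ∈ X, deriv ξ x = b * Real.exp (-x) := fun x hx => by
    rw [← zero_add b, ← hb x hx, mul_assoc, ← Real.exp_add]
    simp
  obtain ⟨b₀, hb₀⟩ := hX.exists_eq_add_const (f := ξ) (g := fun x => -b * Real.exp (-x))
    (f' := fun x => b * Real.exp (-x)) (fun s hs => hb' s hs ▸ sξ.hasDerivAt_of_isOpen hX.1 hs)
    (fun s _ => ((hexp s).const_mul (-b)).congr_deriv (by ring))
  refine ⟨a₀, a₁, b₀, -b, fun p hp => ?_⟩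
  rw [hQe p hp, (ha _ hp.1).1, (ha _ hp.1).2, hb' _ hp.2.1, hb₀ _ hp.2.1]
  refine Prod.ext rfl (Prod.ext ?_ ?_) <;> simp only <;> ring

end Classification

/-! ### Integration of the classifying equations -/

section Integration

lemma hasDerivAt_abs_rpow_of_ne {u : ℝ} (hu : u ≠ 0) (p : ℝ) :
    HasDerivAt (fun x : ℝ => |x| ^ p) (p * |u| ^ p / u) u := by
  have key : ∀ x : ℝ, x ≠ 0 → |x| ^ p = Real.exp (Real.log x * p) := fun x hx => by
    rw [Real.rpow_def_of_pos (abs_pos.2 hx), Real.log_abs]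
  refine HasDerivAt.congr_of_eventuallyEq (f := fun x => Real.exp (Real.log x * p)) ?_ ?_
  · refine ((Real.hasDerivAt_log hu).mul_const p).exp.congr_deriv ?_
    rw [key u hu]
    ring
  · filter_upwards [isOpen_ne.mem_nhds hu] with x hx using key x hx

lemma zpow_neg_two_eq_abs_rpow (u : ℝ) : u ^ (-2 : ℤ) = |u| ^ (-2 : ℝ) := by
  rw [← Even.zpow_abs (by decide), ← Real.rpow_intCast]
  norm_num

lemma zpow_neg_four_eq_abs_rpow (u : ℝ) : u ^ (-4 : ℤ) = |u| ^ (-4 : ℝ) := by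
  rw [← Even.zpow_abs (by decide), ← Real.rpow_intCast]
  norm_num

variable {S : Set ℝ} {f : ℝ → ℝ}

lemma deriv_eq_of_eqOn (hS : IsOpen S) {g : ℝ → ℝ} (h : ∀ s ∈ S, f s = g s) {s d : ℝ}
    (hs : s ∈ S) (hg : HasDerivAt g d s) : deriv f s = d :=
  (hg.congr_of_eventuallyEq (by filter_upwards [hS.mem_nhds hs] with r hr using h r hr)).deriv

lemma deriv_of_eq_exp (hS : IsOpen S) {k c : ℝ} (h : ∀ s ∈ S, f s = k * Real.exp (c * s)) {s : ℝ}
    (hs : s ∈ S) : deriv f s = c * f s := by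
  refine deriv_eq_of_eqOn hS h hs
    ((((hasDerivAt_id s).const_mul c).exp.const_mul k).congr_deriv ?_)
  rw [h s hs]
  simp only [id]
  ring

lemma mul_deriv_of_eq_abs_rpow (hS : IsOpen S) (h0 : 0 ∉ S) {k c : ℝ}
    (h : ∀ s ∈ S, f s = k * |s| ^ c) {s : ℝ} (hs : s ∈ S) : s * deriv f s = c * f s := by
  have hs0 : s ≠ 0 := fun e => h0 (e ▸ hs)
  rw [deriv_eq_of_eqOn hS h hs ((hasDerivAt_abs_rpow_of_ne hs0 c).const_mul k), h s hs]
  field_simp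

lemma mul_deriv_of_eq_pow (hS : IsOpen S) {k : ℝ} {n : ℕ} (hn : 0 < n)
    (h : ∀ s ∈ S, f s = k * s ^ n) {s : ℝ} (hs : s ∈ S) : s * deriv f s = n * f s := by
  rw [deriv_eq_of_eqOn hS h hs ((hasDerivAt_pow n s).const_mul k), h s hs]
  obtain ⟨m, rfl⟩ := Nat.exists_eq_succ_of_ne_zero hn.ne'
  simp only [Nat.succ_eq_add_one, Nat.add_sub_cancel, pow_succ]
  ring

lemma IsOpenInterval.exists_eq_exp (hS : IsOpenInterval S) {c : ℝ}
    (h : ∀ s ∈ S, HasDerivAt f (c * f s) s) : ∃ k, ∀ s ∈ S, f s = k * Real.exp (c * s) := by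
  obtain ⟨k, hk⟩ := hS.exists_eq_add_const (f := fun s => f s * Real.exp (-(c * s)))
    (g := fun _ => 0) (f' := fun _ => 0) (fun s hs =>
      ((h s hs).mul ((hasDerivAt_id s).const_mul c).neg.exp).congr_deriv (by simp; ring))
      (fun s _ => hasDerivAt_const _ _)
  refine ⟨k, fun s hs => ?_⟩
  rw [← zero_add k, ← hk s hs, mul_assoc, ← Real.exp_add]
  simp

lemma IsOpenInterval.exists_eq_abs_rpow (hS : IsOpenInterval S) {b p : ℝ} (hb : -b ∉ S)
    {f' : ℝ → ℝ} (hf : ∀ s ∈ S, HasDerivAt f (f' s) s) (h : ∀ s ∈ S, (s + b) * f' s = p * f s) :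
    ∃ k, ∀ s ∈ S, f s = k * |s + b| ^ p := by
  have hne : ∀ s ∈ S, s + b ≠ 0 := fun s hs e => hb (by rwa [← eq_neg_of_add_eq_zero_left e])
  obtain ⟨k, hk⟩ := hS.exists_eq_add_const (f := fun s => f s * |s + b| ^ (-p))
    (g := fun _ => 0) (f' := fun _ => 0) (fun s hs => by
      refine ((hf s hs).mul ((hasDerivAt_abs_rpow_of_ne (hne s hs) (-p)).comp_add_const s b)).congr_deriv
        ?_
      have := hne s hs
      field_simp
      linear_combination |s + b| ^ (-p) * h s hs) (fun s _ => hasDerivAt_const _ _)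
  refine ⟨k, fun s hs => ?_⟩
  have h0 : (0 : ℝ) < |s + b| := abs_pos.2 (hne s hs)
  rw [← zero_add k, ← hk s hs, mul_assoc, ← Real.rpow_add h0]
  simp

/-- A smooth solution of the Euler equation `s f' = ν f` through `0` is a monomial with a natural
exponent `ν`, or zero. -/
lemma IsOpenInterval.euler_solution_zero_mem (hS : IsOpenInterval S) (h0 : (0 : ℝ) ∈ S)
    (n : ℕ) {ν : ℝ} (hν : ν ≤ n) (hf : ContDiffOn ℝ ∞ f S)
    (h : ∀ s ∈ S, s * deriv f s = ν * f s) :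
    (∀ s ∈ S, f s = 0) ∨ ∃ m : ℕ, ν = m ∧ ∃ k, ∀ s ∈ S, f s = k * s ^ m := by
  induction n generalizing ν f with
  | zero =>
    -- `(f - f 0)²` has a derivative of the sign of `-s`, so it is maximal at `0`
    have hν0 : ν * f 0 = 0 := by simpa using (h 0 h0).symm
    have hconst : ∀ s ∈ S, f s = f 0 := by
      intro s hs
      have hsub : Set.uIcc 0 s ⊆ S := hS.2.1.uIcc_subset h0 hs
      have hd : ∀ r ∈ S, HasDerivAt (fun r => (f r - f 0) ^ 2)
          (2 * (f r - f 0) * deriv f r) r := fun r hr =>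
        (((hf.hasDerivAt_of_isOpen hS.1 hr).sub_const (f 0)).pow 2).congr_deriv (by simp)
      have hsign : ∀ r ∈ S, r * (2 * (f r - f 0) * deriv f r) ≤ 0 := fun r hr => by
        have : r * (2 * (f r - f 0) * deriv f r) = 2 * ν * (f r - f 0) ^ 2 := by
          linear_combination 2 * (f r - f 0) * h r hr + 2 * (f r - f 0) * hν0
        rw [this]
        have : ν ≤ 0 := by simpa using hν
        nlinarith [sq_nonneg (f r - f 0)]
      have hle : (f s - f 0) ^ 2 ≤ 0 := by
        rcases le_total 0 s with hs0 | hs0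
        · rw [Set.uIcc_of_le hs0] at hsub
          have := antitoneOn_of_deriv_nonpos (convex_Icc 0 s)
            (f := fun r => (f r - f 0) ^ 2)
            (fun r hr => (hd r (hsub hr)).continuousAt.continuousWithinAt)
            (fun r hr => (hd r (hsub (interior_subset hr))).differentiableAt.differentiableWithinAt)
            (fun r hr => by
              rw [(hd r (hsub (interior_subset hr))).deriv]
              rw [interior_Icc] at hr
              exact nonpos_of_mul_nonpos_right (hsign r (hsub (Set.Ioo_subset_Icc_self hr))) hr.1)
          simpa using this (Set.left_mem_Icc.2 hs0) (Set.right_mem_Icc.2 hs0) hs0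
        · rw [Set.uIcc_of_ge hs0] at hsub
          have := monotoneOn_of_deriv_nonneg (convex_Icc s 0)
            (f := fun r => (f r - f 0) ^ 2)
            (fun r hr => (hd r (hsub hr)).continuousAt.continuousWithinAt)
            (fun r hr => (hd r (hsub (interior_subset hr))).differentiableAt.differentiableWithinAt)
            (fun r hr => by
              rw [(hd r (hsub (interior_subset hr))).deriv]
              rw [interior_Icc] at hr
              have := hsign r (hsub (Set.Ioo_subset_Icc_self hr))
              by_contra! hc
              exact absurd this (not_le.2 (mul_pos_of_neg_of_neg hr.2 hc)))
          simpa using this (Set.left_mem_Icc.2 hs0) (Set.right_mem_Icc.2 hs0) hs0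
      exact sub_eq_zero.1 (pow_eq_zero_iff two_ne_zero |>.1 (le_antisymm hle (sq_nonneg _)))
    rcases mul_eq_zero.1 hν0 with rfl | h00
    · exact Or.inr ⟨0, by simp, f 0, fun s hs => by simp [hconst s hs]⟩
    · exact Or.inl fun s hs => by rw [hconst s hs, h00]
  | succ n ih =>
    by_cases hν1 : ν ≤ n
    · exact ih hν1 hf h
    have hνpos : 0 < ν := lt_of_le_of_lt (Nat.cast_nonneg n) (not_le.1 hν1)
    have hf1 := hf.deriv_of_isOpen_infty hS.1
    have h' : ∀ s ∈ S, s * deriv (deriv f) s = (ν - 1) * deriv f s := fun s hs => by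
      have l := (hasDerivAt_id s).mul (hf1.hasDerivAt_of_isOpen hS.1 hs)
      have e := l.unique (((hf.hasDerivAt_of_isOpen hS.1 hs).const_mul ν).congr_of_eventuallyEq
        (by filter_upwards [hS.1.mem_nhds hs] with r hr using h r hr))
      simp only [id] at e
      linear_combination e
    have hfs : ∀ s ∈ S, f s = s * deriv f s / ν := fun s hs => by
      rw [h s hs]
      field_simp
    push_cast at hν
    rcases ih (by linarith) hf1 h' with hz | ⟨m, hm, k, hk⟩
    · exact Or.inl fun s hs => by rw [hfs s hs, hz s hs]; simp
    · refine Or.inr ⟨m + 1, by push_cast; linarith, k / ν, fun s hs => ?_⟩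
      rw [hfs s hs, hk s hs]
      ring

end Integration

section LinearAlgebra

variable {E : TelegraphEq} {T X : Set ℝ}

lemma domRestrict_mem_spanOf_cons {Q R : VField} {B : List VField} (c : ℝ)
    (h : (E.domain T X).domRestrict (fun p => Q p - c • R p) ∈ E.spanOf T X B) :
    (E.domain T X).domRestrict Q ∈ E.spanOf T X (R :: B) := by
  have hle : E.spanOf T X B ≤ E.spanOf T X (R :: B) := by
    refine Submodule.span_le.2 ?_
    rintro _ ⟨i, rfl⟩
    exact domRestrict_mem_spanOf (List.mem_cons_of_mem _ (B.get_mem i))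
  have : (E.domain T X).domRestrict Q = (E.domain T X).domRestrict (fun p => Q p - c • R p)
      + c • (E.domain T X).domRestrict R := by
    funext p
    simp [Set.domRestrict]
  rw [this]
  exact Submodule.add_mem _ (hle h)
    (Submodule.smul_mem _ _ (domRestrict_mem_spanOf List.mem_cons_self))

lemma domRestrict_mem_spanOf_nil {Q : VField} (h : ∀ p ∈ E.domain T X, Q p = 0) :
    (E.domain T X).domRestrict Q ∈ E.spanOf T X [] := by
  have : (E.domain T X).domRestrict Q = 0 := by
    funext p
    exact h p p.2
  rw [this]
  exact Submodule.zero_mem _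

lemma linearIndependent_family_three {Q₁ Q₂ Q₃ : VField}
    (h : ∀ a b c : ℝ, (∀ p ∈ E.domain T X, a • Q₁ p + (b • Q₂ p + c • Q₃ p) = 0) →
      a = 0 ∧ b = 0 ∧ c = 0) : LinearIndependent ℝ (E.family T X [Q₁, Q₂, Q₃]) := by
  refine Fintype.linearIndependent_iff.2 fun (g : Fin 3 → ℝ) hg => ?_
  have hsum : ∑ i : Fin 3, g i • E.family T X [Q₁, Q₂, Q₃] i = 0 := hg
  obtain ⟨h0, h1, h2⟩ := h (g 0) (g 1) (g 2) fun p hp => by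
    have := congrFun hsum ⟨p, hp⟩
    simpa [Fin.sum_univ_succ, TelegraphEq.family] using this
  intro (i : Fin 3)
  fin_cases i
  exacts [h0, h1, h2]

lemma linearIndependent_family_four {Q₁ Q₂ Q₃ Q₄ : VField}
    (h : ∀ a b c d : ℝ,
      (∀ p ∈ E.domain T X, a • Q₁ p + (b • Q₂ p + (c • Q₃ p + d • Q₄ p)) = 0) →
      a = 0 ∧ b = 0 ∧ c = 0 ∧ d = 0) : LinearIndependent ℝ (E.family T X [Q₁, Q₂, Q₃, Q₄]) := by
  refine Fintype.linearIndependent_iff.2 fun (g : Fin 4 → ℝ) hg => ?_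
  have hsum : ∑ i : Fin 4, g i • E.family T X [Q₁, Q₂, Q₃, Q₄] i = 0 := hg
  obtain ⟨h0, h1, h2, h3⟩ := h (g 0) (g 1) (g 2) (g 3) fun p hp => by
    have := congrFun hsum ⟨p, hp⟩
    simpa [Fin.sum_univ_succ, TelegraphEq.family] using this
  intro (i : Fin 4)
  fin_cases i
  exacts [h0, h1, h2, h3]

lemma linearIndependent_family_five {Q₁ Q₂ Q₃ Q₄ Q₅ : VField}
    (h : ∀ a b c d e : ℝ,
      (∀ p ∈ E.domain T X,
        a • Q₁ p + (b • Q₂ p + (c • Q₃ p + (d • Q₄ p + e • Q₅ p))) = 0) →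
      a = 0 ∧ b = 0 ∧ c = 0 ∧ d = 0 ∧ e = 0) :
    LinearIndependent ℝ (E.family T X [Q₁, Q₂, Q₃, Q₄, Q₅]) := by
  refine Fintype.linearIndependent_iff.2 fun (g : Fin 5 → ℝ) hg => ?_
  have hsum : ∑ i : Fin 5, g i • E.family T X [Q₁, Q₂, Q₃, Q₄, Q₅] i = 0 := hg
  obtain ⟨h0, h1, h2, h3, h4⟩ := h (g 0) (g 1) (g 2) (g 3) (g 4) fun p hp => by
    have := congrFun hsum ⟨p, hp⟩
    simpa [Fin.sum_univ_succ, TelegraphEq.family] using this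
  intro (i : Fin 5)
  fin_cases i
  exacts [h0, h1, h2, h3, h4]

lemma IsOpenInterval.exists_ne {S : Set ℝ} (hS : IsOpenInterval S) (a : ℝ) :
    ∃ s ∈ S, s ≠ a := by
  obtain ⟨s, hs⟩ := hS.2.2
  by_cases h : s = a
  · have := hS.1.mem_nhds hs
    obtain ⟨ε, hε, hb⟩ := Metric.mem_nhds_iff.1 this
    refine ⟨s + ε / 2, hb ?_, ?_⟩
    · simp [abs_of_pos, hε]
    · rw [h]; linarith
  · exact ⟨s, hs, h⟩

end LinearAlgebra

/-! ### Maximal invariance algebras for each form of `H` and `K` -/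

section Rows

variable {E : TelegraphEq} {T X : Set ℝ}

lemma IsOpenInterval.exists_affine_ne_zero {S : Set ℝ} (hS : IsOpenInterval S) {α β : ℝ}
    (hαβ : α ≠ 0 ∨ β ≠ 0) : ∃ s ∈ S, α * s + β ≠ 0 := by
  obtain ⟨s, hs, hne⟩ := hS.exists_ne (-β / α)
  refine ⟨s, hs, fun h => ?_⟩
  by_cases hα : α = 0
  · subst hα
    simp at h
    exact hαβ.elim (fun h => h rfl) (fun h' => h' h)
  · exact hne (by field_simp; linarith)

lemma maxAlgebra_eq_spanOf (hT : IsOpenInterval T) (hX : IsOpenInterval X) {B : List VField}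
    (hB : ∀ Q ∈ B, E.IsLieSymmetry T X Q)
    (h : ∀ Q, E.IsLieSymmetry T X Q → (E.domain T X).domRestrict Q ∈ E.spanOf T X B) :
    E.maxAlgebra T X = (E.spanOf T X B : Set (E.domain T X → ℝ × ℝ × ℝ)) := by
  refine Set.Subset.antisymm ?_ (spanOf_subset_maxAlgebra hT hX hB)
  rintro _ ⟨Q, hQ, rfl⟩
  exact h Q hQ

/-- If `m H' = μ H` and `m K' = ν K ≠ 0` for the affine function `m = αu + β`, then, outside the
exceptional exponents, the scaling symmetry is the only extension of the kernel algebra. -/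
lemma basis_of_scaling (hT : IsOpenInterval T) (hX : IsOpenInterval X) {α β μ ν : ℝ}
    (hαβ : α ≠ 0 ∨ β ≠ 0) (hH : ∀ u ∈ E.I, (α * u + β) * deriv E.H u = μ * E.H u)
    (hK : ∀ u ∈ E.I, (α * u + β) * deriv E.K u = ν * E.K u)
    {w : ℝ} (hw : w ∈ E.I) (hKw : E.K w ≠ 0) (hμν : μ ≠ 0 ∨ ν ≠ 0)
    (hexc : μ = ν → μ ≠ -2 * α ∧ μ ≠ -4 * α) {R : VField}
    (hR : R = .mk (fun t _ _ => (μ - 2 * ν) * t) (fun _ x _ => 2 * (μ - ν) * x)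
      (fun _ _ u => 2 * (α * u + β))) :
    E.maxAlgebra T X = (E.spanOf T X [.dt, .dx, R] : Set (E.domain T X → ℝ × ℝ × ℝ)) ∧
      LinearIndependent ℝ (E.family T X [.dt, .dx, R]) := by
  constructor
  · refine maxAlgebra_eq_spanOf hT hX ?_ fun Q hQ => ?_
    · simp only [List.mem_cons, List.not_mem_nil, or_false, forall_eq_or_imp, forall_eq]
      exact ⟨isLieSymmetry_dt hT hX, isLieSymmetry_dx hT hX,
        hR ▸ isLieSymmetry_scaling hT hX hH hK⟩
    · obtain ⟨c₀, c₁, s, h⟩ := hQ.eq_scaling hT hX hαβ hH hK hw hKw hμν hexc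
      refine domRestrict_mem_spanOf_cons c₀ (domRestrict_mem_spanOf_cons c₁
        (domRestrict_mem_spanOf_cons s (domRestrict_mem_spanOf_nil fun p hp => ?_)))
      simp [h p hp, hR, VField.dt, VField.dx, VField.mk]
  · refine linearIndependent_family_three fun a b c h => ?_
    obtain ⟨t, ht⟩ := hT.2.2
    obtain ⟨x, hx⟩ := hX.2.2
    obtain ⟨u, hu, hm⟩ := E.interval.exists_affine_ne_zero hαβ
    have e := h (t, x, u) ⟨ht, hx, hu⟩
    simp only [hR, VField.dt, VField.dx, VField.mk, Prod.smul_mk, smul_eq_mul, Prod.mk_add_mk,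
      Prod.mk_eq_zero] at e
    obtain ⟨e1, e2, e3⟩ := e
    have hc : c = 0 := by
      refine (mul_eq_zero.1 (?_ : c * (α * u + β) = 0)).resolve_right hm
      linarith
    subst hc
    exact ⟨by linarith, by linarith, rfl⟩

lemma basis_any_zero (hT : IsOpenInterval T) (hX : IsOpenInterval X)
    (hK : ∀ u ∈ E.I, E.K u = 0)
    (hexp : ∀ h c : ℝ, ¬ ∀ u ∈ E.I, E.H u = h * Real.exp (c * u))
    (hpow : ∀ h b p : ℝ, ¬ ∀ u ∈ E.I, E.H u = h * |u + b| ^ p) :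
    E.maxAlgebra T X = (E.spanOf T X Row.any_zero.basis : Set (E.domain T X → ℝ × ℝ × ℝ)) ∧
      LinearIndependent ℝ (E.family T X Row.any_zero.basis) := by
  have hH : ∃ v ∈ E.I, deriv E.H v ≠ 0 := by
    by_contra! hc
    exact E.nonlinear ⟨hc, fun u hu => deriv_eq_zero_of_eqOn_zero E.interval.1 hK hu⟩
  constructor
  · refine maxAlgebra_eq_spanOf hT hX ?_ fun Q hQ => ?_
    · simp only [Row.basis, Row.extension, List.mem_cons, List.not_mem_nil, or_false,
        forall_eq_or_imp, forall_eq]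
      exact ⟨isLieSymmetry_dt hT hX, isLieSymmetry_dx hT hX, isLieSymmetry_dilation hT hX hK⟩
    · rcases hQ.dichotomy hT hX hH with ⟨α, β, hm⟩ | ⟨c, c₀, c₁, h, -⟩
      · exfalso
        by_cases hα : α = 0
        · subst hα
          have hβ : β ≠ 0 := by
            rintro rfl
            obtain ⟨w, hw⟩ := E.interval.2.2
            have := hm w hw
            simp only [zero_mul, add_zero] at this
            exact E.H_ne_zero w hw this.symm
          obtain ⟨k, hk⟩ := E.interval.exists_eq_exp (f := E.H) (c := 1 / β) fun u hu =>
            (E.hasDerivAt_H hu).congr_deriv (by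
              have := hm u hu
              field_simp
              linear_combination this)
          exact hexp _ _ hk
        · have hne : -(β / α) ∉ E.I := fun hmem => by
            have := hm _ hmem
            rw [show α * -(β / α) + β = 0 by field_simp; ring, zero_mul] at this
            exact E.H_ne_zero _ hmem this.symm
          obtain ⟨k, hk⟩ := E.interval.exists_eq_abs_rpow (f := E.H) (p := 1 / α) hne
            (fun u hu => E.hasDerivAt_H hu) (fun u hu => by
              have := hm u hu
              field_simp
              linear_combination this)
          exact hpow _ _ _ hk
      · refine domRestrict_mem_spanOf_cons c₀ (domRestrict_mem_spanOf_cons c₁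
          (domRestrict_mem_spanOf_cons c (domRestrict_mem_spanOf_nil fun p hp => ?_)))
        simp [h p hp, VField.dt, VField.dx, VField.mk]
  · refine linearIndependent_family_three fun a b c h => ?_
    obtain ⟨t, ht⟩ := hT.2.2
    obtain ⟨s, hs, hts⟩ := hT.exists_ne t
    obtain ⟨x, hx⟩ := hX.2.2
    obtain ⟨u, hu⟩ := E.interval.2.2
    have e := h (t, x, u) ⟨ht, hx, hu⟩
    have e' := h (s, x, u) ⟨hs, hx, hu⟩
    simp only [VField.dt, VField.dx, VField.mk, Prod.smul_mk, smul_eq_mul, Prod.mk_add_mk,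
      Prod.mk_eq_zero] at e e'
    have hc : c = 0 := by
      refine (mul_eq_zero.1 (?_ : c * (s - t) = 0)).resolve_right (sub_ne_zero.2 hts)
      linear_combination e'.1 - e.1
    subst hc
    exact ⟨by linarith [e.1], by linarith [e.2.1], rfl⟩

lemma basis_exp_zero (hT : IsOpenInterval T) (hX : IsOpenInterval X)
    (hH : ∀ u ∈ E.I, deriv E.H u = E.H u) (hK : ∀ u ∈ E.I, E.K u = 0) :
    E.maxAlgebra T X = (E.spanOf T X Row.exp_zero.basis : Set (E.domain T X → ℝ × ℝ × ℝ)) ∧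
      LinearIndependent ℝ (E.family T X Row.exp_zero.basis) := by
  have hH' : ∀ u ∈ E.I, (0 * u + 1) * deriv E.H u = 1 * E.H u := fun u hu => by
    rw [hH u hu]; ring
  have hK' (ν : ℝ) : ∀ u ∈ E.I, (0 * u + 1) * deriv E.K u = ν * E.K u := fun u hu => by
    rw [deriv_eq_zero_of_eqOn_zero E.interval.1 hK hu, hK u hu]; ring
  constructor
  · refine maxAlgebra_eq_spanOf hT hX ?_ fun Q hQ => ?_
    · simp only [Row.basis, Row.extension, List.mem_cons, List.not_mem_nil, or_false,
        forall_eq_or_imp, forall_eq]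
      refine ⟨isLieSymmetry_dt hT hX, isLieSymmetry_dx hT hX, ?_, ?_⟩
      · -- the scaling symmetry with `ν = 1`, up to its sign
        convert (isLieSymmetry_zero hT hX).add_smul hT hX
          (isLieSymmetry_scaling hT hX hH' (hK' 1)) (-1) using 1
        funext p
        simp only [VField.mk, zero_add, Prod.smul_mk, smul_eq_mul, Prod.mk.injEq]
        exact ⟨by ring, by ring, by ring⟩
      · convert isLieSymmetry_scaling hT hX hH' (hK' (1 / 2)) using 1
        funext p
        simp only [VField.mk, Prod.mk.injEq]
        exact ⟨by ring, by ring, by ring⟩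
    · obtain ⟨a₀, a₁, a₂, b₀, b₁, b₂, ha, hb, h⟩ := hQ.eq_of_K_eq_zero hT hX one_ne_zero hH' hK
      have ha : a₂ = 0 := by linarith
      have hb : b₂ = 0 := by linarith
      subst ha hb
      refine domRestrict_mem_spanOf_cons a₀ (domRestrict_mem_spanOf_cons b₀
        (domRestrict_mem_spanOf_cons a₁ (domRestrict_mem_spanOf_cons b₁
        (domRestrict_mem_spanOf_nil fun p hp => ?_))))
      rw [h p hp]
      simp only [VField.dt, VField.dx, VField.mk, Prod.smul_mk, smul_eq_mul, Prod.mk_sub_mk,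
        Prod.mk_eq_zero]
      exact ⟨by ring, by ring, by ring⟩
  · refine linearIndependent_family_four fun a b c d h => ?_
    obtain ⟨t, ht⟩ := hT.2.2
    obtain ⟨s, hs, hts⟩ := hT.exists_ne t
    obtain ⟨x, hx⟩ := hX.2.2
    obtain ⟨u, hu⟩ := E.interval.2.2
    have e := h (t, x, u) ⟨ht, hx, hu⟩
    have e' := h (s, x, u) ⟨hs, hx, hu⟩
    simp only [VField.dt, VField.dx, VField.mk, Prod.smul_mk, smul_eq_mul, Prod.mk_add_mk,
      Prod.mk_eq_zero] at e e'
    have hc : c = 0 := by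
      refine (mul_eq_zero.1 (?_ : c * (s - t) = 0)).resolve_right (sub_ne_zero.2 hts)
      linear_combination e'.1 - e.1
    have hd : d = 0 := by linarith [e.2.2]
    subst hc hd
    exact ⟨by linarith [e.1], by linarith [e.2.1], rfl, rfl⟩

lemma basis_pow_zero (hT : IsOpenInterval T) (hX : IsOpenInterval X) {μ : ℝ} (hμ : μ ≠ 0)
    (hμ4 : μ ≠ -4) (hμ43 : μ ≠ -4 / 3)
    (hH : ∀ u ∈ E.I, u * deriv E.H u = μ * E.H u) (hK : ∀ u ∈ E.I, E.K u = 0) :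
    E.maxAlgebra T X = (E.spanOf T X (Row.pow_zero μ).basis : Set (E.domain T X → ℝ × ℝ × ℝ)) ∧
      LinearIndependent ℝ (E.family T X (Row.pow_zero μ).basis) := by
  have hH' : ∀ u ∈ E.I, (1 * u + 0) * deriv E.H u = μ * E.H u := fun u hu => by
    rw [← hH u hu]; ring
  have hK' (ν : ℝ) : ∀ u ∈ E.I, (1 * u + 0) * deriv E.K u = ν * E.K u := fun u hu => by
    rw [deriv_eq_zero_of_eqOn_zero E.interval.1 hK hu, hK u hu]; ring
  constructor
  · refine maxAlgebra_eq_spanOf hT hX ?_ fun Q hQ => ?_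
    · simp only [Row.basis, Row.extension, List.mem_cons, List.not_mem_nil, or_false,
        forall_eq_or_imp, forall_eq]
      refine ⟨isLieSymmetry_dt hT hX, isLieSymmetry_dx hT hX, ?_, ?_⟩
      · -- the scaling symmetry with `ν = μ`, up to its sign
        convert (isLieSymmetry_zero hT hX).add_smul hT hX
          (isLieSymmetry_scaling hT hX hH' (hK' μ)) (-1) using 1
        funext p
        simp only [VField.mk, zero_add, Prod.smul_mk, smul_eq_mul, Prod.mk.injEq]
        exact ⟨by ring, by ring, by ring⟩
      · convert isLieSymmetry_scaling hT hX hH' (hK' (μ / 2)) using 1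
        funext p
        simp only [VField.mk, Prod.mk.injEq]
        exact ⟨by ring, by ring, by ring⟩
    · obtain ⟨a₀, a₁, a₂, b₀, b₁, b₂, ha, hb, h⟩ := hQ.eq_of_K_eq_zero hT hX hμ hH' hK
      have ha : a₂ = 0 := (mul_eq_zero.1 ha).resolve_left fun h0 => hμ4 (by linarith)
      have hb : b₂ = 0 := (mul_eq_zero.1 hb).resolve_left fun h0 => hμ43 (by linarith)
      subst ha hb
      refine domRestrict_mem_spanOf_cons a₀ (domRestrict_mem_spanOf_cons b₀
        (domRestrict_mem_spanOf_cons (a₁ / μ) (domRestrict_mem_spanOf_cons (b₁ / μ)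
        (domRestrict_mem_spanOf_nil fun p hp => ?_))))
      rw [h p hp]
      simp only [VField.dt, VField.dx, VField.mk, Prod.smul_mk, smul_eq_mul, Prod.mk_sub_mk,
        Prod.mk_eq_zero]
      refine ⟨?_, ?_, ?_⟩ <;> field_simp <;> ring
  · refine linearIndependent_family_four fun a b c d h => ?_
    obtain ⟨t, ht⟩ := hT.2.2
    obtain ⟨s, hs, hts⟩ := hT.exists_ne t
    obtain ⟨x, hx⟩ := hX.2.2
    obtain ⟨u, hu, hu0⟩ := E.interval.exists_ne 0
    have e := h (t, x, u) ⟨ht, hx, hu⟩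
    have e' := h (s, x, u) ⟨hs, hx, hu⟩
    simp only [VField.dt, VField.dx, VField.mk, Prod.smul_mk, smul_eq_mul, Prod.mk_add_mk,
      Prod.mk_eq_zero] at e e'
    have hc : c = 0 := by
      refine (mul_eq_zero.1 (?_ : c * (μ * (s - t)) = 0)).resolve_right
        (mul_ne_zero hμ (sub_ne_zero.2 hts))
      linear_combination e'.1 - e.1
    have hd : d = 0 := by
      subst hc
      refine (mul_eq_zero.1 (?_ : d * u = 0)).resolve_right hu0
      linarith [e.2.2]
    subst hc hd
    exact ⟨by linarith [e.1], by linarith [e.2.1], rfl, rfl⟩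

lemma basis_inv4_zero (hT : IsOpenInterval T) (hX : IsOpenInterval X)
    (hH : ∀ u ∈ E.I, u * deriv E.H u = -4 * E.H u) (hK : ∀ u ∈ E.I, E.K u = 0) :
    E.maxAlgebra T X = (E.spanOf T X Row.inv4_zero.basis : Set (E.domain T X → ℝ × ℝ × ℝ)) ∧
      LinearIndependent ℝ (E.family T X Row.inv4_zero.basis) := by
  have hH' : ∀ u ∈ E.I, (1 * u + 0) * deriv E.H u = -4 * E.H u := fun u hu => by
    rw [← hH u hu]; ring
  have hK' (ν : ℝ) : ∀ u ∈ E.I, (1 * u + 0) * deriv E.K u = ν * E.K u := fun u hu => by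
    rw [deriv_eq_zero_of_eqOn_zero E.interval.1 hK hu, hK u hu]; ring
  constructor
  · refine maxAlgebra_eq_spanOf hT hX ?_ fun Q hQ => ?_
    · simp only [Row.basis, Row.extension, List.mem_cons, List.not_mem_nil, or_false,
        forall_eq_or_imp, forall_eq]
      refine ⟨isLieSymmetry_dt hT hX, isLieSymmetry_dx hT hX, ?_, ?_,
        isLieSymmetry_projective_t hT hX hH fun u hu => by simpa using hK' (-4) u hu⟩
      · -- half of the scaling symmetry with `ν = -4`
        convert (isLieSymmetry_zero hT hX).add_smul hT hX
          (isLieSymmetry_scaling hT hX hH' (hK' (-4))) (1 / 2) using 1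
        funext p
        simp only [VField.mk, zero_add, Prod.smul_mk, smul_eq_mul, Prod.mk.injEq]
        exact ⟨by ring, by ring, by ring⟩
      · convert (isLieSymmetry_zero hT hX).add_smul hT hX
          (isLieSymmetry_scaling hT hX hH' (hK' (-2))) (-1 / 2) using 1
        funext p
        simp only [VField.mk, zero_add, Prod.smul_mk, smul_eq_mul, Prod.mk.injEq]
        exact ⟨by ring, by ring, by ring⟩
    · obtain ⟨a₀, a₁, a₂, b₀, b₁, b₂, ha, hb, h⟩ :=
        hQ.eq_of_K_eq_zero hT hX (by norm_num) hH' hK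
      have hb : b₂ = 0 := by linarith
      subst hb
      refine domRestrict_mem_spanOf_cons a₀ (domRestrict_mem_spanOf_cons b₀
        (domRestrict_mem_spanOf_cons (a₁ / 2) (domRestrict_mem_spanOf_cons (b₁ / 2)
        (domRestrict_mem_spanOf_cons a₂ (domRestrict_mem_spanOf_nil fun p hp => ?_)))))
      rw [h p hp]
      simp only [VField.dt, VField.dx, VField.mk, Prod.smul_mk, smul_eq_mul, Prod.mk_sub_mk,
        Prod.mk_eq_zero]
      exact ⟨by ring, by ring, by ring⟩
  · refine linearIndependent_family_five fun a b c d f h => ?_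
    obtain ⟨t, ht⟩ := hT.2.2
    obtain ⟨s, hs, hts⟩ := hT.exists_ne t
    obtain ⟨x, hx⟩ := hX.2.2
    obtain ⟨y, hy, hxy⟩ := hX.exists_ne x
    obtain ⟨u, hu, hu0⟩ := E.interval.exists_ne 0
    have e := h (t, x, u) ⟨ht, hx, hu⟩
    have e' := h (s, x, u) ⟨hs, hx, hu⟩
    have e'' := h (t, y, u) ⟨ht, hy, hu⟩
    simp only [VField.dt, VField.dx, VField.mk, Prod.smul_mk, smul_eq_mul, Prod.mk_add_mk,
      Prod.mk_eq_zero] at e e' e''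
    have hf : f = 0 := by
      refine (mul_eq_zero.1 (?_ : f * ((s - t) * u) = 0)).resolve_right
        (mul_ne_zero (sub_ne_zero.2 hts) hu0)
      linear_combination e'.2.2 - e.2.2
    have hd : d = 0 := by
      refine (mul_eq_zero.1 (?_ : d * (y - x) = 0)).resolve_right (sub_ne_zero.2 hxy)
      linear_combination (e''.2.1 - e.2.1) / 2
    have hc : c = 0 := by
      subst hf hd
      refine (mul_eq_zero.1 (?_ : c * u = 0)).resolve_right hu0
      linarith [e.2.2]
    subst hc hd hf
    exact ⟨by linarith [e.1], by linarith [e.2.1], rfl, rfl, rfl⟩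

lemma basis_inv43_zero (hT : IsOpenInterval T) (hX : IsOpenInterval X)
    (hH : ∀ u ∈ E.I, u * deriv E.H u = -4 / 3 * E.H u) (hK : ∀ u ∈ E.I, E.K u = 0) :
    E.maxAlgebra T X = (E.spanOf T X Row.inv43_zero.basis : Set (E.domain T X → ℝ × ℝ × ℝ)) ∧
      LinearIndependent ℝ (E.family T X Row.inv43_zero.basis) := by
  have hH' : ∀ u ∈ E.I, (1 * u + 0) * deriv E.H u = -4 / 3 * E.H u := fun u hu => by
    rw [← hH u hu]; ring
  have hK' (ν : ℝ) : ∀ u ∈ E.I, (1 * u + 0) * deriv E.K u = ν * E.K u := fun u hu => by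
    rw [deriv_eq_zero_of_eqOn_zero E.interval.1 hK hu, hK u hu]; ring
  constructor
  · refine maxAlgebra_eq_spanOf hT hX ?_ fun Q hQ => ?_
    · simp only [Row.basis, Row.extension, List.mem_cons, List.not_mem_nil, or_false,
        forall_eq_or_imp, forall_eq]
      refine ⟨isLieSymmetry_dt hT hX, isLieSymmetry_dx hT hX, ?_, ?_,
        isLieSymmetry_projective_x hT hX hH hK⟩
      · convert (isLieSymmetry_zero hT hX).add_smul hT hX
          (isLieSymmetry_scaling hT hX hH' (hK' (-4 / 3))) (3 / 2) using 1
        funext p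
        simp only [VField.mk, zero_add, Prod.smul_mk, smul_eq_mul, Prod.mk.injEq]
        exact ⟨by ring, by ring, by ring⟩
      · convert (isLieSymmetry_zero hT hX).add_smul hT hX
          (isLieSymmetry_scaling hT hX hH' (hK' (-2 / 3))) (-3 / 2) using 1
        funext p
        simp only [VField.mk, zero_add, Prod.smul_mk, smul_eq_mul, Prod.mk.injEq]
        exact ⟨by ring, by ring, by ring⟩
    · obtain ⟨a₀, a₁, a₂, b₀, b₁, b₂, ha, hb, h⟩ :=
        hQ.eq_of_K_eq_zero hT hX (by norm_num) hH' hK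
      have ha : a₂ = 0 := by linarith
      subst ha
      refine domRestrict_mem_spanOf_cons a₀ (domRestrict_mem_spanOf_cons b₀
        (domRestrict_mem_spanOf_cons (a₁ / 2) (domRestrict_mem_spanOf_cons (b₁ / 2)
        (domRestrict_mem_spanOf_cons b₂ (domRestrict_mem_spanOf_nil fun p hp => ?_)))))
      rw [h p hp]
      simp only [VField.dt, VField.dx, VField.mk, Prod.smul_mk, smul_eq_mul, Prod.mk_sub_mk,
        Prod.mk_eq_zero]
      exact ⟨by ring, by ring, by ring⟩
  · refine linearIndependent_family_five fun a b c d f h => ?_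
    obtain ⟨t, ht⟩ := hT.2.2
    obtain ⟨s, hs, hts⟩ := hT.exists_ne t
    obtain ⟨x, hx⟩ := hX.2.2
    obtain ⟨y, hy, hxy⟩ := hX.exists_ne x
    obtain ⟨u, hu, hu0⟩ := E.interval.exists_ne 0
    have e := h (t, x, u) ⟨ht, hx, hu⟩
    have e' := h (s, x, u) ⟨hs, hx, hu⟩
    have e'' := h (t, y, u) ⟨ht, hy, hu⟩
    simp only [VField.dt, VField.dx, VField.mk, Prod.smul_mk, smul_eq_mul, Prod.mk_add_mk,
      Prod.mk_eq_zero] at e e' e''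
    have hf : f = 0 := by
      refine (mul_eq_zero.1 (?_ : f * ((y - x) * u) = 0)).resolve_right
        (mul_ne_zero (sub_ne_zero.2 hxy) hu0)
      linear_combination (e''.2.2 - e.2.2) / (-3)
    have hc : c = 0 := by
      refine (mul_eq_zero.1 (?_ : c * (s - t) = 0)).resolve_right (sub_ne_zero.2 hts)
      linear_combination (e'.1 - e.1) / 2
    have hd : d = 0 := by
      subst hf hc
      refine (mul_eq_zero.1 (?_ : d * u = 0)).resolve_right hu0
      linarith [e.2.2]
    subst hc hd hf
    exact ⟨by linarith [e.1], by linarith [e.2.1], rfl, rfl, rfl⟩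

lemma basis_inv4_inv4 (hT : IsOpenInterval T) (hX : IsOpenInterval X)
    (hH : ∀ u ∈ E.I, u * deriv E.H u = -4 * E.H u)
    (hKH : ∀ u ∈ E.I, E.K u = E.H u) :
    E.maxAlgebra T X = (E.spanOf T X Row.inv4_inv4.basis : Set (E.domain T X → ℝ × ℝ × ℝ)) ∧
      LinearIndependent ℝ (E.family T X Row.inv4_inv4.basis) := by
  have hK : ∀ u ∈ E.I, u * deriv E.K u = -4 * E.K u := fun u hu => by
    rw [deriv_eq_of_eqOn E.interval.1 hKH hu (E.hasDerivAt_H hu), hKH u hu, hH u hu]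
  have hH' : ∀ u ∈ E.I, (1 * u + 0) * deriv E.H u = -4 * E.H u := fun u hu => by
    rw [← hH u hu]; ring
  have hK' : ∀ u ∈ E.I, (1 * u + 0) * deriv E.K u = -4 * E.K u := fun u hu => by
    rw [← hK u hu]; ring
  constructor
  · refine maxAlgebra_eq_spanOf hT hX ?_ fun Q hQ => ?_
    · simp only [Row.basis, Row.extension, List.mem_cons, List.not_mem_nil, or_false,
        forall_eq_or_imp, forall_eq]
      refine ⟨isLieSymmetry_dt hT hX, isLieSymmetry_dx hT hX, ?_,
        isLieSymmetry_projective_t hT hX hH hK⟩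
      convert (isLieSymmetry_zero hT hX).add_smul hT hX
        (isLieSymmetry_scaling hT hX hH' hK') (1 / 2) using 1
      funext p
      simp only [VField.mk, zero_add, Prod.smul_mk, smul_eq_mul, Prod.mk.injEq]
      exact ⟨by ring, by ring, by ring⟩
    · obtain ⟨w, hw⟩ := E.interval.2.2
      obtain ⟨a₀, a₁, a₂, b₀, h⟩ := hQ.eq_of_inv4 hT hX hH hK hw
        (by rw [hKH w hw]; exact E.H_ne_zero w hw)
      refine domRestrict_mem_spanOf_cons a₀ (domRestrict_mem_spanOf_cons b₀
        (domRestrict_mem_spanOf_cons (a₁ / 2) (domRestrict_mem_spanOf_cons a₂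
        (domRestrict_mem_spanOf_nil fun p hp => ?_))))
      rw [h p hp]
      simp only [VField.dt, VField.dx, VField.mk, Prod.smul_mk, smul_eq_mul, Prod.mk_sub_mk,
        Prod.mk_eq_zero]
      exact ⟨by ring, by ring, by ring⟩
  · refine linearIndependent_family_four fun a b c d h => ?_
    obtain ⟨t, ht⟩ := hT.2.2
    obtain ⟨s, hs, hts⟩ := hT.exists_ne t
    obtain ⟨x, hx⟩ := hX.2.2
    obtain ⟨u, hu, hu0⟩ := E.interval.exists_ne 0
    have e := h (t, x, u) ⟨ht, hx, hu⟩
    have e' := h (s, x, u) ⟨hs, hx, hu⟩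
    simp only [VField.dt, VField.dx, VField.mk, Prod.smul_mk, smul_eq_mul, Prod.mk_add_mk,
      Prod.mk_eq_zero] at e e'
    have hd : d = 0 := by
      refine (mul_eq_zero.1 (?_ : d * ((s - t) * u) = 0)).resolve_right
        (mul_ne_zero (sub_ne_zero.2 hts) hu0)
      linear_combination e'.2.2 - e.2.2
    have hc : c = 0 := by
      subst hd
      refine (mul_eq_zero.1 (?_ : c * u = 0)).resolve_right hu0
      linarith [e.2.2]
    subst hc hd
    exact ⟨by linarith [e.1], by linarith [e.2.1], rfl, rfl⟩

lemma basis_inv2_inv2 (hT : IsOpenInterval T) (hX : IsOpenInterval X)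
    (hH : ∀ u ∈ E.I, u * deriv E.H u = -2 * E.H u)
    (hKH : ∀ u ∈ E.I, E.K u = E.H u) :
    E.maxAlgebra T X = (E.spanOf T X Row.inv2_inv2.basis : Set (E.domain T X → ℝ × ℝ × ℝ)) ∧
      LinearIndependent ℝ (E.family T X Row.inv2_inv2.basis) := by
  have hH' : ∀ u ∈ E.I, (1 * u + 0) * deriv E.H u = -2 * E.H u := fun u hu => by
    rw [← hH u hu]; ring
  have hK' : ∀ u ∈ E.I, (1 * u + 0) * deriv E.K u = -2 * E.K u := fun u hu => by
    rw [deriv_eq_of_eqOn E.interval.1 hKH hu (E.hasDerivAt_H hu), hKH u hu, ← hH u hu]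
    ring
  constructor
  · refine maxAlgebra_eq_spanOf hT hX ?_ fun Q hQ => ?_
    · simp only [Row.basis, Row.extension, List.mem_cons, List.not_mem_nil, or_false,
        forall_eq_or_imp, forall_eq]
      refine ⟨isLieSymmetry_dt hT hX, isLieSymmetry_dx hT hX, ?_,
        isLieSymmetry_exponential hT hX hH hKH⟩
      convert (isLieSymmetry_zero hT hX).add_smul hT hX
        (isLieSymmetry_scaling hT hX hH' hK') (1 / 2) using 1
      funext p
      simp only [VField.mk, zero_add, Prod.smul_mk, smul_eq_mul, Prod.mk.injEq]
      exact ⟨by ring, by ring, by ring⟩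
    · obtain ⟨a₀, a₁, b₀, b₁, h⟩ := hQ.eq_of_inv2 hT hX hH hKH
      refine domRestrict_mem_spanOf_cons a₀ (domRestrict_mem_spanOf_cons b₀
        (domRestrict_mem_spanOf_cons a₁ (domRestrict_mem_spanOf_cons b₁
        (domRestrict_mem_spanOf_nil fun p hp => ?_))))
      rw [h p hp]
      simp only [VField.dt, VField.dx, VField.mk, Prod.smul_mk, smul_eq_mul, Prod.mk_sub_mk,
        Prod.mk_eq_zero]
      exact ⟨by ring, by ring, by ring⟩
  · refine linearIndependent_family_four fun a b c d h => ?_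
    obtain ⟨t, ht⟩ := hT.2.2
    obtain ⟨s, hs, hts⟩ := hT.exists_ne t
    obtain ⟨x, hx⟩ := hX.2.2
    obtain ⟨u, hu, hu0⟩ := E.interval.exists_ne 0
    have e := h (t, x, u) ⟨ht, hx, hu⟩
    have e' := h (s, x, u) ⟨hs, hx, hu⟩
    simp only [VField.dt, VField.dx, VField.mk, Prod.smul_mk, smul_eq_mul, Prod.mk_add_mk,
      Prod.mk_eq_zero] at e e'
    have hc : c = 0 := by
      refine (mul_eq_zero.1 (?_ : c * (s - t) = 0)).resolve_right (sub_ne_zero.2 hts)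
      linear_combination e'.1 - e.1
    have hd : d = 0 := by
      subst hc
      refine (mul_eq_zero.1 (?_ : d * (Real.exp (-x) * u) = 0)).resolve_right
        (mul_ne_zero (Real.exp_ne_zero _) hu0)
      linarith [e.2.2]
    subst hc hd
    exact ⟨by linarith [e.1], by linarith [e.2.1], rfl, rfl⟩

end Rows

/-! ### Each row lists a basis -/

section RowBases

variable {E : TelegraphEq} {σ : ℝ}

lemma ne_zero_of_eq_one_or_neg_one (hσ : σ = 1 ∨ σ = -1) : σ ≠ 0 := by
  rcases hσ with rfl | rfl <;> norm_num

/-- Each row of the table lists a basis of the maximal invariance algebra. -/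
theorem Row.Profile.basis {r : Row} (h : r.Profile σ E) (hr : r.Admissible) {T X : Set ℝ}
    (hT : IsOpenInterval T) (hX : IsOpenInterval X) :
    E.maxAlgebra T X = (E.spanOf T X r.basis : Set (E.domain T X → ℝ × ℝ × ℝ)) ∧
      LinearIndependent ℝ (E.family T X r.basis) := by
  have hI := E.interval.1
  obtain ⟨w, hw⟩ := E.interval.2.2
  obtain ⟨hσ, h⟩ := h
  have hσ0 := ne_zero_of_eq_one_or_neg_one hσ
  have exp_rel {f : ℝ → ℝ} {c : ℝ} (hf : ∀ u ∈ E.I, f u = σ * Real.exp (c * u)) :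
      ∀ u ∈ E.I, (0 * u + 1) * deriv f u = c * f u := fun u hu => by
    rw [deriv_of_eq_exp hI hf hu]; ring
  have pow_rel {f : ℝ → ℝ} {c : ℝ} (h0 : 0 ∉ E.I) (hf : ∀ u ∈ E.I, f u = σ * |u| ^ c) :
      ∀ u ∈ E.I, (1 * u + 0) * deriv f u = c * f u := fun u hu => by
    rw [← mul_deriv_of_eq_abs_rpow hI h0 hf hu]; ring
  have pow_rel' {f : ℝ → ℝ} {c : ℝ} (h0 : 0 ∉ E.I) (hf : ∀ u ∈ E.I, f u = σ * |u| ^ c) :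
      ∀ u ∈ E.I, u * deriv f u = c * f u := fun u hu => mul_deriv_of_eq_abs_rpow hI h0 hf hu
  cases r with
  | any_zero => exact basis_any_zero hT hX (fun u hu => (h.1 u hu).2) h.2.1 h.2.2
  | exp_exp μ ν =>
    have hμν : μ ≠ 0 ∨ ν ≠ 0 := by
      by_contra! hc
      exact hr (by rw [hc.1, hc.2])
    refine basis_of_scaling hT hX (Or.inr one_ne_zero) (exp_rel fun u hu => (h u hu).1)
      (exp_rel fun u hu => (h u hu).2) hw ?_ hμν (fun e => ?_) (by funext p; simp [VField.mk])
    · rw [(h w hw).2]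
      exact mul_ne_zero hσ0 (Real.exp_ne_zero _)
    · subst e
      simpa using hμν
  | exp_one =>
    refine basis_of_scaling (α := 0) (β := 1) (μ := 1) (ν := 0) hT hX (Or.inr one_ne_zero)
      (exp_rel fun u hu => by rw [(h u hu).1, one_mul])
      (exp_rel fun u hu => by rw [(h u hu).2, zero_mul, Real.exp_zero, mul_one]) hw ?_
      (Or.inl one_ne_zero) (fun e => absurd e one_ne_zero) (by funext p; simp [VField.mk])
    rw [(h w hw).2]
    exact hσ0
  | exp_zero =>
    refine basis_exp_zero hT hX (fun u hu => ?_) (fun u hu => (h u hu).2)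
    simpa using exp_rel (c := 1) (fun u hu => by rw [(h u hu).1, one_mul]) u hu
  | pow_pow μ ν =>
    obtain ⟨hμν, h2, h4⟩ := hr
    have hμν : μ ≠ 0 ∨ ν ≠ 0 := by
      by_contra! hc
      exact hμν (by rw [hc.1, hc.2])
    have hexc : μ = ν → μ ≠ -2 * 1 ∧ μ ≠ -4 * 1 := fun e => by
      subst e
      exact ⟨fun e => h2 (by rw [e]; norm_num), fun e => h4 (by rw [e]; norm_num)⟩
    rcases h with ⟨h0, h⟩ | ⟨h0, rfl, n, hn, rfl, h⟩
    · refine basis_of_scaling (α := 1) (β := 0) hT hX (Or.inl one_ne_zero)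
        (pow_rel h0 fun u hu => (h u hu).1) (pow_rel h0 fun u hu => (h u hu).2) hw ?_ hμν hexc
        (by funext p; simp [VField.mk])
      rw [(h w hw).2]
      exact mul_ne_zero hσ0 (Real.rpow_pos_of_pos (abs_pos.2 fun e => h0 (e ▸ hw)) _).ne'
    · obtain ⟨v, hv, hv0⟩ := E.interval.exists_ne 0
      refine basis_of_scaling (α := 1) (β := 0) (w := v) hT hX (Or.inl one_ne_zero)
        (fun u hu => ?_) (fun u hu => ?_) hv ?_ hμν hexc (by funext p; simp [VField.mk])
      · rw [deriv_eq_of_eqOn hI (fun s hs => (h s hs).1) hu (hasDerivAt_const _ _)]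
        ring
      · rw [← mul_deriv_of_eq_pow hI hn (fun s hs => (h s hs).2) hu]
        ring
      · rw [(h v hv).2]
        exact mul_ne_zero hσ0 (pow_ne_zero _ hv0)
  | pow_one μ =>
    refine basis_of_scaling (α := 1) (β := 0) (μ := μ) (ν := 0) hT hX (Or.inl one_ne_zero)
      (pow_rel h.1 fun u hu => (h.2 u hu).1)
      (pow_rel h.1 fun u hu => by rw [(h.2 u hu).2, Real.rpow_zero, mul_one]) hw ?_
      (Or.inl hr) (fun e => absurd e hr) (by funext p; simp [VField.mk])
    rw [(h.2 w hw).2]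
    exact hσ0
  | pow_zero μ =>
    exact basis_pow_zero hT hX hr.1 hr.2.1 hr.2.2 (pow_rel' h.1 fun u hu => (h.2 u hu).1)
      fun u hu => (h.2 u hu).2
  | inv2_inv2 =>
    exact basis_inv2_inv2 hT hX
      (pow_rel' h.1 fun u hu => by rw [(h.2 u hu).1, zpow_neg_two_eq_abs_rpow])
      fun u hu => by rw [(h.2 u hu).1, (h.2 u hu).2]
  | inv4_inv4 =>
    exact basis_inv4_inv4 hT hX
      (pow_rel' h.1 fun u hu => by rw [(h.2 u hu).1, zpow_neg_four_eq_abs_rpow])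
      fun u hu => by rw [(h.2 u hu).1, (h.2 u hu).2]
  | inv4_zero =>
    exact basis_inv4_zero hT hX
      (pow_rel' h.1 fun u hu => by rw [(h.2 u hu).1, zpow_neg_four_eq_abs_rpow])
      fun u hu => (h.2 u hu).2
  | inv43_zero =>
    exact basis_inv43_zero hT hX (pow_rel' h.1 fun u hu => (h.2 u hu).1)
      fun u hu => (h.2 u hu).2

end RowBases

/-! ### Normalization by the equivalence group -/

section Equivalence

lemma IsOpenInterval.image_affine {S : Set ℝ} (hS : IsOpenInterval S) {a : ℝ} (ha : a ≠ 0)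
    (b : ℝ) : IsOpenInterval ((fun u => u * a + b) '' S) := by
  refine ⟨?_, ?_, hS.2.2.image _⟩
  · have : (fun u => u * a + b) '' S = (fun v => (v - b) / a) ⁻¹' S := by
      ext v
      constructor
      · rintro ⟨u, hu, rfl⟩
        simpa [ha] using hu
      · intro hv
        exact ⟨_, hv, by field_simp; ring⟩
    rw [this]
    exact hS.1.preimage (by fun_prop)
  · exact (hS.2.1.isPreconnected.image _ (by fun_prop)).ordConnected

lemma affine_leftInverse {a : ℝ} (ha : a ≠ 0) (b u : ℝ) : (u * a + b - b) / a = u := by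
  field_simp
  ring

lemma hasDerivAt_comp_affine {f : ℝ → ℝ} {f' a b v : ℝ} (hf : HasDerivAt f f' ((v - b) / a)) :
    HasDerivAt (fun v => f ((v - b) / a)) (f' * (1 / a)) v :=
  hf.comp (h := fun v => (v - b) / a) v (((hasDerivAt_id v).sub_const b).div_const a)

/-- The equation with the variable `u` replaced by `v = au + b`, and with `H`, `K` multiplied by
nonzero constants. -/
noncomputable def TelegraphEq.push (E : TelegraphEq) (a b p q : ℝ) (ha : a ≠ 0) (hp : p ≠ 0)
    (hq : q ≠ 0) : TelegraphEq where
  I := (fun u => u * a + b) '' E.I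
  H v := p * E.H ((v - b) / a)
  K v := q * E.K ((v - b) / a)
  interval := E.interval.image_affine ha b
  smooth_H := by
    refine contDiffOn_const.mul (E.smooth_H.comp (ContDiff.contDiffOn (by fun_prop)) ?_)
    rintro _ ⟨u, hu, rfl⟩
    change (u * a + b - b) / a ∈ E.I
    rwa [affine_leftInverse ha]
  smooth_K := by
    refine contDiffOn_const.mul (E.smooth_K.comp (ContDiff.contDiffOn (by fun_prop)) ?_)
    rintro _ ⟨u, hu, rfl⟩
    change (u * a + b - b) / a ∈ E.I
    rwa [affine_leftInverse ha]
  H_ne_zero := by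
    rintro _ ⟨u, hu, rfl⟩
    rw [affine_leftInverse ha]
    exact mul_ne_zero hp (E.H_ne_zero u hu)
  nonlinear := by
    rintro ⟨h1, h2⟩
    refine E.nonlinear ⟨fun u hu => ?_, fun u hu => ?_⟩
    · have e := h1 _ ⟨u, hu, rfl⟩
      have d : HasDerivAt E.H (deriv E.H u) ((u * a + b - b) / a) := by
        rw [affine_leftInverse ha]; exact E.hasDerivAt_H hu
      rw [((hasDerivAt_comp_affine d).const_mul p).deriv] at e
      simpa [hp, ha] using e
    · have e := h2 _ ⟨u, hu, rfl⟩
      have d : HasDerivAt E.K (deriv E.K u) ((u * a + b - b) / a) := by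
        rw [affine_leftInverse ha]; exact E.hasDerivAt_K hu
      rw [((hasDerivAt_comp_affine d).const_mul q).deriv] at e
      simpa [hq, ha] using e

lemma TelegraphEq.Equivalent.refl (E : TelegraphEq) : E.Equivalent E :=
  ⟨⟨0, 0, 0, 1, 1, 1, by norm_num⟩, by simp, fun u _ => by simp⟩

/-- A transformation from the equivalence group as a relation between the arbitrary elements. -/
lemma TelegraphEq.Equivalent.exists_scaling {E E' : TelegraphEq} (h : E.Equivalent E') :
    ∃ a b p q : ℝ, a ≠ 0 ∧ 0 < p ∧ q ≠ 0 ∧ E'.I = (fun u => u * a + b) '' E.I ∧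
      ∀ u ∈ E.I, E'.H (u * a + b) = p * E.H u ∧ E'.K (u * a + b) = q * E.K u := by
  obtain ⟨g, hI, h⟩ := h
  have hg := g.nondegenerate
  have h4 : g.ε₄ ≠ 0 := fun e => hg (by rw [e]; ring)
  have h5 : g.ε₅ ≠ 0 := fun e => hg (by rw [e]; ring)
  have h6 : g.ε₆ ≠ 0 := fun e => hg (by rw [e]; ring)
  refine ⟨g.ε₆, g.ε₃, g.ε₄ ^ (-2 : ℤ) * g.ε₅ ^ 2, g.ε₄ ^ (-2 : ℤ) * g.ε₅, h6, ?_,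
    mul_ne_zero (zpow_ne_zero _ h4) h5, hI, fun u hu => ?_⟩
  · have : (0 : ℝ) < g.ε₄ ^ (-2 : ℤ) := Even.zpow_pos (by decide) h4
    positivity
  · rw [(h u hu).1, (h u hu).2]
    constructor <;> ring

/-- Normalization by the equivalence group: if `H = h F(au + b)` and `K = k G(au + b)`, then the
constant factors can be reduced to the sign of `h`, by scaling `t` and `x`. -/
lemma exists_equivalent_normalized (E : TelegraphEq) {a b h k : ℝ} (ha : a ≠ 0) (hh : h ≠ 0)
    {F G : ℝ → ℝ} (hF : ∀ u ∈ E.I, E.H u = h * F (u * a + b))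
    (hG : ∀ u ∈ E.I, E.K u = k * G (u * a + b)) :
    ∃ (σ : ℝ) (E' : TelegraphEq), (σ = 1 ∨ σ = -1) ∧ E.Equivalent E' ∧
      E'.I = (fun u => u * a + b) '' E.I ∧ (∀ v ∈ E'.I, E'.H v = σ * F v) ∧
      (k = 0 → ∀ v ∈ E'.I, E'.K v = 0) ∧ (k ≠ 0 → ∀ v ∈ E'.I, E'.K v = σ * G v) := by
  -- `ε₅ = k / h` equalizes the two factors, and `ε₄² = ε₅² |h|`
  set e : ℝ := if k = 0 then 1 else k / h with he
  have he0 : e ≠ 0 := by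
    rw [he]
    split_ifs with hk
    · exact one_ne_zero
    · exact div_ne_zero hk hh
  have hh' : 0 < |h| := abs_pos.2 hh
  have hsq : √|h| ≠ 0 := (Real.sqrt_pos.2 hh').ne'
  have hd0 : e * √|h| ≠ 0 := mul_ne_zero he0 hsq
  have hd : (e * √|h|) ^ (-2 : ℤ) = (e ^ 2 * |h|)⁻¹ := by
    rw [show (-2 : ℤ) = -((2 : ℕ) : ℤ) by norm_num, zpow_neg, zpow_natCast, mul_pow,
      Real.sq_sqrt hh'.le]
  have hσ : h / |h| = 1 ∨ h / |h| = -1 := by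
    rcases abs_choice h with h1 | h1 <;> rw [h1]
    · exact Or.inl (div_self hh)
    · exact Or.inr (by field_simp)
  have hp : (e * √|h|) ^ (-2 : ℤ) * e ^ 2 = |h|⁻¹ := by rw [hd]; field_simp
  have hq : (e * √|h|) ^ (-2 : ℤ) * e = (e * |h|)⁻¹ := by rw [hd]; field_simp
  refine ⟨h / |h|, E.push a b _ _ ha
    (mul_ne_zero (zpow_ne_zero (-2) hd0) (pow_ne_zero 2 he0))
    (mul_ne_zero (zpow_ne_zero (-2) hd0) he0), hσ,
    ⟨⟨0, 0, b, e * √|h|, e, a, mul_ne_zero (mul_ne_zero hd0 he0) ha⟩, rfl, fun u hu => ?_⟩, rfl,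
    ?_, ?_, ?_⟩
  · constructor
    · simp only [TelegraphEq.push, affine_leftInverse ha]
      ring
    · simp only [TelegraphEq.push, affine_leftInverse ha]
      ring
  · rintro _ ⟨u, hu, rfl⟩
    simp only [TelegraphEq.push, affine_leftInverse ha]
    rw [hp, hF u hu]
    field_simp
  · rintro rfl _ ⟨u, hu, rfl⟩
    simp only [TelegraphEq.push, affine_leftInverse ha]
    rw [hG u hu]
    ring
  · rintro hk _ ⟨u, hu, rfl⟩
    simp only [TelegraphEq.push, affine_leftInverse ha]
    rw [hq, hG u hu, he, if_neg hk]
    field_simp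

/-- The equation is equivalent to an equation of a normalized row of the table. -/
def TelegraphEq.HasRow (E : TelegraphEq) : Prop :=
  ∃ (r : Row) (σ : ℝ) (E' : TelegraphEq), r.Normalized ∧ r.Profile σ E' ∧ E.Equivalent E'

variable {E : TelegraphEq}

lemma TelegraphEq.not_const (E : TelegraphEq) {h k : ℝ} (hH : ∀ u ∈ E.I, E.H u = h)
    (hK : ∀ u ∈ E.I, E.K u = k) : False :=
  E.nonlinear ⟨fun _ hu => deriv_eq_of_eqOn E.interval.1 hH hu (hasDerivAt_const _ _),
    fun _ hu => deriv_eq_of_eqOn E.interval.1 hK hu (hasDerivAt_const _ _)⟩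

lemma hasRow_of_exp {h c k d : ℝ} (hH : ∀ u ∈ E.I, E.H u = h * Real.exp (c * u))
    (hK : ∀ u ∈ E.I, E.K u = k * Real.exp (d * u)) : E.HasRow := by
  have hh : h ≠ 0 := by
    rintro rfl
    obtain ⟨w, hw⟩ := E.interval.2.2
    exact E.H_ne_zero w hw (by rw [hH w hw, zero_mul])
  by_cases hc : c = 0
  · subst hc
    have hd : d ≠ 0 := by
      rintro rfl
      exact E.not_const (fun u hu => by rw [hH u hu, zero_mul]) fun u hu => by
        rw [hK u hu, zero_mul]
    have hk : k ≠ 0 := by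
      rintro rfl
      exact E.not_const (fun u hu => by rw [hH u hu, zero_mul]) fun u hu => by
        rw [hK u hu, zero_mul]
    obtain ⟨σ, E', hσ, heq, -, hH', -, hK'⟩ := exists_equivalent_normalized E (a := d) (b := 0)
      (F := fun _ => 1) (G := Real.exp) hd hh (fun u hu => by rw [hH u hu]; simp)
      (fun u hu => by rw [hK u hu]; ring_nf)
    exact ⟨.exp_exp 0 1, σ, E', ⟨by simp [Row.Admissible], Or.inr ⟨rfl, rfl⟩⟩,
      ⟨hσ, fun v hv => ⟨by rw [hH' v hv]; simp, by rw [hK' hk v hv, one_mul]⟩⟩, heq⟩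
  · obtain ⟨σ, E', hσ, heq, -, hH', hK0, hK'⟩ := exists_equivalent_normalized E (a := c) (b := 0)
      (F := Real.exp) (G := fun v => Real.exp (d / c * v)) hc hh
      (fun u hu => by rw [hH u hu]; ring_nf)
      (fun u hu => by rw [hK u hu, add_zero, show d / c * (u * c) = d * u by field_simp])
    by_cases hk : k = 0
    · exact ⟨.exp_zero, σ, E', ⟨trivial, trivial⟩,
        ⟨hσ, fun v hv => ⟨hH' v hv, hK0 hk v hv⟩⟩, heq⟩
    by_cases hd : d = 0
    · subst hd
      exact ⟨.exp_one, σ, E', ⟨trivial, trivial⟩,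
        ⟨hσ, fun v hv => ⟨hH' v hv, by rw [hK' hk v hv]; simp⟩⟩, heq⟩
    · exact ⟨.exp_exp 1 (d / c), σ, E',
        ⟨by simp [Row.Admissible], Or.inl ⟨rfl, div_ne_zero hd hc⟩⟩,
        ⟨hσ, fun v hv => ⟨by rw [hH' v hv, one_mul], hK' hk v hv⟩⟩, heq⟩

lemma hasRow_of_pow {h b c k d : ℝ} (hb : -b ∉ E.I) (hH : ∀ u ∈ E.I, E.H u = h * |u + b| ^ c)
    (hK : ∀ u ∈ E.I, E.K u = k * |u + b| ^ d) : E.HasRow := by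
  have hh : h ≠ 0 := by
    rintro rfl
    obtain ⟨w, hw⟩ := E.interval.2.2
    exact E.H_ne_zero w hw (by rw [hH w hw, zero_mul])
  obtain ⟨σ, E', hσ, heq, hI, hH', hK0, hK'⟩ := exists_equivalent_normalized E (a := 1) (b := b)
    (F := fun v => |v| ^ c) (G := fun v => |v| ^ d) one_ne_zero hh
    (fun u hu => by rw [hH u hu, mul_one]) (fun u hu => by rw [hK u hu, mul_one])
  have h0 : 0 ∉ E'.I := by
    rw [hI]
    rintro ⟨u, hu, e⟩
    exact hb (by rwa [show -b = u by simp only at e; linarith])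
  by_cases hk : k = 0
  · have hc : c ≠ 0 := by
      rintro rfl
      exact E.not_const (fun u hu => by rw [hH u hu, Real.rpow_zero]) fun u hu => by
        rw [hK u hu, hk, zero_mul]
    by_cases hc4 : c = -4
    · exact ⟨.inv4_zero, σ, E', ⟨trivial, trivial⟩, ⟨hσ, h0, fun v hv =>
        ⟨by rw [hH' v hv, zpow_neg_four_eq_abs_rpow, hc4], hK0 hk v hv⟩⟩, heq⟩
    by_cases hc43 : c = -4 / 3
    · exact ⟨.inv43_zero, σ, E', ⟨trivial, trivial⟩, ⟨hσ, h0, fun v hv =>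
        ⟨by rw [hH' v hv, hc43], hK0 hk v hv⟩⟩, heq⟩
    exact ⟨.pow_zero c, σ, E', ⟨⟨hc, hc4, hc43⟩, trivial⟩, ⟨hσ, h0, fun v hv =>
      ⟨hH' v hv, hK0 hk v hv⟩⟩, heq⟩
  by_cases hd : d = 0
  · have hc : c ≠ 0 := by
      rintro rfl
      exact E.not_const (fun u hu => by rw [hH u hu, Real.rpow_zero]) fun u hu => by
        rw [hK u hu, hd, Real.rpow_zero]
    exact ⟨.pow_one c, σ, E', ⟨hc, trivial⟩, ⟨hσ, h0, fun v hv =>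
      ⟨hH' v hv, by rw [hK' hk v hv, hd, Real.rpow_zero, mul_one]⟩⟩, heq⟩
  by_cases h2 : (c, d) = (-2, -2)
  · obtain ⟨rfl, rfl⟩ := Prod.mk.inj h2
    exact ⟨.inv2_inv2, σ, E', ⟨trivial, trivial⟩, ⟨hσ, h0, fun v hv => by
      rw [hH' v hv, hK' hk v hv, zpow_neg_two_eq_abs_rpow]
      exact ⟨rfl, rfl⟩⟩, heq⟩
  by_cases h4 : (c, d) = (-4, -4)
  · obtain ⟨rfl, rfl⟩ := Prod.mk.inj h4
    exact ⟨.inv4_inv4, σ, E', ⟨trivial, trivial⟩, ⟨hσ, h0, fun v hv => by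
      rw [hH' v hv, hK' hk v hv, zpow_neg_four_eq_abs_rpow]
      exact ⟨rfl, rfl⟩⟩, heq⟩
  exact ⟨.pow_pow c d, σ, E', ⟨⟨fun e => hd (Prod.mk.inj e).2, h2, h4⟩, hd⟩, ⟨hσ, Or.inl ⟨h0,
    fun v hv => ⟨hH' v hv, hK' hk v hv⟩⟩⟩, heq⟩

lemma hasRow_of_monomial {h b k : ℝ} {n : ℕ} (hb : -b ∈ E.I) (hH : ∀ u ∈ E.I, E.H u = h)
    (hK : ∀ u ∈ E.I, E.K u = k * (u + b) ^ n) : E.HasRow := by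
  have hh : h ≠ 0 := by
    rintro rfl
    obtain ⟨w, hw⟩ := E.interval.2.2
    exact E.H_ne_zero w hw (by rw [hH w hw])
  have hk : k ≠ 0 := by
    rintro rfl
    exact E.not_const hH fun u hu => by rw [hK u hu, zero_mul]
  have hn : 0 < n := by
    by_contra! hn
    exact E.not_const hH fun u hu => by rw [hK u hu, Nat.le_zero.1 hn, pow_zero]
  obtain ⟨σ, E', hσ, heq, hI, hH', hK0, hK'⟩ := exists_equivalent_normalized E (a := 1) (b := b)
    (F := fun v => 1) (G := fun v => v ^ n) one_ne_zero hh
    (fun u hu => by rw [hH u hu, mul_one]) (fun u hu => by rw [hK u hu, mul_one])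
  have h0 : 0 ∈ E'.I := by
    rw [hI]
    exact ⟨-b, hb, by simp⟩
  have hn0 : (n : ℝ) ≠ 0 := Nat.cast_ne_zero.2 hn.ne'
  have hneg (m : ℝ) (hm : m < 0) : ((0 : ℝ), (n : ℝ)) ≠ (m, m) := fun e =>
    hm.ne (Prod.mk.inj e).1.symm
  exact ⟨.pow_pow 0 n, σ, E', ⟨⟨fun e => hn0 (Prod.mk.inj e).2, hneg _ (by norm_num),
    hneg _ (by norm_num)⟩, hn0⟩, ⟨hσ, Or.inr ⟨h0, rfl, n, hn, rfl, fun v hv =>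
    ⟨by rw [hH' v hv, mul_one], hK' hk v hv⟩⟩⟩, heq⟩

/-- If `m H' = μ H` and `m K' = ν K` for an affine function `m ≠ 0`, then integration and
normalization by the equivalence group lead to the table. -/
lemma hasRow_of_relations {α β μ ν : ℝ} (hαβ : α ≠ 0 ∨ β ≠ 0)
    (hH : ∀ u ∈ E.I, (α * u + β) * deriv E.H u = μ * E.H u)
    (hK : ∀ u ∈ E.I, (α * u + β) * deriv E.K u = ν * E.K u) : E.HasRow := by
  by_cases hα : α = 0
  · subst hα
    have hβ : β ≠ 0 := hαβ.resolve_left fun h => h rfl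
    obtain ⟨h, hh⟩ := E.interval.exists_eq_exp (f := E.H) (c := μ / β) fun u hu =>
      (E.hasDerivAt_H hu).congr_deriv (by
        field_simp
        linear_combination hH u hu)
    obtain ⟨k, hk⟩ := E.interval.exists_eq_exp (f := E.K) (c := ν / β) fun u hu =>
      (E.hasDerivAt_K hu).congr_deriv (by
        field_simp
        linear_combination hK u hu)
    exact hasRow_of_exp hh hk
  have hH1 : ∀ u ∈ E.I, (u + β / α) * deriv E.H u = μ / α * E.H u := fun u hu => by
    field_simp
    linear_combination hH u hu
  have hK1 : ∀ u ∈ E.I, (u + β / α) * deriv E.K u = ν / α * E.K u := fun u hu => by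
    field_simp
    linear_combination hK u hu
  by_cases hb : -(β / α) ∈ E.I
  · -- the zero of `m` lies in the interval, which forces `H` to be constant
    have hμ : μ = 0 := by
      have e := hH _ hb
      rw [show α * -(β / α) + β = 0 by field_simp; ring, zero_mul] at e
      exact (mul_eq_zero.1 e.symm).resolve_right (E.H_ne_zero _ hb)
    have hH0 : ∀ u ∈ E.I, deriv E.H u = 0 := fun u hu =>
      E.interval.eq_zero_of_affine_mul hαβ
        (E.smooth_H.deriv_of_isOpen_infty E.interval.1).continuousOn
        (fun u hu => by rw [hH u hu, hμ, zero_mul]) hu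
    have hHc : ∀ u ∈ E.I, E.H u = E.H (-(β / α)) := fun u hu =>
      E.interval.eq_of_hasDerivAt_zero (fun s hs => hH0 s hs ▸ E.hasDerivAt_H hs) hu hb
    -- the equation translated to move the zero of `m` to the origin
    let P : TelegraphEq := E.push 1 (β / α) 1 1 one_ne_zero one_ne_zero one_ne_zero
    have h0 : (0 : ℝ) ∈ P.I := ⟨_, hb, by simp⟩
    have hPK : ∀ s ∈ P.I, s * deriv P.K s = ν / α * P.K s := by
      rintro _ ⟨u, hu, rfl⟩
      have d : HasDerivAt E.K (deriv E.K u) ((u * 1 + β / α - β / α) / 1) := by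
        rw [affine_leftInverse one_ne_zero]; exact E.hasDerivAt_K hu
      have d' : HasDerivAt P.K _ (u * 1 + β / α) := (hasDerivAt_comp_affine d).const_mul 1
      have e : P.K (u * 1 + β / α) = 1 * E.K u := by
        simp only [P, TelegraphEq.push, affine_leftInverse one_ne_zero]
      simp only
      rw [d'.deriv, e]
      linear_combination hK1 u hu
    have hPE : ∀ u ∈ E.I, E.K u = P.K (u + β / α) := fun u hu => by
      simp [P, TelegraphEq.push]
    obtain ⟨n, hn⟩ := exists_nat_ge (ν / α)
    rcases P.interval.euler_solution_zero_mem h0 n hn P.smooth_K hPK with hz | ⟨m, -, k, hk⟩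
    · exact (E.not_const hHc fun u hu => by
        rw [hPE u hu, hz _ ⟨u, hu, by simp⟩]).elim
    · exact hasRow_of_monomial hb hHc fun u hu => by rw [hPE u hu, hk _ ⟨u, hu, by simp⟩]
  · obtain ⟨h, hh⟩ := E.interval.exists_eq_abs_rpow hb (fun u hu => E.hasDerivAt_H hu) hH1
    obtain ⟨k, hk⟩ := E.interval.exists_eq_abs_rpow hb (fun u hu => E.hasDerivAt_K hu) hK1
    exact hasRow_of_pow hb hh hk

/-- For `K = 0` each function `H` belongs to a row: the first one collects all functions that are
neither exponentials nor powers. -/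
lemma hasRow_of_K_eq_zero (hK : ∀ u ∈ E.I, E.K u = 0) : E.HasRow := by
  by_cases hexp : ∃ h c : ℝ, ∀ u ∈ E.I, E.H u = h * Real.exp (c * u)
  · obtain ⟨h, c, hH⟩ := hexp
    exact hasRow_of_exp (k := 0) (d := 0) hH fun u hu => by rw [hK u hu, zero_mul]
  by_cases hpow : ∃ h b p : ℝ, ∀ u ∈ E.I, E.H u = h * |u + b| ^ p
  · obtain ⟨h, b, p, hH⟩ := hpow
    refine hasRow_of_pow (k := 0) (d := 0) (fun hb => ?_) hH fun u hu => by
      rw [hK u hu, zero_mul]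
    -- `H(-b) ≠ 0` would force `p = 0` (with `0 ^ 0 = 1`), a constant `H`
    have hp : p = 0 := by
      by_contra hp
      exact E.H_ne_zero _ hb (by rw [hH _ hb]; simp [hp])
    exact E.not_const (h := h) (k := 0) (fun u hu => by rw [hH u hu, hp]; simp) hK
  push Not at hexp hpow
  -- `H` has a constant sign, as it does not vanish on the interval
  have hsign : (∀ u ∈ E.I, 0 < E.H u) ∨ ∀ u ∈ E.I, E.H u < 0 := by
    by_contra! hc
    obtain ⟨⟨u, hu, h1⟩, v, hv, h2⟩ := hc
    obtain ⟨w, hw, h0⟩ := E.interval.2.1.isPreconnected.intermediate_value hu hv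
      E.smooth_H.continuousOn ⟨h1, h2⟩
    exact E.H_ne_zero w hw h0
  have hnot : (∀ h c : ℝ, ¬ ∀ u ∈ E.I, E.H u = h * Real.exp (c * u)) ∧
      ∀ h b p : ℝ, ¬ ∀ u ∈ E.I, E.H u = h * |u + b| ^ p :=
    ⟨fun h c H => by obtain ⟨u, hu, hne⟩ := hexp h c; exact hne (H u hu),
      fun h b p H => by obtain ⟨u, hu, hne⟩ := hpow h b p; exact hne (H u hu)⟩
  rcases hsign with hs | hs
  · exact ⟨.any_zero, 1, E, ⟨trivial, trivial⟩, ⟨Or.inl rfl, fun u hu =>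
      ⟨by rw [one_mul]; exact hs u hu, hK u hu⟩, hnot⟩, .refl E⟩
  · exact ⟨.any_zero, -1, E, ⟨trivial, trivial⟩, ⟨Or.inr rfl, fun u hu =>
      ⟨by linarith [hs u hu], hK u hu⟩, hnot⟩, .refl E⟩

end Equivalence

/-! ### Invariants of the rows and inequivalence -/

section Extensions

variable {E E' : TelegraphEq} {T X : Set ℝ} {σ σ' : ℝ}

/-- The symmetry `t∂_t + x∂_x` of an equation with `K = 0` does not belong to the kernel. -/
lemma maxAlgebra_ne_of_K_eq_zero (hT : IsOpenInterval T) (hX : IsOpenInterval X)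
    (hK : ∀ u ∈ E.I, E.K u = 0) :
    E.maxAlgebra T X ≠ (E.kerAlgebra T X : Set (E.domain T X → ℝ × ℝ × ℝ)) := fun heq => by
  have hmem := mem_maxAlgebra (isLieSymmetry_dilation hT hX hK)
  rw [heq] at hmem
  obtain ⟨c₀, c₁, h⟩ := exists_eq_of_mem_kerAlgebra hmem
  obtain ⟨t, ht⟩ := hT.2.2
  obtain ⟨s, hs, hts⟩ := hT.exists_ne t
  obtain ⟨x, hx⟩ := hX.2.2
  obtain ⟨u, hu⟩ := E.interval.2.2
  have e1 : t = c₀ := congrArg Prod.fst (h (t, x, u) ⟨ht, hx, hu⟩)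
  have e2 : s = c₀ := congrArg Prod.fst (h (s, x, u) ⟨hs, hx, hu⟩)
  exact hts (e2.trans e1.symm)

/-- The scaling symmetry has `η = 2m ≠ 0`, so it does not belong to the kernel. -/
lemma maxAlgebra_ne_of_relations (hT : IsOpenInterval T) (hX : IsOpenInterval X)
    {α β μ ν : ℝ} (hαβ : α ≠ 0 ∨ β ≠ 0)
    (hH : ∀ u ∈ E.I, (α * u + β) * deriv E.H u = μ * E.H u)
    (hK : ∀ u ∈ E.I, (α * u + β) * deriv E.K u = ν * E.K u) :
    E.maxAlgebra T X ≠ (E.kerAlgebra T X : Set (E.domain T X → ℝ × ℝ × ℝ)) := fun heq => by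
  have hmem := mem_maxAlgebra (isLieSymmetry_scaling hT hX hH hK)
  rw [heq] at hmem
  obtain ⟨c₀, c₁, h⟩ := exists_eq_of_mem_kerAlgebra hmem
  obtain ⟨t, ht⟩ := hT.2.2
  obtain ⟨x, hx⟩ := hX.2.2
  obtain ⟨u, hu, hm⟩ := E.interval.exists_affine_ne_zero hαβ
  have e : 2 * (α * u + β) = 0 := congrArg (fun q => q.2.2) (h (t, x, u) ⟨ht, hx, hu⟩)
  exact hm (by linarith)

/-- The relations `m f' = μ f` with affine `m` are inherited along affine changes of the variable. -/
lemma relation_of_scaling {f g : ℝ → ℝ} {S S' : Set ℝ} (hS : IsOpen S) {a b p α β μ : ℝ}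
    (ha : a ≠ 0) (hp : p ≠ 0) (hmem : ∀ u ∈ S, u * a + b ∈ S')
    (hg : ∀ v ∈ S', HasDerivAt g (deriv g v) v) (hfg : ∀ u ∈ S, g (u * a + b) = p * f u)
    (h : ∀ v ∈ S', (α * v + β) * deriv g v = μ * g v) :
    ∀ u ∈ S, (α * u + (α * b + β) / a) * deriv f u = μ * f u := fun u hu => by
  have hlin : HasDerivAt (fun u => u * a + b) a u := by
    simpa using ((hasDerivAt_id u).mul_const a).add_const b
  have hd : deriv f u = p⁻¹ * (deriv g (u * a + b) * a) := by
    refine deriv_eq_of_eqOn hS (g := fun u => p⁻¹ * g (u * a + b)) (fun s hs => ?_) hu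
      (((hg _ (hmem u hu)).comp u hlin).const_mul _)
    rw [hfg s hs, inv_mul_cancel_left₀ hp]
  have e := h _ (hmem u hu)
  rw [hfg u hu] at e
  rw [hd]
  field_simp
  linear_combination e

/-- `1` for the rows with powers, `0` for the rows with exponentials: the functions `H`, `K` of a row
are eigenfunctions of `m d/du` with `m = slope * u + (1 - slope)`. The value for the row with
arbitrary `H` has no meaning. -/
def Row.slope : Row → ℝ
  | any_zero => 0
  | exp_exp _ _ => 0
  | exp_one => 0
  | exp_zero => 0
  | _ => 1

/-- The exponents of `H` and of `K`, with `0` for `K = 0`. The value for the row with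
arbitrary `H` has no meaning. -/
noncomputable def Row.exponents : Row → ℝ × ℝ
  | any_zero => (0, 0)
  | exp_exp μ ν => (μ, ν)
  | exp_one => (1, 0)
  | exp_zero => (1, 0)
  | pow_pow μ ν => (μ, ν)
  | pow_one μ => (μ, 0)
  | pow_zero μ => (μ, 0)
  | inv2_inv2 => (-2, -2)
  | inv4_inv4 => (-4, -4)
  | inv4_zero => (-4, 0)
  | inv43_zero => (-4 / 3, 0)

/-- Whether the row has `K = 0`. -/
def Row.zeroK : Row → Bool
  | any_zero => true
  | exp_zero => true
  | pow_zero _ => true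
  | inv4_zero => true
  | inv43_zero => true
  | _ => false

/-- The functions `H` and `K` of a row are eigenfunctions of a common operator `m d/du`, with the
exponents as eigenvalues. -/
lemma Row.Profile.relations {r : Row} (h : r.Profile σ E) (hr : r.Normalized)
    (hne : r ≠ .any_zero) :
    (∀ u ∈ E.I, (r.slope * u + (1 - r.slope)) * deriv E.H u = r.exponents.1 * E.H u) ∧
    (∀ u ∈ E.I, (r.slope * u + (1 - r.slope)) * deriv E.K u = r.exponents.2 * E.K u) ∧
    (r.exponents.1 ≠ 0 ∨ r.exponents.2 ≠ 0) ∧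
    ((r.zeroK = true ∧ r.exponents.2 = 0 ∧ ∀ u ∈ E.I, E.K u = 0) ∨
      (r.zeroK = false ∧ ∃ w ∈ E.I, E.K w ≠ 0)) := by
  have hI := E.interval.1
  obtain ⟨w, hw⟩ := E.interval.2.2
  obtain ⟨hσ, h⟩ := h
  have hσ0 := ne_zero_of_eq_one_or_neg_one hσ
  have exp_rel {f : ℝ → ℝ} {c : ℝ} (hf : ∀ u ∈ E.I, f u = σ * Real.exp (c * u)) :
      ∀ u ∈ E.I, (0 * u + (1 - 0)) * deriv f u = c * f u := fun u hu => by
    rw [deriv_of_eq_exp hI hf hu]; ring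
  have pow_rel {f : ℝ → ℝ} {c : ℝ} (h0 : 0 ∉ E.I) (hf : ∀ u ∈ E.I, f u = σ * |u| ^ c) :
      ∀ u ∈ E.I, (1 * u + (1 - 1)) * deriv f u = c * f u := fun u hu => by
    rw [← mul_deriv_of_eq_abs_rpow hI h0 hf hu]; ring
  have zero_rel {m : ℝ → ℝ} {f : ℝ → ℝ} (hf : ∀ u ∈ E.I, f u = 0) :
      ∀ u ∈ E.I, m u * deriv f u = 0 * f u := fun u hu => by
    rw [deriv_eq_zero_of_eqOn_zero hI hf hu]; ring
  cases r with
  | any_zero => exact absurd rfl hne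
  | exp_exp μ ν =>
    refine ⟨exp_rel fun u hu => (h u hu).1, exp_rel fun u hu => (h u hu).2, ?_,
      Or.inr ⟨rfl, w, hw, ?_⟩⟩
    · rcases hr.2 with ⟨-, hν⟩ | ⟨-, hν⟩
      · exact Or.inr hν
      · exact Or.inr (hν ▸ one_ne_zero)
    · rw [(h w hw).2]
      exact mul_ne_zero hσ0 (Real.exp_ne_zero _)
  | exp_one =>
    refine ⟨exp_rel (c := 1) fun u hu => by rw [(h u hu).1, one_mul],
      exp_rel (c := 0) fun u hu => by rw [(h u hu).2, zero_mul, Real.exp_zero, mul_one],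
      Or.inl one_ne_zero, Or.inr ⟨rfl, w, hw, ?_⟩⟩
    rw [(h w hw).2]
    exact hσ0
  | exp_zero =>
    exact ⟨exp_rel (c := 1) fun u hu => by rw [(h u hu).1, one_mul], zero_rel fun u hu => (h u hu).2,
      Or.inl one_ne_zero, Or.inl ⟨rfl, rfl, fun u hu => (h u hu).2⟩⟩
  | pow_pow μ ν =>
    have hν : ν ≠ 0 := hr.2
    rcases h with ⟨h0, h⟩ | ⟨h0, rfl, n, hn, rfl, h⟩
    · refine ⟨pow_rel h0 fun u hu => (h u hu).1, pow_rel h0 fun u hu => (h u hu).2, Or.inr hν,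
        Or.inr ⟨rfl, w, hw, ?_⟩⟩
      rw [(h w hw).2]
      exact mul_ne_zero hσ0 (Real.rpow_pos_of_pos (abs_pos.2 fun e => h0 (e ▸ hw)) _).ne'
    · obtain ⟨v, hv, hv0⟩ := E.interval.exists_ne 0
      refine ⟨fun u hu => ?_, fun u hu => ?_, Or.inr hν, Or.inr ⟨rfl, v, hv, ?_⟩⟩
      · rw [deriv_eq_of_eqOn hI (fun s hs => (h s hs).1) hu (hasDerivAt_const _ _)]
        simp [Row.exponents]
      · have := mul_deriv_of_eq_pow hI hn (fun s hs => (h s hs).2) hu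
        simpa [Row.exponents, Row.slope] using this
      · rw [(h v hv).2]
        exact mul_ne_zero hσ0 (pow_ne_zero _ hv0)
  | pow_one μ =>
    refine ⟨pow_rel h.1 fun u hu => (h.2 u hu).1,
      pow_rel (c := 0) h.1 fun u hu => by rw [(h.2 u hu).2, Real.rpow_zero, mul_one], Or.inl hr.1,
      Or.inr ⟨rfl, w, hw, ?_⟩⟩
    rw [(h.2 w hw).2]
    exact hσ0
  | pow_zero μ =>
    exact ⟨pow_rel h.1 fun u hu => (h.2 u hu).1, zero_rel fun u hu => (h.2 u hu).2,
      Or.inl hr.1.1, Or.inl ⟨rfl, rfl, fun u hu => (h.2 u hu).2⟩⟩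
  | inv2_inv2 =>
    refine ⟨pow_rel (c := -2) h.1 fun u hu => by rw [(h.2 u hu).1, zpow_neg_two_eq_abs_rpow],
      pow_rel (c := -2) h.1 fun u hu => by rw [(h.2 u hu).2, zpow_neg_two_eq_abs_rpow],
      Or.inl (by norm_num [Row.exponents]), Or.inr ⟨rfl, w, hw, ?_⟩⟩
    rw [(h.2 w hw).2]
    exact mul_ne_zero hσ0 (zpow_ne_zero _ fun e => h.1 (e ▸ hw))
  | inv4_inv4 =>
    refine ⟨pow_rel (c := -4) h.1 fun u hu => by rw [(h.2 u hu).1, zpow_neg_four_eq_abs_rpow],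
      pow_rel (c := -4) h.1 fun u hu => by rw [(h.2 u hu).2, zpow_neg_four_eq_abs_rpow],
      Or.inl (by norm_num [Row.exponents]), Or.inr ⟨rfl, w, hw, ?_⟩⟩
    rw [(h.2 w hw).2]
    exact mul_ne_zero hσ0 (zpow_ne_zero _ fun e => h.1 (e ▸ hw))
  | inv4_zero =>
    exact ⟨pow_rel (c := -4) h.1 fun u hu => by rw [(h.2 u hu).1, zpow_neg_four_eq_abs_rpow],
      zero_rel fun u hu => (h.2 u hu).2, Or.inl (by norm_num [Row.exponents]),
      Or.inl ⟨rfl, rfl, fun u hu => (h.2 u hu).2⟩⟩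
  | inv43_zero =>
    exact ⟨pow_rel h.1 fun u hu => (h.2 u hu).1, zero_rel fun u hu => (h.2 u hu).2,
      Or.inl (by norm_num [Row.exponents]), Or.inl ⟨rfl, rfl, fun u hu => (h.2 u hu).2⟩⟩

lemma Row.slope_eq_zero_or_one (r : Row) : r.slope = 0 ∨ r.slope = 1 := by
  cases r <;> simp [Row.slope]

/-- An equation equivalent to a row of the table has additional symmetries. -/
theorem TelegraphEq.HasRow.maxAlgebra_ne (h : E.HasRow) (hT : IsOpenInterval T)
    (hX : IsOpenInterval X) :
    E.maxAlgebra T X ≠ (E.kerAlgebra T X : Set (E.domain T X → ℝ × ℝ × ℝ)) := by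
  obtain ⟨r, σ, E', hr, hprof, heq⟩ := h
  obtain ⟨a, b, p, q, ha, hp, hq, hI, hHK⟩ := heq.exists_scaling
  have hmem : ∀ u ∈ E.I, u * a + b ∈ E'.I := fun u hu => hI ▸ ⟨u, hu, rfl⟩
  by_cases hne : r = .any_zero
  · subst hne
    refine maxAlgebra_ne_of_K_eq_zero hT hX fun u hu => ?_
    have := (hHK u hu).2
    rw [(hprof.2.1 _ (hmem u hu)).2] at this
    exact (mul_eq_zero.1 this.symm).resolve_left hq
  · obtain ⟨hH, hK, -, -⟩ := hprof.relations hr hne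
    refine maxAlgebra_ne_of_relations hT hX (α := r.slope)
      (β := (r.slope * b + (1 - r.slope)) / a) ?_
      (relation_of_scaling E.interval.1 ha hp.ne' hmem (fun v hv => E'.hasDerivAt_H hv)
        (fun u hu => (hHK u hu).1) hH)
      (relation_of_scaling E.interval.1 ha hq hmem (fun v hv => E'.hasDerivAt_K hv)
        (fun u hu => (hHK u hu).2) hK)
    rcases r.slope_eq_zero_or_one with h | h <;> simp [h, ha]

end Extensions

section Inequivalence

variable {E E' : TelegraphEq} {σ σ' : ℝ}

lemma Row.Profile.sigma_mul_H_pos {r : Row} (h : r.Profile σ E) {u : ℝ} (hu : u ∈ E.I) :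
    0 < σ * E.H u := by
  obtain ⟨hσ, h⟩ := h
  have hσ2 : σ * σ = 1 := by rcases hσ with rfl | rfl <;> norm_num
  have key {y : ℝ} (hy : 0 < y) (he : E.H u = σ * y) : 0 < σ * E.H u := by
    rw [he, ← mul_assoc, hσ2, one_mul]
    exact hy
  have pow_pos' (h0 : 0 ∉ E.I) (c : ℝ) : 0 < |u| ^ c :=
    Real.rpow_pos_of_pos (abs_pos.2 fun e => h0 (e ▸ hu)) _
  cases r with
  | any_zero => exact (h.1 u hu).1
  | exp_exp μ ν => exact key (Real.exp_pos _) (h u hu).1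
  | exp_one => exact key (Real.exp_pos _) (h u hu).1
  | exp_zero => exact key (Real.exp_pos _) (h u hu).1
  | pow_pow μ ν =>
    rcases h with ⟨h0, h⟩ | ⟨h0, rfl, n, hn, rfl, h⟩
    · exact key (pow_pos' h0 _) (h u hu).1
    · exact key one_pos (by rw [(h u hu).1, mul_one])
  | pow_one μ => exact key (pow_pos' h.1 _) (h.2 u hu).1
  | pow_zero μ => exact key (pow_pos' h.1 _) (h.2 u hu).1
  | inv2_inv2 => exact key (pow_pos' h.1 _) (by rw [(h.2 u hu).1, zpow_neg_two_eq_abs_rpow])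
  | inv4_inv4 => exact key (pow_pos' h.1 _) (by rw [(h.2 u hu).1, zpow_neg_four_eq_abs_rpow])
  | inv4_zero => exact key (pow_pos' h.1 _) (by rw [(h.2 u hu).1, zpow_neg_four_eq_abs_rpow])
  | inv43_zero => exact key (pow_pos' h.1 _) (h.2 u hu).1

/-- The function `H` is an exponential or a power, up to affine changes of `u`. -/
def TelegraphEq.IsExpOrPow (E : TelegraphEq) : Prop :=
  (∃ h c : ℝ, ∀ u ∈ E.I, E.H u = h * Real.exp (c * u)) ∨
    ∃ h b p : ℝ, ∀ u ∈ E.I, E.H u = h * |u + b| ^ p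

lemma Row.Profile.isExpOrPow {r : Row} (h : r.Profile σ E) (hne : r ≠ .any_zero) :
    E.IsExpOrPow := by
  obtain ⟨-, h⟩ := h
  cases r with
  | any_zero => exact absurd rfl hne
  | exp_exp μ ν => exact Or.inl ⟨σ, μ, fun u hu => (h u hu).1⟩
  | exp_one => exact Or.inl ⟨σ, 1, fun u hu => by rw [(h u hu).1, one_mul]⟩
  | exp_zero => exact Or.inl ⟨σ, 1, fun u hu => by rw [(h u hu).1, one_mul]⟩
  | pow_pow μ ν =>
    rcases h with ⟨h0, h⟩ | ⟨h0, rfl, n, hn, rfl, h⟩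
    · exact Or.inr ⟨σ, 0, μ, fun u hu => by rw [(h u hu).1, add_zero]⟩
    · exact Or.inl ⟨σ, 0, fun u hu => by rw [(h u hu).1]; simp⟩
  | pow_one μ => exact Or.inr ⟨σ, 0, μ, fun u hu => by rw [(h.2 u hu).1, add_zero]⟩
  | pow_zero μ => exact Or.inr ⟨σ, 0, μ, fun u hu => by rw [(h.2 u hu).1, add_zero]⟩
  | inv2_inv2 => exact Or.inr ⟨σ, 0, -2, fun u hu => by
      rw [(h.2 u hu).1, add_zero, zpow_neg_two_eq_abs_rpow]⟩
  | inv4_inv4 => exact Or.inr ⟨σ, 0, -4, fun u hu => by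
      rw [(h.2 u hu).1, add_zero, zpow_neg_four_eq_abs_rpow]⟩
  | inv4_zero => exact Or.inr ⟨σ, 0, -4, fun u hu => by
      rw [(h.2 u hu).1, add_zero, zpow_neg_four_eq_abs_rpow]⟩
  | inv43_zero => exact Or.inr ⟨σ, 0, -4 / 3, fun u hu => by rw [(h.2 u hu).1, add_zero]⟩

lemma TelegraphEq.IsExpOrPow.of_scaling {a b p : ℝ} (ha : a ≠ 0) (hp : p ≠ 0)
    (hmem : ∀ u ∈ E.I, u * a + b ∈ E'.I) (hH : ∀ u ∈ E.I, E'.H (u * a + b) = p * E.H u)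
    (h : E'.IsExpOrPow) : E.IsExpOrPow := by
  rcases h with ⟨h, c, h'⟩ | ⟨h, d, c, h'⟩
  · refine Or.inl ⟨h * Real.exp (c * b) / p, c * a, fun u hu => ?_⟩
    have e := hH u hu
    rw [h' _ (hmem u hu), mul_add, Real.exp_add] at e
    field_simp
    rw [mul_comm (E.H u) p, ← e]
    ring_nf
  · refine Or.inr ⟨h * |a| ^ c / p, (b + d) / a, c, fun u hu => ?_⟩
    have e := hH u hu
    rw [h' _ (hmem u hu), show u * a + b + d = a * (u + (b + d) / a) by field_simp; ring, abs_mul,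
      Real.mul_rpow (abs_nonneg _) (abs_nonneg _)] at e
    rw [eq_comm, div_mul_eq_mul_div, div_eq_iff hp, mul_comm (E.H u) p, ← e]
    ring

lemma TelegraphEq.Equivalent.isExpOrPow_iff (h : E.Equivalent E') :
    E.IsExpOrPow ↔ E'.IsExpOrPow := by
  obtain ⟨a, b, p, q, ha, hp, hq, hI, hHK⟩ := h.exists_scaling
  constructor
  · refine TelegraphEq.IsExpOrPow.of_scaling (a := 1 / a) (b := -b / a) (p := 1 / p)
      (one_div_ne_zero ha) (one_div_ne_zero hp.ne') ?_ ?_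
    · rw [hI]
      rintro _ ⟨u, hu, rfl⟩
      convert hu using 1
      field_simp
      ring
    · rw [hI]
      rintro _ ⟨u, hu, rfl⟩
      simp only
      rw [(hHK u hu).1, show (u * a + b) * (1 / a) + -b / a = u by field_simp; ring]
      field_simp
  · exact TelegraphEq.IsExpOrPow.of_scaling ha hp.ne' (fun u hu => hI ▸ ⟨u, hu, rfl⟩)
      fun u hu => (hHK u hu).1

/-- Two affine functions with `A₁u + B₁ = A₂u + B₂` near a point coincide. -/
lemma affine_eq_of_eventually {A₁ B₁ A₂ B₂ w : ℝ}
    (h : ∀ᶠ u in nhds w, A₁ * u + B₁ = A₂ * u + B₂) : A₁ = A₂ ∧ B₁ = B₂ := by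
  have l (A B : ℝ) : HasDerivAt (fun u => A * u + B) A w := by
    simpa using ((hasDerivAt_id w).const_mul A).add_const B
  have hA : A₁ = A₂ := (l A₁ B₁).unique ((l A₂ B₂).congr_of_eventuallyEq h)
  subst hA
  exact ⟨rfl, by linarith [h.self_of_nhds]⟩

/-- If a function which does not vanish at `w` is an eigenfunction of both `m₁ d/du` and `m₂ d/du`,
then `m₁` and `m₂` are proportional as the eigenvalues are. -/
lemma affine_proportional {S : Set ℝ} (hS : IsOpen S) {f : ℝ → ℝ} {w : ℝ} (hw : w ∈ S)
    (hf : ContinuousAt f w) (hfw : f w ≠ 0) {A₁ B₁ A₂ B₂ μ₁ μ₂ : ℝ}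
    (h₁ : ∀ u ∈ S, (A₁ * u + B₁) * deriv f u = μ₁ * f u)
    (h₂ : ∀ u ∈ S, (A₂ * u + B₂) * deriv f u = μ₂ * f u) :
    A₂ * μ₁ = A₁ * μ₂ ∧ B₂ * μ₁ = B₁ * μ₂ := by
  refine affine_eq_of_eventually (w := w) ?_
  filter_upwards [hS.mem_nhds hw, hf.eventually_ne hfw] with u hu hfu
  refine mul_right_cancel₀ hfu ?_
  linear_combination (A₁ * u + B₁) * h₂ u hu - (A₂ * u + B₂) * h₁ u hu

lemma Row.Normalized.exponents_of_slope_eq_zero {r : Row} (hr : r.Normalized)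
    (hne : r ≠ .any_zero) (hs : r.slope = 0) : r.exponents.1 = 1 ∨ r.exponents = (0, 1) := by
  cases r with
  | any_zero => exact absurd rfl hne
  | exp_exp μ ν => exact hr.2.imp And.left fun h => Prod.ext h.1 h.2
  | exp_one => exact Or.inl rfl
  | exp_zero => exact Or.inl rfl
  | _ => exact absurd hs one_ne_zero

/-- A normalized row is determined by its invariants. -/
lemma Row.eq_of_invariants {r r' : Row} (hr : r.Normalized) (hr' : r'.Normalized)
    (hne : r ≠ .any_zero) (hne' : r' ≠ .any_zero) (hs : r.slope = r'.slope)
    (he : r.exponents = r'.exponents) (hz : r.zeroK = r'.zeroK) : r = r' := by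
  cases r <;> cases r' <;>
    first
    | rfl
    | exact absurd rfl hne
    | exact absurd rfl hne'
    | exact absurd hz Bool.noConfusion
    | exact absurd hs zero_ne_one
    | exact absurd hs one_ne_zero
    | (simp only [Row.exponents, Prod.mk.injEq] at he
       obtain ⟨he₁, he₂⟩ := he
       first
       | (subst he₁; subst he₂; rfl)
       | (subst he₁; rfl)
       | (norm_num at he₁; done)
       | (norm_num at he₂; done)
       | exact absurd he₂ hr.2
       | exact absurd he₂.symm hr'.2
       | exact absurd (Prod.ext he₁ he₂) hr.1.2.1
       | exact absurd (Prod.ext he₁ he₂) hr.1.2.2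
       | exact absurd (Prod.ext he₁.symm he₂.symm) hr'.1.2.1
       | exact absurd (Prod.ext he₁.symm he₂.symm) hr'.1.2.2
       | exact absurd he₁ hr.1.2.1
       | exact absurd he₁ hr.1.2.2
       | exact absurd he₁.symm hr'.1.2.1
       | exact absurd he₁.symm hr'.1.2.2
       | exact hr.2.elim (fun h => absurd he₂ h.2) fun h => absurd (h.2.symm.trans he₂) one_ne_zero
       | exact hr'.2.elim (fun h => absurd he₂.symm h.2)
           fun h => absurd (h.2.symm.trans he₂.symm) one_ne_zero)

/-- Equivalent equations of normalized rows of the table belong to the same row. -/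
theorem Row.eq_of_equivalent {r r' : Row} (hr : r.Normalized) (hr' : r'.Normalized)
    (h : r.Profile σ E) (h' : r'.Profile σ' E') (heq : E.Equivalent E') : r = r' ∧ σ = σ' := by
  obtain ⟨a, b, p, q, ha, hp, hq, hI, hHK⟩ := heq.exists_scaling
  have hmem : ∀ u ∈ E.I, u * a + b ∈ E'.I := fun u hu => hI ▸ ⟨u, hu, rfl⟩
  obtain ⟨w, hw⟩ := E.interval.2.2
  have hHw := E.H_ne_zero w hw
  refine ⟨?_, ?_⟩
  · by_cases hne : r = .any_zero
    · by_contra hrr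
      have hne' : r' ≠ .any_zero := fun e => hrr (hne.trans e.symm)
      subst hne
      rcases heq.isExpOrPow_iff.2 (h'.isExpOrPow hne') with ⟨k, c, hk⟩ | ⟨k, d, c, hk⟩
      · exact h.2.2.1 k c hk
      · exact h.2.2.2 k d c hk
    have hne' : r' ≠ .any_zero := fun e => by
      subst e
      rcases heq.isExpOrPow_iff.1 (h.isExpOrPow hne) with ⟨k, c, hk⟩ | ⟨k, d, c, hk⟩
      · exact h'.2.2.1 k c hk
      · exact h'.2.2.2 k d c hk
    obtain ⟨hH, hK, hμν, hzero⟩ := h.relations hr hne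
    obtain ⟨hH', hK', hμν', hzero'⟩ := h'.relations hr' hne'
    have pH := affine_proportional E.interval.1 hw (E.hasDerivAt_H hw).continuousAt hHw hH
      (relation_of_scaling E.interval.1 ha hp.ne' hmem (fun v hv => E'.hasDerivAt_H hv)
        (fun u hu => (hHK u hu).1) hH')
    have pullK := relation_of_scaling E.interval.1 ha hq hmem (fun v hv => E'.hasDerivAt_K hv)
        (fun u hu => (hHK u hu).2) hK'
    -- `K` vanishes for both equations or for none of them
    have hKz : r.zeroK = r'.zeroK ∧ r'.slope * r.exponents.2 = r.slope * r'.exponents.2 ∧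
        (r'.slope * b + (1 - r'.slope)) / a * r.exponents.2
          = (1 - r.slope) * r'.exponents.2 := by
      rcases hzero with ⟨hz, he, hKz⟩ | ⟨hz, v, hv, hKv⟩ <;>
        rcases hzero' with ⟨hz', he', hKz'⟩ | ⟨hz', v', hv', hKv'⟩
      · rw [hz, hz', he, he']
        simp
      · rw [hI] at hv'
        obtain ⟨u, hu, rfl⟩ := hv'
        exact absurd (by rw [(hHK u hu).2, hKz u hu, mul_zero]) hKv'
      · have := (hHK v hv).2
        rw [hKz' _ (hmem v hv)] at this
        exact absurd ((mul_eq_zero.1 this.symm).resolve_left hq) hKv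
      · exact ⟨hz.trans hz'.symm, affine_proportional E.interval.1 hv
          (E.hasDerivAt_K hv).continuousAt hKv hK pullK⟩
    obtain ⟨hz, pK⟩ := hKz
    have hslope : r.slope = r'.slope := by
      rcases r.slope_eq_zero_or_one with e | e <;> rcases r'.slope_eq_zero_or_one with e' | e' <;>
        simp only [e, e'] at pH pK ⊢
      · refine absurd hμν ?_
        simp only [one_mul, zero_mul] at pH pK
        rw [pH.1, pK.1]
        simp
      · refine absurd hμν' ?_
        simp only [one_mul, zero_mul] at pH pK
        rw [← pH.1, ← pK.1]
        simp
    refine Row.eq_of_invariants hr hr' hne hne' hslope ?_ hz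
    rcases r.slope_eq_zero_or_one with e | e
    · -- exponential rows: the exponents are proportional, hence equal by normalization
      rw [← hslope, e] at pH pK
      have e1 : r.exponents.1 = a * r'.exponents.1 := by
        have := pH.2
        field_simp at this
        linarith
      have e2 : r.exponents.2 = a * r'.exponents.2 := by
        have := pK.2
        field_simp at this
        linarith
      rcases hr.exponents_of_slope_eq_zero hne e with n | n <;>
        rcases hr'.exponents_of_slope_eq_zero hne' (hslope ▸ e) with n' | n'
      · rw [n, n', mul_one] at e1
        refine Prod.ext (n.trans n'.symm) ?_
        rw [e2, ← e1, one_mul]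
      · rw [n'] at e1
        simp [n] at e1
      · rw [n, n', mul_one] at e1
        exact absurd e1.symm ha
      · rw [n, n']
    · rw [← hslope, e] at pH pK
      simp only [one_mul] at pH pK
      exact Prod.ext pH.1 pK.1
  · have s1 := h.sigma_mul_H_pos hw
    have s2 := h'.sigma_mul_H_pos (hmem w hw)
    rw [(hHK w hw).1] at s2
    have s3 : 0 < σ' * E.H w := by
      refine (mul_pos_iff_of_pos_left hp).1 ?_
      linarith
    rcases h.1 with rfl | rfl <;> rcases h'.1 with rfl | rfl
    · rfl
    · linarith
    · linarith
    · rfl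

end Inequivalence

/-! ### Reduction of the inverse square case -/

section Substitution

variable {σ : ℝ} {T Y : Set ℝ} {w : ℝ → ℝ → ℝ}

/-- The substitution `u(t, x) = eˣ w(t, eˣ)` preserves `C²` functions, its inverse being
`w(t, y) = y⁻¹ u(t, log y)`. -/
lemma contDiffOn_exp_substitution_iff (hpos : ∀ y ∈ Y, 0 < y) :
    ContDiffOn ℝ 2 (fun p : ℝ × ℝ => Real.exp p.2 * w p.1 (Real.exp p.2)) (T ×ˢ (Real.exp ⁻¹' Y)) ↔
      ContDiffOn ℝ 2 (fun p : ℝ × ℝ => w p.1 p.2) (T ×ˢ Y) := by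
  constructor <;> intro h
  · have hlog : ContDiffOn ℝ 2 (fun p : ℝ × ℝ => (p.1, Real.log p.2)) (T ×ˢ Y) :=
      contDiffOn_fst.prodMk (contDiffOn_snd.log fun p hp => (hpos _ hp.2).ne')
    have hinv : ContDiffOn ℝ 2 (fun p : ℝ × ℝ => p.2⁻¹) (T ×ˢ Y) :=
      contDiffOn_snd.inv fun p hp => (hpos _ hp.2).ne'
    refine (hinv.mul (h.comp hlog fun p hp => ⟨hp.1, ?_⟩)).congr fun p hp => ?_
    · simpa [Real.exp_log (hpos _ hp.2)] using hp.2
    · simp [Real.exp_log (hpos _ hp.2), (hpos _ hp.2).ne']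
  · have hexp : ContDiff ℝ 2 (fun p : ℝ × ℝ => Real.exp p.2) := contDiff_snd.exp
    exact hexp.contDiffOn.mul
      (h.comp (contDiff_fst.prodMk hexp).contDiffOn fun p hp => ⟨hp.1, hp.2⟩)

/-- With `u(x) = eˣ g(eˣ)`, the flux and the convection term of the equation with
`H = K = σ u⁻²` combine to `eˣ` times the flux term of the equation with `H = σ u⁻²`, `K = 0`. -/
lemma flux_exp_substitution {g : ℝ → ℝ} (hY : IsOpen Y) (hg : ContDiffOn ℝ 2 g Y)
    (hg0 : ∀ y ∈ Y, g y ≠ 0) {x : ℝ} (hx : Real.exp x ∈ Y) :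
    deriv (fun y => σ * (Real.exp y * g (Real.exp y)) ^ (-2 : ℤ)
        * deriv (fun z => Real.exp z * g (Real.exp z)) y) x
      + σ * (Real.exp x * g (Real.exp x)) ^ (-2 : ℤ)
        * deriv (fun z => Real.exp z * g (Real.exp z)) x
      = Real.exp x * deriv (fun y => σ * g y ^ (-2 : ℤ) * deriv g y) (Real.exp x) := by
  have hg1 : ∀ y ∈ Y, HasDerivAt g (deriv g y) y := fun y hy =>
    ((hg.contDiffAt (hY.mem_nhds hy)).differentiableAt (by norm_num)).hasDerivAt
  have hg2 : ∀ y ∈ Y, HasDerivAt (deriv g) (deriv (deriv g) y) y := fun y hy =>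
    (((hg.deriv_of_isOpen (m := 1) hY (by norm_num)).contDiffAt
      (hY.mem_nhds hy)).differentiableAt (by norm_num)).hasDerivAt
  have hu : ∀ y ∈ Real.exp ⁻¹' Y, HasDerivAt (fun z => Real.exp z * g (Real.exp z))
      (Real.exp y * g (Real.exp y) + Real.exp y * (deriv g (Real.exp y) * Real.exp y)) y :=
    fun y hy => (Real.hasDerivAt_exp y).mul ((hg1 _ hy).comp y (Real.hasDerivAt_exp y))
  -- the flux of `u` in terms of `g`
  have hflux : ∀ y ∈ Real.exp ⁻¹' Y, σ * (Real.exp y * g (Real.exp y)) ^ (-2 : ℤ)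
        * deriv (fun z => Real.exp z * g (Real.exp z)) y
      = σ * ((Real.exp y * g (Real.exp y))⁻¹ + deriv g (Real.exp y) / g (Real.exp y) ^ 2) := by
    intro y hy
    have h0 := hg0 _ hy
    have he := Real.exp_ne_zero y
    rw [(hu y hy).deriv, zpow_neg, show ((2 : ℤ)) = ((2 : ℕ) : ℤ) from rfl, zpow_natCast]
    field_simp
  have h0 := hg0 _ hx
  have he := Real.exp_ne_zero x
  have hd1 := (hg1 _ hx).comp x (Real.hasDerivAt_exp x)
  have hd2 := (hg2 _ hx).comp x (Real.hasDerivAt_exp x)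
  have hright : deriv (fun y => σ * g y ^ (-2 : ℤ) * deriv g y) (Real.exp x) = _ :=
    deriv_eq_of_eqOn (g := fun y => σ * (deriv g y / g y ^ 2)) hY (fun y _ => by
      rw [zpow_neg, show ((2 : ℤ)) = ((2 : ℕ) : ℤ) from rfl, zpow_natCast]
      ring) hx (((hg2 _ hx).div ((hg1 _ hx).pow 2) (pow_ne_zero 2 h0)).const_mul σ)
  rw [deriv_eq_of_eqOn (hY.preimage Real.continuous_exp) hflux hx
      ((((hu x hx).inv (mul_ne_zero he h0)).add (hd2.div (hd1.pow 2) (pow_ne_zero 2 h0))).const_mul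
        σ),
    hflux x hx, hright]
  simp only [Function.comp, Pi.pow_apply]
  field_simp
  push_cast
  ring

theorem isNonvanishingSolution_exp_substitution_iff (hY : IsOpen Y) (hpos : ∀ y ∈ Y, 0 < y) :
    IsNonvanishingSolution (fun u => σ * u ^ (-2 : ℤ)) (fun _ => 0) T Y w ↔
      IsNonvanishingSolution (fun u => σ * u ^ (-2 : ℤ)) (fun u => σ * u ^ (-2 : ℤ))
        T (Real.exp ⁻¹' Y) (fun t x => Real.exp x * w t (Real.exp x)) := by
  refine (and_congr_right fun h => ?_).trans
    (and_congr_left' (contDiffOn_exp_substitution_iff hpos).symm)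
  refine forall₂_congr fun t ht => ?_
  have hwt : ContDiffOn ℝ 2 (w t) Y :=
    h.comp (contDiff_const.prodMk contDiff_id).contDiffOn fun y hy => ⟨ht, hy⟩
  -- the equation for `u` at `(t, x)` is `eˣ` times the equation for `w` at `(t, eˣ)`
  have key (hn : ∀ y ∈ Y, w t y ≠ 0) {x : ℝ} (hx : Real.exp x ∈ Y) :
      deriv (fun s => deriv (fun s' => w s' (Real.exp x)) s) t =
          deriv (fun y => σ * w t y ^ (-2 : ℤ) * deriv (fun y' => w t y') y) (Real.exp x)
            + 0 * deriv (fun y => w t y) (Real.exp x) ↔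
        deriv (fun s => deriv (fun s' => Real.exp x * w s' (Real.exp x)) s) t =
          deriv (fun y => σ * (Real.exp y * w t (Real.exp y)) ^ (-2 : ℤ)
              * deriv (fun y' => Real.exp y' * w t (Real.exp y')) y) x
            + σ * (Real.exp x * w t (Real.exp x)) ^ (-2 : ℤ)
              * deriv (fun y => Real.exp y * w t (Real.exp y)) x := by
    rw [flux_exp_substitution hY hwt hn hx, zero_mul, add_zero]
    simp only [deriv_const_mul_field]
    exact (mul_right_inj' (Real.exp_ne_zero x)).symm
  constructor
  · intro H x hx
    exact ⟨mul_ne_zero (Real.exp_ne_zero x) (H _ hx).1,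
      (key (fun y hy => (H y hy).1) hx).1 (H _ hx).2⟩
  · intro H
    have hlog {y : ℝ} (hy : y ∈ Y) : Real.exp (Real.log y) ∈ Y := by rwa [Real.exp_log (hpos y hy)]
    have hn : ∀ y ∈ Y, w t y ≠ 0 := fun y hy => by
      have := right_ne_zero_of_mul (H _ (hlog hy)).1
      rwa [Real.exp_log (hpos y hy)] at this
    intro y hy
    have := (key hn (hlog hy)).2 (H _ (hlog hy)).2
    rw [Real.exp_log (hpos y hy)] at this
    exact ⟨hn y hy, this⟩

end Substitution

theorem mainTheorem3 :
    -- every equation of the class admits the kernel algebra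
    (∀ (E : TelegraphEq) (T X : Set ℝ), IsOpenInterval T → IsOpenInterval X →
      (E.kerAlgebra T X : Set (E.domain T X → ℝ × ℝ × ℝ)) ⊆ E.maxAlgebra T X) ∧
    -- the extensions are exhausted, up to equivalence, by the rows of the table
    (∀ (E : TelegraphEq) (T X : Set ℝ), IsOpenInterval T → IsOpenInterval X →
      (E.maxAlgebra T X ≠ (E.kerAlgebra T X : Set (E.domain T X → ℝ × ℝ × ℝ)) ↔
        ∃ (r : Row) (σ : ℝ) (E' : TelegraphEq),
          r.Normalized ∧ r.Profile σ E' ∧ E.Equivalent E')) ∧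
    -- each row lists a basis of the maximal invariance algebra
    (∀ (r : Row) (σ : ℝ) (E : TelegraphEq) (T X : Set ℝ), IsOpenInterval T → IsOpenInterval X →
      r.Admissible → r.Profile σ E →
        E.maxAlgebra T X = (E.spanOf T X r.basis : Set (E.domain T X → ℝ × ℝ × ℝ)) ∧
        LinearIndependent ℝ (E.family T X r.basis)) ∧
    -- the rows are pairwise inequivalent
    (∀ (r r' : Row) (σ σ' : ℝ) (E E' : TelegraphEq),
      r.Normalized → r'.Normalized → r.Profile σ E → r'.Profile σ' E' →
        E.Equivalent E' → r = r' ∧ σ = σ') ∧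
    -- the row `H = K = u⁻²` is reduced to the row `H = u⁻², K = 0` by `x̃ = eˣ, ũ = e⁻ˣ u`
    (∀ (σ : ℝ) (T Y : Set ℝ) (w : ℝ → ℝ → ℝ), (σ = 1 ∨ σ = -1) → IsOpen T → IsOpen Y →
      (∀ y ∈ Y, 0 < y) →
        (IsNonvanishingSolution (fun u => σ * u ^ (-2 : ℤ)) (fun _ => 0) T Y w ↔
          IsNonvanishingSolution (fun u => σ * u ^ (-2 : ℤ)) (fun u => σ * u ^ (-2 : ℤ))
            T (Real.exp ⁻¹' Y) (fun t x => Real.exp x * w t (Real.exp x)))) := by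
  refine ⟨fun E T X hT hX => kerAlgebra_subset_maxAlgebra hT hX,
    fun E T X hT hX => ⟨fun hne => ?_, fun h => TelegraphEq.HasRow.maxAlgebra_ne h hT hX⟩,
    fun r σ E T X hT hX hr h => h.basis hr hT hX,
    fun r r' σ σ' E E' hr hr' h h' heq => Row.eq_of_equivalent hr hr' h h' heq,
    fun σ T Y w _ _ hY hpos => isNonvanishingSolution_exp_substitution_iff hY hpos⟩
  exact (exists_affine_relations hT hX hne).elim hasRow_of_K_eq_zero
    fun ⟨_, _, _, _, hαβ, hH, hK⟩ => hasRow_of_relations hαβ hH hK
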